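/- **Conventions.** A metric measure space (mm-space) $(X,d,m)$ is a Polish space $X$ with a complete separable metric $d$ inducing its topology and a Borel measure $m$ with full topological support such that $\int e^{-C d^2(x,z)}\,dm(x)<\infty$ for some $C\in\mathbb R$, $z\in X$; it has normalized volume if $m(X)=1$. $W$ denotes the $L^2$-Kantorovich–Wasserstein distance (with values in $[0,\infty]$) on the set $\mathcal P(X)$ of Borel probability measures, and $S(\mu)=\int u\log u\,dm$ if $\mu=u\,m$ with $\int (u\log u)_+\,dm<\infty$, $S(\mu)=\infty$ otherwise. A $W$-geodesic $(\mu^a)_{a\in[-1,1]}$ is a curve in $\mathcal P(X)$ with $W(\mu^{-1},\mu^1)<\infty$ and $W(\mu^a,\mu^b)=\tfrac{|a-b|}2W(\mu^{-1},\mu^1)$ for all $a,b\in[-1,1]$. Let $K\in\mathbb R$. The mm-space $(X,d,m)$ has *robust synthetic upper Ricci bound $K$ with approximation function $\overline K$* if $\overline K:(0,\infty)\to(-\infty,\infty]$ is upper semicontinuous with $\lim_{r\to0}\overline K(r)=K$ and if for all $r>0$ with $\overline K(r)<\infty$, all $x,y\in X$ with $d(x,y)=r$, and all $\mu^0\in\mathcal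 P(X)$ with $W(\mu^0,\delta_x)<r^4$ there exists a $W$-geodesic $(\mu^a)_{a\in[-1,1]}$ with the given $\mu^0$ as its value at $a=0$, with $W(\mu^1,\delta_y)\le r^2$, and with $$S(\mu^1)-2S(\mu^0)+S(\mu^{-1})\le \overline K(r)\cdot r^2,$$ where for $S(\mu^0)=\infty$ the inequality is regarded as satisfied. For mm-spaces with normalized volume, $\mathbb D_2\big((X,d,m),(X',d',m')\big)=\inf\big(\int_{X\times X'}\hat d(x,x')^2\,dq(x,x')\big)^{1/2}$, the infimum being over all couplings $q$ of $m$ and $m'$ and all pseudo-metrics $\hat d$ on the disjoint union $X\sqcup X'$ that restrict to $d$ on $X$ and to $d'$ on $X'$. **Theorem.** Let $K\in\mathbb R$ and $\overline K$ be given with $\lim_{r\to0}\overline K(r)=K$. Let $(X_n,d_n,m_n)$, $n\in\mathbb N$, be mm-spaces with normalized volume such that each $(X_n,d_n,m_n)$ has robust synthetic upper Ricci bound $K$ with approximation function $\overline K$, and such that, as $n\to\infty$, they converge with respect to $\mathbb D_2$ to a locally compact mm-space $(X,d,m)$ with normalized volume. Then $(X,d,m)$ has robust synthetic upper Ricci bound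 $K$ with approximation function $\overline K$. -/

import Mathlib

open MeasureTheory Filter Topology
open scoped ENNReal

noncomputable section

namespace SyntheticRicci

/-- The standing assumptions on the measure `m` of a metric measure space `(X, d, m)`: full
topological support and `∫ exp (-C d(x,z)²) dm(x) < ∞` for some `C ∈ ℝ` and `z ∈ X`. That `d` is a
complete separable metric and that `m` is a Borel measure is expressed by type classes. -/
structure IsMMSpace {X : Type*} [MetricSpace X] [CompleteSpace X] [SecondCountableTopology X]
    [MeasurableSpace X] [BorelSpace X] (m : Measure X) : Prop where
  fullSupport : ∀ U : Set X, IsOpen U → U.Nonempty → 0 < m U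
  gaussian : ∃ (C : ℝ) (z : X), ∫⁻ x, ENNReal.ofReal (Real.exp (-C * dist x z ^ 2)) ∂m < ⊤

/-- Couplings of two measures: measures on the product with the given marginals. -/
def couplings {X Y : Type*} [MeasurableSpace X] [MeasurableSpace Y]
    (μ : Measure X) (ν : Measure Y) : Set (Measure (X × Y)) :=
  {q | q.map Prod.fst = μ ∧ q.map Prod.snd = ν}

/-- The `L²`-Kantorovich-Wasserstein distance, with values in `[0, ∞]`. -/
def W₂ {X : Type*} [MetricSpace X] [MeasurableSpace X] (μ ν : Measure X) : ℝ≥0∞ :=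
  (⨅ q ∈ couplings μ ν, ∫⁻ p, edist p.1 p.2 ^ 2 ∂q) ^ (1 / 2 : ℝ)

/-- The Boltzmann entropy `S(μ) = ∫ u log u dm ∈ [-∞, ∞)` if `μ = u m` and
`∫ (u log u)₊ dm < ∞`, and `S(μ) = ∞` otherwise. The integral is written as the integral of the
positive part minus the integral of the negative part. -/
def entropy {X : Type*} [MeasurableSpace X] (m μ : Measure X) : EReal :=
  let f : X → ℝ := fun x => (μ.rnDeriv m x).toReal * Real.log (μ.rnDeriv m x).toReal
  open Classical in
  if μ ≪ m ∧ ∫⁻ x, ENNReal.ofReal (f x) ∂m < ⊤ then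
    ((∫⁻ x, ENNReal.ofReal (f x) ∂m : ℝ≥0∞) : EReal)
      - ((∫⁻ x, ENNReal.ofReal (-f x) ∂m : ℝ≥0∞) : EReal)
  else ⊤

/-- `(μ a)`, `a ∈ [-1, 1]`, is a (minimizing, constant speed) `W₂`-geodesic of probability
measures. Values of `μ` outside `[-1, 1]` are irrelevant. -/
def IsW₂Geodesic {X : Type*} [MetricSpace X] [MeasurableSpace X]
    (μ : ℝ → ProbabilityMeasure X) : Prop :=
  W₂ (μ (-1) : Measure X) (μ 1) < ⊤ ∧
  ∀ a ∈ Set.Icc (-1 : ℝ) 1, ∀ b ∈ Set.Icc (-1 : ℝ) 1,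
    W₂ (μ a : Measure X) (μ b) = ENNReal.ofReal (|a - b| / 2) * W₂ (μ (-1) : Measure X) (μ 1)

/-- `Kbar : (0, ∞) → (-∞, ∞]` is upper semicontinuous with `lim_{r → 0} Kbar r = K`.
Values of `Kbar` outside `(0, ∞)` are irrelevant. -/
structure IsApproximationFunction (K : ℝ) (Kbar : ℝ → EReal) : Prop where
  ne_bot : ∀ r : ℝ, 0 < r → Kbar r ≠ ⊥
  usc : UpperSemicontinuousOn Kbar (Set.Ioi 0)
  tendsto : Tendsto Kbar (𝓝[>] 0) (𝓝 (K : EReal))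

/-- `(X, d, m)` has robust synthetic upper Ricci bound `K` with approximation function `Kbar`.
In the entropy inequality, the left-hand side is `-∞` when `S(μ⁰) = ∞` (the convention of `EReal`),
so that the inequality is no restriction for such `μ⁰`. -/
def HasRobustUpperRicciBoundWith {X : Type*} [MetricSpace X] [MeasurableSpace X]
    (m : Measure X) (K : ℝ) (Kbar : ℝ → EReal) : Prop :=
  IsApproximationFunction K Kbar ∧
  ∀ r : ℝ, 0 < r → Kbar r < ⊤ → ∀ x y : X, dist x y = r →
    ∀ μ₀ : ProbabilityMeasure X,
      W₂ (μ₀ : Measure X) (Measure.dirac x) < ENNReal.ofReal (r ^ 4) →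
      ∃ μ : ℝ → ProbabilityMeasure X, IsW₂Geodesic μ ∧ μ 0 = μ₀ ∧
        W₂ (μ 1 : Measure X) (Measure.dirac y) ≤ ENNReal.ofReal (r ^ 2) ∧
        entropy m (μ 1) - 2 * entropy m (μ 0) + entropy m (μ (-1))
          ≤ Kbar r * ((r ^ 2 : ℝ) : EReal)

/-- A coupling of the metrics of `X` and `Y`: a pseudo-metric on the disjoint union `X ⊔ Y` that
restricts to the given metrics. -/
structure MetricCoupling (X Y : Type*) [MetricSpace X] [MetricSpace Y] where
  d : X ⊕ Y → X ⊕ Y → ℝ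
  d_self : ∀ p, d p p = 0
  d_comm : ∀ p q, d p q = d q p
  d_triangle : ∀ p q s, d p s ≤ d p q + d q s
  d_inl : ∀ x x' : X, d (Sum.inl x) (Sum.inl x') = dist x x'
  d_inr : ∀ y y' : Y, d (Sum.inr y) (Sum.inr y') = dist y y'

/-- Sturm's `L²`-transportation distance `𝔻₂` between `(X, d, m)` and `(Y, d', m')`: the infimum of
`(∫ δ(x,y)² dq(x,y))^{1/2}` over all couplings `δ` of the metrics and `q` of the measures. -/
def D₂ {X Y : Type*} [MetricSpace X] [MeasurableSpace X] [MetricSpace Y] [MeasurableSpace Y]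
    (m : Measure X) (m' : Measure Y) : ℝ≥0∞ :=
  (⨅ δ : MetricCoupling X Y, ⨅ q ∈ couplings m m',
    ∫⁻ p, ENNReal.ofReal (δ.d (Sum.inl p.1) (Sum.inr p.2) ^ 2) ∂q) ^ (1 / 2 : ℝ)

end SyntheticRicci

end

noncomputable section

namespace SyntheticRicci

/-! ### Entropy and its dual representation -/

/-! The data at `x`, `y`, `μ₀` in the limit are lifted to the approximating spaces, the Ricci bound
is applied there, and the resulting geodesics are brought back by a weak limit. Along a subsequence
there are couplings `q n` of the reference measures and `δ n` of the metrics with cost at most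
`(n+1)⁻⁴`. Almost nearest point maps `T n : X n → Y` and `R n : Y → X n` move points between the
spaces, and `WeakLimit` is weak convergence of images under `T n`.

Lifting: the density of `μ₀` is pulled back along `q n`, restricted to pairs at distance at most
`1/(n+1)`, normalised, and projected to `X n`. By `exists_isRecovery_of_entropy_ne_top` the
entropies do not increase in the limit, and by `IsRecovery.eventually_W₂_dirac_lt` the strict
condition `W < r⁴` survives. If `μ₀` has infinite entropy, its image under `R n` suffices
(`isRecovery_of_moment`). The lifted points have distance tending to `r`, so upper semicontinuity
controls `Kbar` along the sequence.

Compactness: the main danger is that the geodesics in `X n` run into regions of negligible mass,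
which convergence of the reference measures does not see. The Ricci bound itself excludes this
(`exists_near_of_robust`). Suppose `x` is near a point `z` of `Y`, and `y` is a short step away from
`x`. The normalised restriction of `m n` to a small ball at `z` has bounded entropy. When it is not
already near `y`, the bound extends it to a geodesic ending near `y`; entropies are nonnegative for
probability reference measures, so this endpoint has bounded entropy too. It therefore cannot charge
a set of tiny `m n`-measure by much, and `y` is close to a point of the region approximated by a
finite subset of `Y`. A geodesic is cut into `k` pieces of length of order `1/k`; in each piece only
mass of order `k⁻²` makes a step that is not short, so the total loss is of order `1/k`
(`AsympTight.of_geodesic`).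

The limit is a geodesic: near-optimal couplings between three times of the geodesic are glued. A
quadratic identity shows that the middle point is almost between the outer ones in mean
(`exists_glued_near_geodesic`), a closed condition. The limiting coupling of the outer measures is
optimal because weak limits of near-optimal couplings are (`lintegral_le_of_weakLimit_nearOptimal`):
a competitor in `Y × Y` is discretised to a kernel of finite rank, which can be transplanted to `X
n`. This gives the upper bounds on `W₂`, and the triangle inequality turns them into equalities
(`isW₂Geodesic_of_between`).

Entropy: the Donsker-Varadhan formula writes the entropy as a supremum of functionals of `(μ, m)`
that are weakly continuous, so the sum of the two endpoint entropies is lower semicontinuous jointly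
in the measures and the reference measures (`exists_entropy_add_le_of_weakLimit`). -/

theorem mul_le_mul_log_sub_add_exp {a : ℝ} (ha : 0 ≤ a) (b : ℝ) :
    a * b ≤ a * Real.log a - a + Real.exp b := by
  rcases ha.eq_or_lt with rfl | ha
  · simp [Real.exp_nonneg]
  -- The tangent line of `exp` at `0`, taken at `b - log a` and multiplied by `a`: this is Young's
  -- inequality for `u log u - u` and its conjugate `exp`.
  · have h := Real.add_one_le_exp (b - Real.log a)
    rw [Real.exp_sub, Real.exp_log ha, le_div_iff₀ ha] at h
    nlinarith

theorem neg_one_le_mul_log {a : ℝ} (ha : 0 ≤ a) : -1 ≤ a * Real.log a := by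
  have h := mul_le_mul_log_sub_add_exp ha 0
  have h1 := mul_le_mul_log_sub_add_exp ha 1
  rcases ha.eq_or_lt with rfl | ha
  · simp
  · have := Real.one_sub_inv_le_log_of_pos ha
    have h2 : a * (1 - a⁻¹) ≤ a * Real.log a := mul_le_mul_of_nonneg_left this ha.le
    rw [mul_sub, mul_inv_cancel₀ ha.ne'] at h2
    linarith

theorem integrable_of_bounded {Ω : Type*} [MeasurableSpace Ω] {q : Measure Ω} [IsFiniteMeasure q]
    {φ : Ω → ℝ} (hφ : Measurable φ) {C : ℝ} (hC : ∀ x, |φ x| ≤ C) : Integrable φ q :=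
  Integrable.of_bound hφ.aestronglyMeasurable C (ae_of_all _ hC)

theorem integrable_exp_of_bounded {Ω : Type*} [MeasurableSpace Ω] {q : Measure Ω}
    [IsFiniteMeasure q] {φ : Ω → ℝ} (hφ : Measurable φ) {C : ℝ} (hC : ∀ x, |φ x| ≤ C) :
    Integrable (fun x => Real.exp (φ x)) q := by
  refine integrable_of_bounded (C := Real.exp C) (Real.measurable_exp.comp hφ) fun x => ?_
  rw [abs_of_pos (Real.exp_pos _)]
  exact Real.exp_le_exp.2 ((le_abs_self _).trans (hC x))

theorem integral_exp_pos_of_bounded {Ω : Type*} [MeasurableSpace Ω] {q : Measure Ω}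
    [IsProbabilityMeasure q] {φ : Ω → ℝ} (hφ : Measurable φ) {C : ℝ} (hC : ∀ x, |φ x| ≤ C) :
    0 < ∫ x, Real.exp (φ x) ∂q :=
  integral_exp_pos (integrable_exp_of_bounded hφ hC)

/-- The Gibbs variational inequality for a probability density. -/
theorem integral_sub_log_integral_exp_le {Ω : Type*} [MeasurableSpace Ω] {q : Measure Ω}
    [IsProbabilityMeasure q] {w φ : Ω → ℝ} (hw0 : ∀ x, 0 ≤ w x)
    (hw : Integrable w q) (hw1 : ∫ x, w x ∂q = 1)
    (hwl : Integrable (fun x => w x * Real.log (w x)) q)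
    (hφ : Measurable φ) {C : ℝ} (hC : ∀ x, |φ x| ≤ C) :
    ∫ x, w x * φ x ∂q - Real.log (∫ x, Real.exp (φ x) ∂q) ≤ ∫ x, w x * Real.log (w x) ∂q := by
  set c := Real.log (∫ x, Real.exp (φ x) ∂q) with hc
  have hpos := integral_exp_pos_of_bounded (q := q) hφ hC
  have hwφ : Integrable (fun x => w x * φ x) q :=
    hw.mul_bdd hφ.aestronglyMeasurable (ae_of_all _ hC)
  have hexp := integrable_exp_of_bounded (q := q) hφ hC
  have hsub : Integrable (fun x => w x * Real.log (w x) - w x) q := hwl.sub hw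
  have hec : Real.exp c = ∫ x, Real.exp (φ x) ∂q := Real.exp_log hpos
  -- Young's inequality for `φ - c`. The constant `c` is chosen so that `exp (φ - c)` has integral
  -- `1` and cancels the term `-∫ w`.
  have key : ∫ x, (w x * φ x - c * w x) ∂q
      ≤ ∫ x, (w x * Real.log (w x) - w x + Real.exp (φ x) * (Real.exp c)⁻¹) ∂q := by
    refine integral_mono (hwφ.sub (hw.const_mul c)) (hsub.fun_add (hexp.mul_const _)) ?_
    intro x
    have := mul_le_mul_log_sub_add_exp (hw0 x) (φ x - c)
    rw [Real.exp_sub] at this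
    simp only [div_eq_mul_inv] at this
    simp only
    linarith
  rw [integral_sub hwφ (hw.const_mul c), integral_add hsub (hexp.mul_const _),
    integral_sub hwl hw, integral_const_mul, integral_mul_const, hw1, hec,
    mul_inv_cancel₀ hpos.ne'] at key
  linarith

theorem absolutelyContinuous_of_entropy_ne_top {X : Type*} [MeasurableSpace X]
    {m μ : Measure X} (h : entropy m μ ≠ ⊤) : μ ≪ m := by
  by_contra hcon
  refine h ?_
  unfold entropy
  exact if_neg fun h' => hcon h'.1

section Entropy

variable {X : Type*} [MeasurableSpace X] {m μ : Measure X} [IsProbabilityMeasure m]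

/-- The integrand `u log u` of the entropy, `u` the density of `μ`. -/
def entropyDensity (m μ : Measure X) (x : X) : ℝ :=
  (μ.rnDeriv m x).toReal * Real.log (μ.rnDeriv m x).toReal

theorem measurable_entropyDensity (m μ : Measure X) : Measurable (entropyDensity m μ) := by
  unfold entropyDensity
  fun_prop

theorem neg_one_le_entropyDensity (m μ : Measure X) (x : X) : -1 ≤ entropyDensity m μ x :=
  neg_one_le_mul_log ENNReal.toReal_nonneg

theorem lintegral_neg_entropyDensity_ne_top :
    ∫⁻ x, ENNReal.ofReal (-entropyDensity m μ x) ∂m ≠ ⊤ := by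
  refine ne_top_of_le_ne_top (b := ∫⁻ _, 1 ∂m) (by simp) (lintegral_mono fun x => ?_)
  rw [← ENNReal.ofReal_one]
  exact ENNReal.ofReal_le_ofReal (by linarith [neg_one_le_entropyDensity m μ x])

theorem entropy_of_integrable (hac : μ ≪ m) (hf : Integrable (entropyDensity m μ) m) :
    entropy m μ = ((∫ x, entropyDensity m μ x ∂m : ℝ) : EReal) := by
  have hp : ∫⁻ x, ENNReal.ofReal (entropyDensity m μ x) ∂m < ⊤ :=
    lt_of_le_of_lt (lintegral_mono fun x => Real.ofReal_le_enorm _) hf.2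
  have : entropy m μ = ((∫⁻ x, ENNReal.ofReal (entropyDensity m μ x) ∂m : ℝ≥0∞) : EReal)
      - ((∫⁻ x, ENNReal.ofReal (-entropyDensity m μ x) ∂m : ℝ≥0∞) : EReal) := by
    unfold entropy
    exact if_pos ⟨hac, hp⟩
  rw [this, integral_eq_lintegral_pos_part_sub_lintegral_neg_part hf, EReal.coe_sub,
    EReal.coe_ennreal_toReal hp.ne, EReal.coe_ennreal_toReal lintegral_neg_entropyDensity_ne_top]

theorem integrable_entropyDensity_of_entropy_ne_top (h : entropy m μ ≠ ⊤) :
    Integrable (entropyDensity m μ) m := by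
  have hp : ∫⁻ x, ENNReal.ofReal (entropyDensity m μ x) ∂m < ⊤ := by
    by_contra hcon
    refine h ?_
    unfold entropy
    exact if_neg fun h' => hcon h'.2
  refine ⟨(measurable_entropyDensity m μ).aestronglyMeasurable, ?_⟩
  have : ∀ x, ‖entropyDensity m μ x‖ₑ ≤ ENNReal.ofReal (entropyDensity m μ x)
      + ENNReal.ofReal (-entropyDensity m μ x) := by
    intro x
    rw [Real.enorm_eq_ofReal_abs]
    rcases le_total 0 (entropyDensity m μ x) with h0 | h0
    · rw [abs_of_nonneg h0]; exact le_self_add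
    · rw [abs_of_nonpos h0]; exact le_add_self
  refine lt_of_le_of_lt (lintegral_mono this) ?_
  rw [lintegral_add_left (by have := measurable_entropyDensity m μ; fun_prop)]
  exact ENNReal.add_lt_top.2 ⟨hp, lintegral_neg_entropyDensity_ne_top.lt_top⟩

theorem integral_rnDeriv_toReal_eq_one [IsProbabilityMeasure μ] (hac : μ ≪ m) :
    ∫ x, (μ.rnDeriv m x).toReal ∂m = 1 := by
  rw [Measure.integral_toReal_rnDeriv hac]; simp

/-- The Donsker-Varadhan lower bound for the entropy. -/
theorem le_entropy [IsProbabilityMeasure μ] {φ : X → ℝ} (hφ : Measurable φ) {C : ℝ}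
    (hC : ∀ x, |φ x| ≤ C) :
    ((∫ x, φ x ∂μ - Real.log (∫ x, Real.exp (φ x) ∂m) : ℝ) : EReal) ≤ entropy m μ := by
  by_cases h : entropy m μ = ⊤
  · rw [h]; exact le_top
  have hac := absolutelyContinuous_of_entropy_ne_top h
  have hf := integrable_entropyDensity_of_entropy_ne_top h
  rw [entropy_of_integrable hac hf, EReal.coe_le_coe_iff, ← integral_rnDeriv_smul hac]
  exact integral_sub_log_integral_exp_le (w := fun x => (μ.rnDeriv m x).toReal)
    (fun x => ENNReal.toReal_nonneg) Measure.integrable_toReal_rnDeriv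
    (integral_rnDeriv_toReal_eq_one hac) hf hφ hC

theorem entropy_nonneg [IsProbabilityMeasure μ] : 0 ≤ entropy m μ := by
  have := le_entropy (m := m) (μ := μ) (φ := fun _ => 0) measurable_const (C := 0) (by simp)
  simpa using this

/-- A measure of small entropy gives small mass to sets of tiny reference measure. -/
theorem mul_measureReal_le_of_entropy_le [IsProbabilityMeasure μ] {L t : ℝ}
    (hL : entropy m μ ≤ (L : EReal)) (ht : 0 ≤ t) {A : Set X} (hA : MeasurableSet A)
    (hmA : m.real A ≤ Real.exp (-t)) : t * μ.real A ≤ L + Real.log 2 := by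
  classical
  -- The test function is `t` on `A` and `0` elsewhere. The exponent `-t` in `hmA` is what keeps its
  -- exponential integral below `2`.
  have hφ : Measurable (A.indicator fun _ : X => t) := measurable_const.indicator hA
  have hC : ∀ x, |A.indicator (fun _ : X => t) x| ≤ t := fun x => by
    by_cases hx : x ∈ A <;> simp [hx, abs_of_nonneg ht, ht]
  have h := (le_entropy (m := m) (μ := μ) hφ hC).trans hL
  rw [EReal.coe_le_coe_iff, integral_indicator_const _ hA] at h
  have h2 : ∫ x, Real.exp (A.indicator (fun _ : X => t) x) ∂m ≤ 2 := by
    have : ∀ x, Real.exp (A.indicator (fun _ : X => t) x)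
        ≤ 1 + A.indicator (fun _ : X => Real.exp t) x := by
      intro x
      by_cases hx : x ∈ A <;> simp [hx]
    refine (integral_mono (integrable_exp_of_bounded hφ hC) ?_ this).trans ?_
    · exact (integrable_const _).add ((integrable_const _).indicator hA)
    · rw [integral_add (integrable_const _) ((integrable_const _).indicator hA),
        integral_indicator_const _ hA]
      have : m.real A * Real.exp t ≤ Real.exp (-t) * Real.exp t :=
        mul_le_mul_of_nonneg_right hmA (Real.exp_nonneg _)
      rw [← Real.exp_add, neg_add_cancel, Real.exp_zero] at this
      simp only [integral_const, probReal_univ, smul_eq_mul, mul_one]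
      linarith
  have h3 := Real.log_le_log (integral_exp_pos_of_bounded (q := m) hφ hC) h2
  simp only [smul_eq_mul] at h
  linarith

/-- If the Donsker-Varadhan functional is at most `L` on bounded measurable functions, then so is
the entropy. -/
theorem entropy_le_of_forall_bounded [IsProbabilityMeasure μ] {L : ℝ}
    (h : ∀ φ : X → ℝ, Measurable φ → (∃ C : ℝ, ∀ x, |φ x| ≤ C) →
      ∫ x, φ x ∂μ - Real.log (∫ x, Real.exp (φ x) ∂m) ≤ L) : entropy m μ ≤ (L : EReal) := by
  classical
  have hac : μ ≪ m := by
    refine Measure.AbsolutelyContinuous.mk fun A hA hmA => ?_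
    by_contra hne
    have hpos : 0 < μ.real A := ENNReal.toReal_pos hne (by finiteness)
    -- On an `m`-null set the test function `t` is free of charge in the logarithmic term, so
    -- arbitrarily large `t` are allowed.
    have key : ∀ t : ℝ, μ.real A * t ≤ L := by
      intro t
      have hφ : Measurable (A.indicator fun _ : X => t) := measurable_const.indicator hA
      have := h _ hφ ⟨|t|, fun x => by by_cases hx : x ∈ A <;> simp [hx]⟩
      have h1 : ∫ x, Real.exp (A.indicator (fun _ : X => t) x) ∂m = 1 := by
        have : (fun x => Real.exp (A.indicator (fun _ : X => t) x)) =ᵐ[m] fun _ => 1 := by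
          filter_upwards [measure_eq_zero_iff_ae_notMem.1 hmA] with x hx
          simp [hx]
        rw [integral_congr_ae this]; simp
      rw [integral_indicator_const _ hA, h1] at this
      simpa using this
    have := key ((L + 1) / μ.real A)
    rw [mul_div_cancel₀ _ hpos.ne'] at this
    linarith
  set u : X → ℝ := fun x => (μ.rnDeriv m x).toReal with hu
  have hum : Measurable u := by fun_prop
  have hu0 : ∀ x, 0 ≤ u x := fun x => ENNReal.toReal_nonneg
  have hui : Integrable u m := Measure.integrable_toReal_rnDeriv
  have hu1 : ∫ x, u x ∂m = 1 := integral_rnDeriv_toReal_eq_one hac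
  -- The optimal test function `log u`, made bounded by truncating `u` to `[1/(k+1), k+1]`. The
  -- lower truncation adds at most `1/(k+1)` to the exponential integral, and `u log v ≥ -1` permits
  -- Fatou after adding `1`.
  let v : ℕ → X → ℝ := fun k x => max (min (u x) (k + 1)) (1 / ((k : ℝ) + 1))
  have hk0 : ∀ k : ℕ, (0 : ℝ) < 1 / ((k : ℝ) + 1) := fun k => by positivity
  have hvpos : ∀ k x, 0 < v k x := fun k x => lt_max_of_lt_right (hk0 k)
  have hvm : ∀ k, Measurable (v k) := fun k => by fun_prop
  have hvle : ∀ k x, v k x ≤ k + 1 := fun k x => by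
    refine max_le (min_le_right _ _) ?_
    rw [div_le_iff₀ (by positivity)]
    have : (0:ℝ) ≤ k := by positivity
    nlinarith
  have hlogb : ∀ k x, |Real.log (v k x)| ≤ Real.log (k + 1) := fun k x => by
    refine abs_le.2 ⟨?_, Real.log_le_log (hvpos k x) (hvle k x)⟩
    rw [← Real.log_inv, ← one_div]
    exact Real.log_le_log (hk0 k) (le_max_right _ _)
  have h_int : ∀ k, Integrable (fun x => u x * Real.log (v k x)) m := fun k =>
    hui.mul_bdd (Real.measurable_log.comp (hvm k)).aestronglyMeasurable (ae_of_all _ (hlogb k))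
  have hge : ∀ k x, -1 ≤ u x * Real.log (v k x) := by
    intro k x
    rcases le_total (u x) (k + 1) with hx | hx
    · refine (neg_one_le_mul_log (hu0 x)).trans ?_
      rcases (hu0 x).eq_or_lt with h0 | h0
      · rw [← h0]; simp
      · refine mul_le_mul_of_nonneg_left (Real.log_le_log h0 ?_) h0.le
        exact le_max_of_le_left (le_min le_rfl hx)
    · have : 0 ≤ Real.log (v k x) := by
        refine Real.log_nonneg (le_max_of_le_left ?_)
        rw [min_eq_right hx]
        have : (0:ℝ) ≤ k := by positivity
        linarith
      have := mul_nonneg (hu0 x) this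
      linarith
  have hbound : ∀ k : ℕ, ∫ x, (u x * Real.log (v k x) + 1) ∂m
      ≤ L + Real.log (1 + 1 / ((k : ℝ) + 1)) + 1 := by
    intro k
    have h1 := h (fun x => Real.log (v k x)) (Real.measurable_log.comp (hvm k)) ⟨_, hlogb k⟩
    rw [← integral_rnDeriv_smul hac] at h1
    have h2 : ∫ x, Real.exp (Real.log (v k x)) ∂m ≤ 1 + 1 / ((k : ℝ) + 1) := by
      have h3 : ∀ x, Real.exp (Real.log (v k x)) ≤ u x + 1 / ((k : ℝ) + 1) := by
        intro x
        rw [Real.exp_log (hvpos k x)]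
        refine max_le ((min_le_left _ _).trans ?_) ?_
        · linarith [hk0 k]
        · linarith [hu0 x]
      refine (integral_mono (integrable_exp_of_bounded (Real.measurable_log.comp (hvm k))
        (hlogb k)) (hui.fun_add (integrable_const _)) h3).trans ?_
      rw [integral_add hui (integrable_const _), hu1]
      simp
    have h4 := Real.log_le_log (integral_exp_pos_of_bounded (q := m)
      (Real.measurable_log.comp (hvm k)) (hlogb k)) h2
    rw [integral_add (h_int k) (integrable_const _)]
    simp only [smul_eq_mul, Function.comp_apply] at h1 h4
    simp only [integral_const, probReal_univ, smul_eq_mul, mul_one]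
    linarith
  have hlim : ∀ x, Tendsto (fun k => u x * Real.log (v k x) + 1) atTop
      (𝓝 (entropyDensity m μ x + 1)) := by
    intro x
    have h1 : Tendsto (fun k => v k x) atTop (𝓝 (u x)) := by
      have h2 : Tendsto (fun k : ℕ => min (u x) ((k : ℝ) + 1)) atTop (𝓝 (u x)) := by
        refine tendsto_const_nhds.congr' ?_
        obtain ⟨N, hN⟩ := exists_nat_ge (u x)
        filter_upwards [eventually_ge_atTop N] with k hk
        have : (N : ℝ) ≤ k := by exact_mod_cast hk
        rw [min_eq_left (by linarith)]
      have := h2.max tendsto_one_div_add_atTop_nhds_zero_nat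
      rwa [max_eq_left (hu0 x)] at this
    rcases (hu0 x).eq_or_lt with h0 | h0
    · have : entropyDensity m μ x = u x * Real.log (u x) := rfl
      rw [this, ← h0]; simp
    · exact ((h1.log h0.ne').const_mul _).add_const _
  have hL : Tendsto (fun k : ℕ => L + Real.log (1 + 1 / ((k : ℝ) + 1)) + 1) atTop
      (𝓝 (L + 1)) := by
    have h1 : Tendsto (fun k : ℕ => (1 : ℝ) + 1 / ((k : ℝ) + 1)) atTop (𝓝 (1 + 0)) :=
      tendsto_one_div_add_atTop_nhds_zero_nat.const_add 1
    have h2 := ((h1.log (by norm_num)).const_add L).add_const 1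
    simpa using h2
  have hfatou : ∫⁻ x, ENNReal.ofReal (entropyDensity m μ x + 1) ∂m ≤ ENNReal.ofReal (L + 1) := by
    have h1 : ∀ x, ENNReal.ofReal (entropyDensity m μ x + 1)
        = liminf (fun k => ENNReal.ofReal (u x * Real.log (v k x) + 1)) atTop := fun x =>
      ((ENNReal.tendsto_ofReal (hlim x)).liminf_eq).symm
    simp_rw [h1]
    refine (lintegral_liminf_le fun k => ?_).trans ?_
    · exact ((hum.mul (Real.measurable_log.comp (hvm k))).add_const 1).ennreal_ofReal
    · rw [← (ENNReal.tendsto_ofReal hL).liminf_eq]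
      refine liminf_le_liminf (Eventually.of_forall fun k => ?_)
      rw [← ofReal_integral_eq_lintegral_ofReal ((h_int k).fun_add (integrable_const _))
        (ae_of_all _ fun x => by simpa using neg_le_iff_add_nonneg.1 (hge k x))]
      exact ENNReal.ofReal_le_ofReal (hbound k)
  have hLp : 0 ≤ L := by
    have := h (fun _ => 0) measurable_const ⟨0, by simp⟩
    simpa using this
  have hi1 : Integrable (fun x => entropyDensity m μ x + 1) m := by
    refine ⟨((measurable_entropyDensity m μ).add_const 1).aestronglyMeasurable, ?_⟩
    rw [hasFiniteIntegral_iff_ofReal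
      (ae_of_all _ fun x => by
        simpa using neg_le_iff_add_nonneg.1 (neg_one_le_entropyDensity m μ x))]
    exact hfatou.trans_lt ENNReal.ofReal_lt_top
  have hi : Integrable (entropyDensity m μ) m := by
    have : Integrable (fun x => entropyDensity m μ x + 1 - 1) m :=
      hi1.sub (integrable_const (1 : ℝ))
    simpa using this
  rw [entropy_of_integrable hac hi, EReal.coe_le_coe_iff]
  rw [← ofReal_integral_eq_lintegral_ofReal hi1
    (ae_of_all _ fun x => by simpa using neg_le_iff_add_nonneg.1 (neg_one_le_entropyDensity m μ x)),
    ENNReal.ofReal_le_ofReal_iff (by linarith), integral_add hi (integrable_const _)] at hfatou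
  simpa using hfatou

/-- The entropy of the image of a measure with density `w` is at most `∫ w log w`. -/
theorem entropy_map_le {Ω : Type*} [MeasurableSpace Ω] {q : Measure Ω} [IsProbabilityMeasure q]
    {w : Ω → ℝ} (hwm : Measurable w) (hw0 : ∀ x, 0 ≤ w x)
    (hw : Integrable w q) (hw1 : ∫ x, w x ∂q = 1)
    (hwl : Integrable (fun x => w x * Real.log (w x)) q) {g : Ω → X} (hg : Measurable g)
    (hm : q.map g = m) (hμ : (q.withDensity fun x => ENNReal.ofReal (w x)).map g = μ) :
    entropy m μ ≤ ((∫ x, w x * Real.log (w x) ∂q : ℝ) : EReal) := by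
  have : IsProbabilityMeasure (q.withDensity fun x => ENNReal.ofReal (w x)) :=
    ⟨by
      rw [withDensity_apply _ .univ, setLIntegral_univ, ← ofReal_integral_eq_lintegral_ofReal hw
        (ae_of_all _ hw0), hw1, ENNReal.ofReal_one]⟩
  have : IsProbabilityMeasure μ := hμ ▸ Measure.isProbabilityMeasure_map hg.aemeasurable
  refine entropy_le_of_forall_bounded fun φ hφ ⟨C, hC⟩ => ?_
  -- The Gibbs inequality is used upstairs for `φ ∘ g`, so the density of the image measure never
  -- has to be computed.
  have := integral_sub_log_integral_exp_le hw0 hw hw1 hwl (hφ.comp hg) (fun x => hC (g x))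
  rw [← hm, ← hμ, integral_map hg.aemeasurable hφ.aestronglyMeasurable,
    integral_map hg.aemeasurable (f := fun x => Real.exp (φ x))
      (Real.measurable_exp.comp hφ).aestronglyMeasurable,
    integral_withDensity_eq_integral_toReal_smul (by fun_prop) (by simp)]
  simpa [hw0] using this

end Entropy

/-- If the Donsker-Varadhan functional is at most `L` on bounded continuous functions, then so is
the entropy. -/
theorem entropy_le_of_forall_continuous {X : Type*} [MetricSpace X] [MeasurableSpace X]
    [BorelSpace X] {m μ : Measure X} [IsProbabilityMeasure m] [IsProbabilityMeasure μ] {L : ℝ}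
    (h : ∀ φ : BoundedContinuousFunction X ℝ,
      ∫ x, φ x ∂μ - Real.log (∫ x, Real.exp (φ x) ∂m) ≤ L) : entropy m μ ≤ (L : EReal) := by
  refine entropy_le_of_forall_bounded fun φ hφ ⟨C, hC⟩ => ?_
  have hC0 : 0 ≤ C := (abs_nonneg _).trans (hC (Classical.choice
    (nonempty_of_isProbabilityMeasure m)))
  have key : ∀ ε : ℝ, 0 < ε → ∫ x, φ x ∂μ - ε
      - Real.log (∫ x, Real.exp (φ x) ∂m + Real.exp C * ε) ≤ L := by
    intro ε hε
    -- Approximation in `L¹(m + μ)` serves both integrals at once. Truncating `g` to `[-C, C]`,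
    -- where `φ` takes its values, only brings it closer and bounds `exp g'` by `exp C`.
    obtain ⟨g, hg, -⟩ := (integrable_of_bounded (q := m + μ) hφ
      hC).exists_boundedContinuous_integral_sub_le hε
    let g' : BoundedContinuousFunction X ℝ := BoundedContinuousFunction.ofNormedAddCommGroup
      (fun x => max (min (g x) C) (-C)) (by fun_prop) C (fun x => by
        rw [Real.norm_eq_abs, abs_le]
        exact ⟨le_max_right _ _, max_le (min_le_right _ _) (by linarith)⟩)
    have hg'b : ∀ x, |g' x| ≤ C := fun x => by
      rw [abs_le]
      exact ⟨le_max_right _ _, max_le (min_le_right _ _) (by linarith)⟩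
    have hg'm : Measurable g' := g'.continuous.measurable
    have hclose : ∀ x, |φ x - g' x| ≤ |φ x - g x| := by
      intro x
      have h1 := abs_le.1 (hC x)
      have : φ x = max (min (φ x) C) (-C) := by
        rw [min_eq_left h1.2, max_eq_left h1.1]
      change |φ x - max (min (g x) C) (-C)| ≤ _
      rw [this]
      refine (abs_max_sub_max_le_abs _ _ _).trans ?_
      refine (abs_min_sub_min_le_max _ _ _ _).trans ?_
      rw [min_eq_left h1.2, max_eq_left h1.1]; simp
    have hi : ∀ (ρ : Measure X) [IsFiniteMeasure ρ], Integrable (fun x => ‖φ x - g x‖) ρ :=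
      fun ρ _ =>
      ((integrable_of_bounded hφ hC).sub (g.integrable ρ)).norm
    rw [integral_add_measure (hi m) (hi μ)] at hg
    have hm0 : 0 ≤ ∫ x, ‖φ x - g x‖ ∂m := integral_nonneg fun x => norm_nonneg _
    have hμ0 : 0 ≤ ∫ x, ‖φ x - g x‖ ∂μ := integral_nonneg fun x => norm_nonneg _
    have h1 : ∫ x, φ x ∂μ - ε ≤ ∫ x, g' x ∂μ := by
      have : ∫ x, (φ x - g' x) ∂μ ≤ ∫ x, ‖φ x - g x‖ ∂μ :=
        integral_mono ((integrable_of_bounded hφ hC).sub (integrable_of_bounded hg'm hg'b)) (hi μ)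
          fun x => (le_abs_self _).trans (hclose x)
      rw [integral_sub (integrable_of_bounded hφ hC) (integrable_of_bounded hg'm hg'b)] at this
      linarith
    have h2 : ∫ x, Real.exp (g' x) ∂m ≤ ∫ x, Real.exp (φ x) ∂m + Real.exp C * ε := by
      have hpt : ∀ x, Real.exp (g' x) ≤ Real.exp (φ x) + Real.exp C * ‖φ x - g x‖ := by
        intro x
        have h3 := Real.add_one_le_exp (φ x - g' x)
        have h4 : Real.exp (φ x) = Real.exp (g' x) * Real.exp (φ x - g' x) := by
          rw [← Real.exp_add]; congr 1; ring
        have h5 : Real.exp (g' x) ≤ Real.exp C :=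
          Real.exp_le_exp.2 ((le_abs_self _).trans (hg'b x))
        have h6 : Real.exp (g' x) * (φ x - g' x + 1) ≤ Real.exp (φ x) := by
          rw [h4]; exact mul_le_mul_of_nonneg_left h3 (Real.exp_nonneg _)
        have h7 : -(φ x - g' x) ≤ ‖φ x - g x‖ := (neg_le_abs _).trans (hclose x)
        have h8 : Real.exp (g' x) * (-(φ x - g' x)) ≤ Real.exp (g' x) * ‖φ x - g x‖ :=
          mul_le_mul_of_nonneg_left h7 (Real.exp_nonneg _)
        have h9 : Real.exp (g' x) * ‖φ x - g x‖ ≤ Real.exp C * ‖φ x - g x‖ :=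
          mul_le_mul_of_nonneg_right h5 (norm_nonneg _)
        linarith
      refine (integral_mono (integrable_exp_of_bounded hg'm hg'b)
        ((integrable_exp_of_bounded hφ hC).fun_add ((hi m).const_mul _)) hpt).trans ?_
      rw [integral_add (integrable_exp_of_bounded hφ hC) ((hi m).const_mul _), integral_const_mul]
      have : Real.exp C * ∫ x, ‖φ x - g x‖ ∂m ≤ Real.exp C * ε :=
        mul_le_mul_of_nonneg_left (by linarith) (Real.exp_nonneg _)
      linarith
    have h3 := Real.log_le_log (integral_exp_pos_of_bounded (q := m) hg'm hg'b) h2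
    have := h g'
    linarith
  have hlim : Tendsto (fun ε : ℝ => ∫ x, φ x ∂μ - ε
      - Real.log (∫ x, Real.exp (φ x) ∂m + Real.exp C * ε)) (𝓝[>] 0)
      (𝓝 (∫ x, φ x ∂μ - 0 - Real.log (∫ x, Real.exp (φ x) ∂m + Real.exp C * 0))) := by
    refine Tendsto.mono_left ?_ nhdsWithin_le_nhds
    refine ContinuousAt.tendsto ?_
    refine (continuousAt_const.sub continuousAt_id).sub (ContinuousAt.log ?_ ?_)
    · fun_prop
    · simpa using (integral_exp_pos_of_bounded (q := m) hφ hC).ne'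
  have := le_of_tendsto hlim (eventually_nhdsWithin_of_forall key)
  simpa using this

/-! ### Couplings and the Wasserstein distance -/

section Couplings

variable {X Y Z : Type*} [MeasurableSpace X] [MeasurableSpace Y] [MeasurableSpace Z]

theorem isProbabilityMeasure_of_mem_couplings {μ : Measure X} {ν : Measure Y}
    [IsProbabilityMeasure μ] {q : Measure (X × Y)} (hq : q ∈ couplings μ ν) :
    IsProbabilityMeasure q := by
  refine ⟨?_⟩
  have := congrArg (fun μ => μ Set.univ) hq.1
  simpa [Measure.map_apply measurable_fst] using this

theorem lintegral_fst_of_mem_couplings {μ : Measure X} {ν : Measure Y} {q : Measure (X × Y)}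
    (hq : q ∈ couplings μ ν) {f : X → ℝ≥0∞} (hf : Measurable f) :
    ∫⁻ p, f p.1 ∂q = ∫⁻ x, f x ∂μ := by
  rw [← hq.1, lintegral_map hf measurable_fst]

theorem lintegral_snd_of_mem_couplings {μ : Measure X} {ν : Measure Y} {q : Measure (X × Y)}
    (hq : q ∈ couplings μ ν) {f : Y → ℝ≥0∞} (hf : Measurable f) :
    ∫⁻ p, f p.2 ∂q = ∫⁻ y, f y ∂ν := by
  rw [← hq.2, lintegral_map hf measurable_snd]

theorem prod_mem_couplings (μ : Measure X) (ν : Measure Y) [IsProbabilityMeasure μ]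
    [IsProbabilityMeasure ν] : μ.prod ν ∈ couplings μ ν := by
  constructor
  · simp [Measure.map_fst_prod]
  · simp [Measure.map_snd_prod]

theorem map_swap_mem_couplings {μ : Measure X} {ν : Measure Y} {q : Measure (X × Y)}
    (hq : q ∈ couplings μ ν) : q.map Prod.swap ∈ couplings ν μ := by
  constructor
  · rw [Measure.map_map measurable_fst measurable_swap, ← hq.2]; rfl
  · rw [Measure.map_map measurable_snd measurable_swap, ← hq.1]; rfl

theorem map_prodMk_mem_couplings {Ω : Type*} [MeasurableSpace Ω] (P : Measure Ω) {f : Ω → X}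
    {g : Ω → Y} (hf : Measurable f) (hg : Measurable g) :
    P.map (fun ω => (f ω, g ω)) ∈ couplings (P.map f) (P.map g) := by
  constructor
  · rw [Measure.map_map measurable_fst (hf.prodMk hg)]; rfl
  · rw [Measure.map_map measurable_snd (hf.prodMk hg)]; rfl

/-- The gluing lemma. -/
theorem exists_gluing [StandardBorelSpace Z] [Nonempty Z] {α : Measure X} {β : Measure Y}
    {γ : Measure Z} [IsProbabilityMeasure α] [IsProbabilityMeasure β] {p : Measure (X × Y)}
    {q : Measure (Y × Z)} (hp : p ∈ couplings α β) (hq : q ∈ couplings β γ) :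
    ∃ P : Measure ((X × Y) × Z), IsProbabilityMeasure P ∧ P.map Prod.fst = p ∧
      P.map (fun ω => (ω.1.2, ω.2)) = q := by
  have := isProbabilityMeasure_of_mem_couplings hp
  have := isProbabilityMeasure_of_mem_couplings hq
  -- The third coordinate is drawn from the disintegration of `q` over the second coordinate,
  -- independently of the first.
  let κ : ProbabilityTheory.Kernel (X × Y) Z :=
    q.condKernel.comap (Prod.snd : X × Y → Y) measurable_snd
  refine ⟨p.compProd κ, inferInstance, ?_, ?_⟩
  · exact Measure.fst_compProd p κ
  · have hq' : q.fst.compProd q.condKernel = q := q.disintegrate q.condKernel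
    have hfst : q.fst = p.map Prod.snd := by rw [hp.2]; exact hq.1
    rw [hfst] at hq'
    refine Measure.ext fun s hs => ?_
    have hm : Measurable (fun ω : (X × Y) × Z => (ω.1.2, ω.2)) := by fun_prop
    conv_rhs => rw [← hq']
    rw [Measure.map_apply hm hs, Measure.compProd_apply (hm hs), Measure.compProd_apply hs,
      lintegral_map (ProbabilityTheory.Kernel.measurable_kernel_prodMk_left hs) measurable_snd]
    rfl

end Couplings

/-! ### The Wasserstein distance, handled without optimal couplings -/

section Wasserstein

variable {X : Type*} [MetricSpace X] [MeasurableSpace X]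

theorem W₂_sq (μ ν : Measure X) :
    W₂ μ ν ^ 2 = ⨅ q ∈ couplings μ ν, ∫⁻ p, edist p.1 p.2 ^ 2 ∂q := by
  rw [W₂, ← ENNReal.rpow_natCast, ← ENNReal.rpow_mul]
  norm_num

theorem W₂_sq_le {μ ν : Measure X} {q : Measure (X × X)} (hq : q ∈ couplings μ ν) :
    W₂ μ ν ^ 2 ≤ ∫⁻ p, edist p.1 p.2 ^ 2 ∂q := by
  rw [W₂_sq]; exact iInf₂_le q hq

theorem exists_coupling_lt {μ ν : Measure X} {c : ℝ≥0∞} (h : W₂ μ ν ^ 2 < c) :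
    ∃ q ∈ couplings μ ν, ∫⁻ p, edist p.1 p.2 ^ 2 ∂q < c := by
  rw [W₂_sq] at h
  simpa [iInf_lt_iff] using h

theorem sq_le_sq_ennreal {a b : ℝ≥0∞} : a ^ 2 ≤ b ^ 2 ↔ a ≤ b :=
  ENNReal.pow_le_pow_left_iff two_ne_zero

variable [BorelSpace X] [SecondCountableTopology X]

theorem measurable_edist_sq : Measurable fun p : X × X => edist p.1 p.2 ^ 2 :=
  (measurable_edist).pow_const 2

theorem W₂_sq_comm_le (μ ν : Measure X) : W₂ μ ν ^ 2 ≤ W₂ ν μ ^ 2 := by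
  conv_rhs => rw [W₂_sq]
  refine le_iInf₂ fun q hq => ?_
  refine (W₂_sq_le (map_swap_mem_couplings hq)).trans ?_
  rw [lintegral_map measurable_edist_sq measurable_swap]
  simp [edist_comm]

theorem W₂_comm (μ ν : Measure X) : W₂ μ ν = W₂ ν μ :=
  le_antisymm (sq_le_sq_ennreal.1 (W₂_sq_comm_le μ ν)) (sq_le_sq_ennreal.1 (W₂_sq_comm_le ν μ))

theorem W₂_self (μ : Measure X) : W₂ μ μ = 0 := by
  have h := W₂_sq_le (map_prodMk_mem_couplings μ (f := id) (g := id) measurable_id measurable_id)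
  rw [lintegral_map measurable_edist_sq (by fun_prop)] at h
  simpa using h

/-- Every coupling with a Dirac mass is concentrated on `p.2 = x`, so there is nothing to minimise.
Conditions on `W₂` to a Dirac mass thus become conditions on second moments. -/
theorem W₂_dirac_sq (μ : Measure X) [IsProbabilityMeasure μ] (x : X) :
    W₂ μ (Measure.dirac x) ^ 2 = ∫⁻ z, edist z x ^ 2 ∂μ := by
  have hm : Measurable fun z : X => edist z x ^ 2 := (measurable_edist_left).pow_const 2
  refine le_antisymm ?_ ?_
  · refine (W₂_sq_le (prod_mem_couplings μ (Measure.dirac x))).trans ?_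
    rw [lintegral_prod _ measurable_edist_sq.aemeasurable]
    refine lintegral_mono fun z => ?_
    rw [lintegral_dirac]
  · rw [W₂_sq]
    refine le_iInf₂ fun q hq => ?_
    rw [← lintegral_fst_of_mem_couplings hq hm]
    refine le_of_eq (lintegral_congr_ae ?_)
    have : ∀ᵐ p ∂q, p.2 = x := by
      have h1 : ∀ᵐ y ∂(q.map Prod.snd), y = x := by
        rw [hq.2, ae_dirac_eq]; simp
      exact ae_of_ae_map measurable_snd.aemeasurable h1
    filter_upwards [this] with p hp
    rw [hp]

variable [CompleteSpace X]

/-- Gluing and Minkowski's inequality in `L²` for arbitrary couplings. The infimum is taken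
afterwards, the square root commuting with it as an order isomorphism. -/
theorem W₂_triangle (α β γ : Measure X) [IsProbabilityMeasure α] [IsProbabilityMeasure β] :
    W₂ α γ ≤ W₂ α β + W₂ β γ := by
  have : Nonempty X := nonempty_of_isProbabilityMeasure α
  have hrt : ∀ a : ℝ≥0∞, (a ^ 2) ^ (1 / 2 : ℝ) = a := fun a => by
    rw [← ENNReal.rpow_natCast, ← ENNReal.rpow_mul]; norm_num
  have key : ∀ p ∈ couplings α β, ∀ q ∈ couplings β γ,
      W₂ α γ ≤ (∫⁻ p, edist p.1 p.2 ^ 2 ∂p) ^ (1 / 2 : ℝ)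
        + (∫⁻ p, edist p.1 p.2 ^ 2 ∂q) ^ (1 / 2 : ℝ) := by
    intro p hp q hq
    obtain ⟨P, hP, hP1, hP2⟩ := exists_gluing hp hq
    have hc : P.map (fun ω : (X × X) × X => (ω.1.1, ω.2)) ∈ couplings α γ := by
      have h := map_prodMk_mem_couplings P (f := fun ω : (X × X) × X => ω.1.1)
        (g := fun ω => ω.2) (by fun_prop) (by fun_prop)
      have e1 : P.map (fun ω : (X × X) × X => ω.1.1) = α := by
        rw [← hp.1, ← hP1, Measure.map_map (by fun_prop) (by fun_prop)]; rfl
      have e2 : P.map (fun ω : (X × X) × X => ω.2) = γ := by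
        rw [← hq.2, ← hP2, Measure.map_map (by fun_prop) (by fun_prop)]; rfl
      rwa [e1, e2] at h
    have h := W₂_sq_le hc
    rw [lintegral_map measurable_edist_sq (by fun_prop)] at h
    rw [← hrt (W₂ α γ)]
    refine (ENNReal.rpow_le_rpow h (by norm_num)).trans ?_
    have e1 : ∫⁻ p, edist p.1 p.2 ^ 2 ∂p = ∫⁻ ω, edist ω.1.1 ω.1.2 ^ (2 : ℝ) ∂P := by
      rw [← hP1, lintegral_map measurable_edist_sq (by fun_prop)]; norm_num
    have e2 : ∫⁻ p, edist p.1 p.2 ^ 2 ∂q = ∫⁻ ω, edist ω.1.2 ω.2 ^ (2 : ℝ) ∂P := by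
      rw [← hP2, lintegral_map measurable_edist_sq (by fun_prop)]; norm_num
    rw [e1, e2]
    refine le_trans ?_ (ENNReal.lintegral_Lp_add_le (p := 2) (μ := P)
      (f := fun ω => edist ω.1.1 ω.1.2) (g := fun ω => edist ω.1.2 ω.2)
      (by fun_prop) (by fun_prop) (by norm_num))
    gcongr with ω
    norm_num
    gcongr
    exact edist_triangle _ _ _
  have h1 : W₂ α β = ⨅ q ∈ couplings α β, (∫⁻ p, edist p.1 p.2 ^ 2 ∂q) ^ (1 / 2 : ℝ) := by
    unfold W₂
    simp only [← ENNReal.orderIsoRpow_apply (1 / 2 : ℝ) (by norm_num), OrderIso.map_iInf]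
  have h2 : W₂ β γ = ⨅ q ∈ couplings β γ, (∫⁻ p, edist p.1 p.2 ^ 2 ∂q) ^ (1 / 2 : ℝ) := by
    unfold W₂
    simp only [← ENNReal.orderIsoRpow_apply (1 / 2 : ℝ) (by norm_num), OrderIso.map_iInf]
  rw [h1, h2]
  simp only [ENNReal.iInf_add, ENNReal.add_iInf]
  exact le_iInf₂ fun q hq => le_iInf₂ fun p hp => key p hp q hq

end Wasserstein

/-! ### Partial couplings and near-optimal couplings -/

/-- A measure whose marginals are dominated by `A` and `G` can be completed to a coupling. -/
theorem exists_completion {X Y : Type*} [MeasurableSpace X] [MeasurableSpace Y] (A : Measure X)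
    (G : Measure Y) [IsFiniteMeasure A] [IsFiniteMeasure G] (hAG : A Set.univ = G Set.univ)
    (s : Measure (X × Y)) (hsA : s.map Prod.fst ≤ A) (hsG : s.map Prod.snd ≤ G) :
    ∃ ρ : Measure (X × Y), s + ρ ∈ couplings A G ∧ ρ Set.univ = A Set.univ - s Set.univ ∧
      ρ ≪ A.prod G := by
  have hs1 : s.map Prod.fst Set.univ = s Set.univ := by
    rw [Measure.map_apply measurable_fst .univ, Set.preimage_univ]
  have hs2 : s.map Prod.snd Set.univ = s Set.univ := by
    rw [Measure.map_apply measurable_snd .univ, Set.preimage_univ]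
  have hf1 : IsFiniteMeasure (s.map Prod.fst) := isFiniteMeasure_of_le A hsA
  have hf2 : IsFiniteMeasure (s.map Prod.snd) := isFiniteMeasure_of_le G hsG
  set r₁ := A - s.map Prod.fst with hr₁
  set r₂ := G - s.map Prod.snd with hr₂
  have h1 : r₁ + s.map Prod.fst = A := Measure.sub_add_cancel_of_le hsA
  have h2 : r₂ + s.map Prod.snd = G := Measure.sub_add_cancel_of_le hsG
  set t := A Set.univ - s Set.univ with ht
  have ht1 : r₁ Set.univ = t := by
    rw [hr₁, Measure.sub_apply .univ hsA, hs1]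
  have ht2 : r₂ Set.univ = t := by
    rw [hr₂, Measure.sub_apply .univ hsG, hs2, ← hAG]
  have htf : t ≠ ⊤ := by rw [← ht1]; finiteness
  have hle1 : r₁ ≤ A := Measure.sub_le
  have hle2 : r₂ ≤ G := Measure.sub_le
  -- The residual marginals have the same mass `t`, and their product divided by `t` fills the gap.
  -- For `t = 0` the factor `t⁻¹` would be infinite.
  by_cases ht0 : t = 0
  · have hz1 : r₁ = 0 := Measure.measure_univ_eq_zero.1 (by rw [ht1, ht0])
    have hz2 : r₂ = 0 := Measure.measure_univ_eq_zero.1 (by rw [ht2, ht0])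
    refine ⟨0, ⟨?_, ?_⟩, by simp [ht0], Measure.AbsolutelyContinuous.zero _⟩
    · rw [add_zero]; simpa [hz1] using h1
    · rw [add_zero]; simpa [hz2] using h2
  · have hc : t⁻¹ * t = 1 := ENNReal.inv_mul_cancel ht0 htf
    refine ⟨t⁻¹ • r₁.prod r₂, ⟨?_, ?_⟩, ?_, ?_⟩
    · rw [Measure.map_add _ _ measurable_fst, Measure.map_smul, Measure.map_fst_prod, ht2,
        smul_smul, hc, one_smul, add_comm]
      exact h1
    · rw [Measure.map_add _ _ measurable_snd, Measure.map_smul, Measure.map_snd_prod, ht1,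
        smul_smul, hc, one_smul, add_comm]
      exact h2
    · rw [Measure.smul_apply, ← Set.univ_prod_univ, Measure.prod_prod, ht1, ht2, smul_eq_mul,
        ← mul_assoc, hc, one_mul]
    · exact (Measure.smul_absolutelyContinuous).trans
        (hle1.absolutelyContinuous.prod hle2.absolutelyContinuous)

/-- Both marginals of `f π` charge only `S`. This confines any measure dominated by the product of
these marginals to a set of bounded diameter, so its cost is at most `M²` times its mass. -/
theorem ae_mem_prod_of_withDensity {X : Type*} [MeasurableSpace X] {π : Measure (X × X)}
    {f : X × X → ℝ≥0∞} {A G : Measure X} [SFinite A] [SFinite G]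
    (hA : (π.withDensity f).map Prod.fst = A) (hG : (π.withDensity f).map Prod.snd = G)
    {S : Set X} (hS : MeasurableSet S) (hfS : ∀ p, f p ≠ 0 → p.1 ∈ S ∧ p.2 ∈ S) :
    ∀ᵐ p ∂(A.prod G), p.1 ∈ S ∧ p.2 ∈ S := by
  have hAS : A Sᶜ = 0 := by
    rw [← hA, Measure.map_apply measurable_fst hS.compl,
      withDensity_apply _ (measurable_fst hS.compl)]
    refine setLIntegral_eq_zero (measurable_fst hS.compl) fun p hp => ?_
    by_contra hne
    exact hp (hfS p hne).1
  have hGS : G Sᶜ = 0 := by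
    rw [← hG, Measure.map_apply measurable_snd hS.compl,
      withDensity_apply _ (measurable_snd hS.compl)]
    refine setLIntegral_eq_zero (measurable_snd hS.compl) fun p hp => ?_
    by_contra hne
    exact hp (hfS p hne).2
  have h1 : ∀ᵐ p ∂(A.prod G), p.1 ∈ S :=
    Measure.quasiMeasurePreserving_fst.ae (μb := A) (mem_ae_iff.2 hAS)
  have h2 : ∀ᵐ p ∂(A.prod G), p.2 ∈ S :=
    Measure.quasiMeasurePreserving_snd.ae (μb := G) (mem_ae_iff.2 hGS)
  filter_upwards [h1, h2] with p hp1 hp2 using ⟨hp1, hp2⟩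

/-- The effect on the cost of replacing the part `f π` of a near-optimal coupling `π` by the
measure with density `h` with respect to the product of the marginals of `f π`. -/
theorem lintegral_le_of_nearOptimal {X : Type*} [MetricSpace X] [MeasurableSpace X] [BorelSpace X]
    [SecondCountableTopology X] {π : Measure (X × X)} [IsProbabilityMeasure π] {ε : ℝ≥0∞}
    (hfin : ∫⁻ p, edist p.1 p.2 ^ 2 ∂π ≠ ⊤)
    (hopt : ∀ q ∈ couplings (π.map Prod.fst) (π.map Prod.snd),
      ∫⁻ p, edist p.1 p.2 ^ 2 ∂π ≤ ∫⁻ p, edist p.1 p.2 ^ 2 ∂q + ε)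
    {f h : X × X → ℝ≥0∞} (hf : Measurable f) (hf1 : ∀ p, f p ≤ 1) (hh : Measurable h)
    {A G : Measure X} (hA : (π.withDensity f).map Prod.fst = A)
    (hG : (π.withDensity f).map Prod.snd = G)
    (hhG : ∀ x, ∫⁻ y, h (x, y) ∂G ≤ 1) (hhA : ∀ y, ∫⁻ x, h (x, y) ∂A ≤ 1)
    {S : Set X} (hS : MeasurableSet S) (hfS : ∀ p, f p ≠ 0 → p.1 ∈ S ∧ p.2 ∈ S) {M : ℝ≥0∞}
    (hM : ∀ x ∈ S, ∀ y ∈ S, edist x y ≤ M) :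
    ∫⁻ p, f p * edist p.1 p.2 ^ 2 ∂π ≤ ∫⁻ p, h p * edist p.1 p.2 ^ 2 ∂(A.prod G)
      + M ^ 2 * (∫⁻ p, f p ∂π - ∫⁻ p, h p ∂(A.prod G)) + ε := by
  have hfl : ∫⁻ p, f p ∂π ≠ ⊤ := by
    refine ne_top_of_le_ne_top (b := ∫⁻ _, 1 ∂π) (by simp) (lintegral_mono hf1)
  have hfinf : IsFiniteMeasure (π.withDensity f) := isFiniteMeasure_withDensity hfl
  have hAf : IsFiniteMeasure A := hA ▸ inferInstance
  have hGf : IsFiniteMeasure G := hG ▸ inferInstance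
  have hAu : A Set.univ = ∫⁻ p, f p ∂π := by
    rw [← hA, Measure.map_apply measurable_fst .univ, Set.preimage_univ,
      withDensity_apply _ .univ, setLIntegral_univ]
  have hGu : G Set.univ = ∫⁻ p, f p ∂π := by
    rw [← hG, Measure.map_apply measurable_snd .univ, Set.preimage_univ,
      withDensity_apply _ .univ, setLIntegral_univ]
  set s := (A.prod G).withDensity h with hs
  -- Integrals of `h` over rows that are at most `1` say exactly that the new part does not exceed
  -- the first marginal it has to reproduce; columns do the same for the second.
  have hsA : s.map Prod.fst ≤ A := by
    refine Measure.le_iff.2 fun U hU => ?_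
    rw [Measure.map_apply measurable_fst hU, hs, withDensity_apply _ (measurable_fst hU),
      ← lintegral_indicator (measurable_fst hU),
      lintegral_prod _ ((hh.indicator (measurable_fst hU)).aemeasurable)]
    have : ∀ x, ∫⁻ y, (Prod.fst ⁻¹' U).indicator h (x, y) ∂G ≤ U.indicator 1 x := by
      intro x
      by_cases hx : x ∈ U
      · have e : ∀ y : X, (Prod.fst ⁻¹' U).indicator h (x, y) = h (x, y) := fun y =>
          Set.indicator_of_mem (by exact hx) _
        simp only [e, Set.indicator_of_mem hx]
        exact hhG x
      · have e : ∀ y : X, (Prod.fst ⁻¹' U).indicator h (x, y) = 0 := fun y =>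
          Set.indicator_of_notMem (by exact hx) _
        simp [e]
    refine (lintegral_mono this).trans ?_
    rw [lintegral_indicator_one hU]
  have hsG : s.map Prod.snd ≤ G := by
    refine Measure.le_iff.2 fun U hU => ?_
    rw [Measure.map_apply measurable_snd hU, hs, withDensity_apply _ (measurable_snd hU),
      ← lintegral_indicator (measurable_snd hU),
      lintegral_prod_symm _ ((hh.indicator (measurable_snd hU)).aemeasurable)]
    have : ∀ y, ∫⁻ x, (Prod.snd ⁻¹' U).indicator h (x, y) ∂A ≤ U.indicator 1 y := by
      intro y
      by_cases hy : y ∈ U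
      · have e : ∀ x : X, (Prod.snd ⁻¹' U).indicator h (x, y) = h (x, y) := fun x =>
          Set.indicator_of_mem (by exact hy) _
        simp only [e, Set.indicator_of_mem hy]
        exact hhA y
      · have e : ∀ x : X, (Prod.snd ⁻¹' U).indicator h (x, y) = 0 := fun x =>
          Set.indicator_of_notMem (by exact hy) _
        simp [e]
    refine (lintegral_mono this).trans ?_
    rw [lintegral_indicator_one hU]
  have hsu : s Set.univ = ∫⁻ p, h p ∂(A.prod G) := by
    rw [hs, withDensity_apply _ .univ, setLIntegral_univ]
  obtain ⟨ρ, hρ, hρu, hρac⟩ := exists_completion A G (by rw [hAu, hGu]) s hsA hsG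
  have hsplit : π.withDensity (fun p => 1 - f p) + π.withDensity f = π := by
    rw [← withDensity_add_right _ hf]
    have : (fun p => 1 - f p) + f = 1 := by
      ext p; simp [tsub_add_cancel_of_le (hf1 p)]
    rw [this, withDensity_one]
  -- The competitor keeps `(1 - f) π`, replaces `f π` by `s`, and completes `s` by `ρ`. The part
  -- kept has finite cost, so it cancels in the comparison.
  have hcomp : π.withDensity (fun p => 1 - f p) + (s + ρ)
      ∈ couplings (π.map Prod.fst) (π.map Prod.snd) := by
    constructor
    · rw [Measure.map_add _ _ measurable_fst, hρ.1, ← hA, ← Measure.map_add _ _ measurable_fst,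
        hsplit]
    · rw [Measure.map_add _ _ measurable_snd, hρ.2, ← hG, ← Measure.map_add _ _ measurable_snd,
        hsplit]
  have hd := measurable_edist_sq (X := X)
  have hcost := hopt _ hcomp
  rw [lintegral_add_measure, lintegral_add_measure] at hcost
  have hπ : ∫⁻ p, edist p.1 p.2 ^ 2 ∂π = ∫⁻ p, edist p.1 p.2 ^ 2 ∂(π.withDensity fun p => 1 - f p)
      + ∫⁻ p, f p * edist p.1 p.2 ^ 2 ∂π := by
    conv_lhs => rw [← hsplit]
    rw [lintegral_add_measure, lintegral_withDensity_eq_lintegral_mul _ hf hd]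
    rfl
  have hfin' : ∫⁻ p, edist p.1 p.2 ^ 2 ∂(π.withDensity fun p => 1 - f p) ≠ ⊤ := by
    rw [hπ] at hfin
    exact (ENNReal.add_ne_top.1 hfin).1
  have hscost : ∫⁻ p, edist p.1 p.2 ^ 2 ∂s = ∫⁻ p, h p * edist p.1 p.2 ^ 2 ∂(A.prod G) := by
    rw [hs, lintegral_withDensity_eq_lintegral_mul _ hh hd]
    rfl
  have hae := ae_mem_prod_of_withDensity hA hG hS hfS
  have hρcost : ∫⁻ p, edist p.1 p.2 ^ 2 ∂ρ
      ≤ M ^ 2 * (∫⁻ p, f p ∂π - ∫⁻ p, h p ∂(A.prod G)) := by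
    rw [← hsu, ← hAu, ← hρu, ← lintegral_const]
    refine lintegral_mono_ae ?_
    filter_upwards [hρac.ae_le hae] with p hp
    gcongr
    exact hM _ hp.1 _ hp.2
  rw [hπ, hscost, add_assoc] at hcost
  have := ENNReal.le_of_add_le_add_left hfin' hcost
  refine this.trans ?_
  gcongr

/-! ### Weak limits of measures on varying spaces -/

/-- The images of the measures `P i` under the maps `T i` converge weakly to `ν`. -/
def WeakLimit {ι : Type*} (l : Filter ι) {Ω : ι → Type*} [∀ i, MeasurableSpace (Ω i)] {Z : Type*}
    [TopologicalSpace Z] [MeasurableSpace Z] (T : ∀ i, Ω i → Z) (P : ∀ i, Measure (Ω i))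
    (ν : Measure Z) : Prop :=
  ∀ F : BoundedContinuousFunction Z ℝ,
    Tendsto (fun i => ∫ x, F (T i x) ∂P i) l (𝓝 (∫ z, F z ∂ν))

namespace WeakLimit

variable {ι : Type*} {l : Filter ι} {Ω : ι → Type*} [∀ i, MeasurableSpace (Ω i)] {Z : Type*}
  [TopologicalSpace Z] [MeasurableSpace Z] {T : ∀ i, Ω i → Z} {P : ∀ i, Measure (Ω i)}
  {ν : Measure Z}

theorem tendsto_integral (h : WeakLimit l T P ν) {f : Z → ℝ} (hf : Continuous f) {C : ℝ}
    (hC : ∀ z, |f z| ≤ C) : Tendsto (fun i => ∫ x, f (T i x) ∂P i) l (𝓝 (∫ z, f z ∂ν)) :=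
  h (BoundedContinuousFunction.ofNormedAddCommGroup f hf C hC)

theorem mono_filter {l' : Filter ι} (h : WeakLimit l T P ν) (hl : l' ≤ l) : WeakLimit l' T P ν :=
  fun F => (h F).mono_left hl

theorem comp {Z' : Type*} [TopologicalSpace Z'] [MeasurableSpace Z'] [BorelSpace Z]
    [BorelSpace Z'] (h : WeakLimit l T P ν) {g : Z → Z'} (hg : Continuous g) :
    WeakLimit l (fun i x => g (T i x)) P (ν.map g) := by
  intro F
  have e : ∫ z, F z ∂(ν.map g) = ∫ z, F (g z) ∂ν :=
    integral_map hg.measurable.aemeasurable F.continuous.measurable.aestronglyMeasurable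
  rw [e]
  exact h (F.compContinuous ⟨g, hg⟩)

end WeakLimit

/-- Two uniformly bounded sequences of random variables that are asymptotically equal in
probability have asymptotically equal expectations. -/
theorem tendsto_integral_sub_of_tendsto_measure {ι : Type*} {l : Filter ι} {Ω : ι → Type*}
    [∀ i, MeasurableSpace (Ω i)] {P : ∀ i, Measure (Ω i)} [∀ i, IsProbabilityMeasure (P i)]
    {A B : ∀ i, Ω i → ℝ} (hA : ∀ i, Measurable (A i)) (hB : ∀ i, Measurable (B i)) {C : ℝ}
    (hAC : ∀ i x, |A i x| ≤ C) (hBC : ∀ i x, |B i x| ≤ C)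
    (h : ∀ η : ℝ, 0 < η → Tendsto (fun i => P i {x | η < |A i x - B i x|}) l (𝓝 0)) :
    Tendsto (fun i => ∫ x, A i x ∂P i - ∫ x, B i x ∂P i) l (𝓝 0) := by
  rw [Metric.tendsto_nhds]
  intro ε hε
  have h1 : Tendsto (fun i => (P i).real {x | ε / 2 < |A i x - B i x|}) l (𝓝 0) := by
    have := (ENNReal.tendsto_toReal ENNReal.zero_ne_top).comp (h (ε / 2) (by linarith))
    exact this
  have h2 : ∀ᶠ i in l, 2 * C * (P i).real {x | ε / 2 < |A i x - B i x|} < ε / 2 := by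
    have := h1.const_mul (2 * C)
    rw [mul_zero] at this
    exact this.eventually_lt_const (by linarith)
  filter_upwards [h2] with i hi
  have hms : MeasurableSet {x | ε / 2 < |A i x - B i x|} :=
    measurableSet_lt measurable_const ((hA i).sub (hB i)).abs
  rw [dist_zero_right, ← integral_sub (integrable_of_bounded (hA i) (hAC i))
    (integrable_of_bounded (hB i) (hBC i))]
  have hpt : ∀ x, ‖A i x - B i x‖
      ≤ ε / 2 + {x | ε / 2 < |A i x - B i x|}.indicator (fun _ => 2 * C) x := by
    intro x
    by_cases hx : x ∈ {x | ε / 2 < |A i x - B i x|}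
    · rw [Set.indicator_of_mem hx, Real.norm_eq_abs]
      have := abs_sub (A i x) (B i x)
      linarith [hAC i x, hBC i x]
    · rw [Set.indicator_of_notMem hx, Real.norm_eq_abs, add_zero]
      exact not_lt.1 hx
  have h_int : Integrable (fun x => ε / 2
      + {x | ε / 2 < |A i x - B i x|}.indicator (fun _ => 2 * C) x) (P i) :=
    (integrable_const _).add ((integrable_const _).indicator hms)
  refine (norm_integral_le_of_norm_le h_int (ae_of_all _ hpt)).trans_lt ?_
  rw [integral_add (integrable_const _) ((integrable_const _).indicator hms),
    integral_indicator_const _ hms]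
  simp only [integral_const, probReal_univ, smul_eq_mul, one_mul]
  linarith

/-! ### Bump functions and finite rank kernels -/

/-- A partition of unity by tent functions at finitely many points of a dense sequence, up to small
mass. Dividing by `max η (∑ ψ)` instead of `∑ ψ` keeps continuity where all tents vanish, and the
sum is still `1` on the union of the balls of radius `η`. -/
theorem exists_bumps {Y : Type*} [MetricSpace Y] [SecondCountableTopology Y] [Nonempty Y]
    [MeasurableSpace Y] [BorelSpace Y] (ρ : Measure Y) [IsFiniteMeasure ρ] {η κ : ℝ}
    (hη : 0 < η) (hκ : 0 < κ) :
    ∃ (N : ℕ) (z : Fin N → Y) (φ : Fin N → Y → ℝ), (∀ k, Continuous (φ k)) ∧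
      (∀ k y, 0 ≤ φ k y) ∧ (∀ y, ∑ k, φ k y ≤ 1) ∧
      (∀ k y, φ k y ≠ 0 → dist y (z k) < 2 * η) ∧ ρ.real {y | ∑ k, φ k y < 1} ≤ κ := by
  obtain ⟨D, hD⟩ := TopologicalSpace.exists_dense_seq Y
  let U : ℕ → Set Y := fun N => ⋃ k ∈ Set.Iio N, Metric.ball (D k) η
  have hUo : ∀ N, IsOpen (U N) := fun N => isOpen_biUnion fun _ _ => Metric.isOpen_ball
  have hUm : Monotone U := fun a b hab =>
    Set.biUnion_mono (Set.Iio_subset_Iio hab) fun _ _ => le_rfl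
  have hUu : ⋂ N, (U N)ᶜ = ∅ := by
    rw [← Set.compl_iUnion, Set.compl_empty_iff, Set.eq_univ_iff_forall]
    intro y
    obtain ⟨k, hk⟩ := hD.exists_dist_lt y hη
    exact Set.mem_iUnion.2 ⟨k + 1, Set.mem_biUnion (Nat.lt_succ_self k) hk⟩
  have hlim : Tendsto (fun N => ρ (U N)ᶜ) atTop (𝓝 0) := by
    have := tendsto_measure_iInter_atTop (μ := ρ) (s := fun N => (U N)ᶜ)
      (fun N => (hUo N).measurableSet.compl.nullMeasurableSet)
      (fun a b hab => Set.compl_subset_compl.2 (hUm hab)) ⟨0, by finiteness⟩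
    rwa [hUu, measure_empty] at this
  obtain ⟨N, hN⟩ := (hlim.eventually_lt_const (ENNReal.ofReal_pos.2 hκ)).exists
  let ψ : Fin N → Y → ℝ := fun k y => max 0 (2 * η - dist y (D k))
  have hψ0 : ∀ k y, 0 ≤ ψ k y := fun k y => le_max_left _ _
  have hpos : ∀ y, 0 < max η (∑ k, ψ k y) := fun y => lt_max_of_lt_left hη
  refine ⟨N, fun k => D k, fun k y => ψ k y / max η (∑ k, ψ k y), ?_, ?_, ?_, ?_, ?_⟩
  · intro k
    refine Continuous.div (by fun_prop) ?_ fun y => (hpos y).ne'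
    exact continuous_const.max (continuous_finsetSum _ fun j _ => by fun_prop)
  · exact fun k y => div_nonneg (hψ0 k y) (hpos y).le
  · intro y
    rw [← Finset.sum_div, div_le_one (hpos y)]
    exact le_max_right _ _
  · intro k y hne
    by_contra hcon
    refine hne ?_
    have : ψ k y = 0 := max_eq_left (by linarith)
    simp [this]
  · have hsub : {y | ∑ k, ψ k y / max η (∑ k, ψ k y) < 1} ⊆ (U N)ᶜ := by
      intro y hy hyU
      obtain ⟨k, hk, hyk⟩ := Set.mem_iUnion₂.1 hyU
      have h1 : η ≤ ∑ k, ψ k y := by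
        have h2 : ψ ⟨k, hk⟩ y ≤ ∑ k, ψ k y :=
          Finset.single_le_sum (f := fun k => ψ k y) (fun j _ => hψ0 j y) (Finset.mem_univ _)
        have h3 : 2 * η - dist y (D k) ≤ ψ ⟨k, hk⟩ y := le_max_right _ _
        have h4 : dist y (D k) < η := hyk
        linarith
      have hy' : ∑ k, ψ k y / max η (∑ k, ψ k y) < 1 := hy
      rw [← Finset.sum_div, max_eq_right h1, div_self (by linarith)] at hy'
      exact lt_irrefl _ hy'
    exact ENNReal.toReal_le_of_le_ofReal hκ.le ((measure_mono hsub).trans hN.le)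

/-- The kernel `∑ b_{jk} ψ_j(x) ψ_k(y)`. -/
def finiteRank {X : Type*} {N : ℕ} (b : Fin N → Fin N → ℝ) (ψ : Fin N → X → ℝ) (p : X × X) : ℝ :=
  ∑ j, ∑ k, b j k * ψ j p.1 * ψ k p.2

section FiniteRank

variable {X : Type*} {N : ℕ} {b : Fin N → Fin N → ℝ} {ψ : Fin N → X → ℝ}

theorem finiteRank_nonneg (hb : ∀ j k, 0 ≤ b j k) (hψ0 : ∀ k x, 0 ≤ ψ k x) (p : X × X) :
    0 ≤ finiteRank b ψ p :=
  Finset.sum_nonneg fun j _ => Finset.sum_nonneg fun k _ =>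
    mul_nonneg (mul_nonneg (hb j k) (hψ0 j _)) (hψ0 k _)

variable [MeasurableSpace X]

theorem measurable_finiteRank (hψ : ∀ k, Measurable (ψ k)) : Measurable (finiteRank b ψ) := by
  unfold finiteRank
  fun_prop

theorem lintegral_finiteRank_snd (hψ : ∀ k, Measurable (ψ k)) (hb : ∀ j k, 0 ≤ b j k)
    (hψ0 : ∀ k x, 0 ≤ ψ k x) (hψ1 : ∀ k x, ψ k x ≤ 1) (γ : Measure X) [IsFiniteMeasure γ] (x : X) :
    ∫⁻ y, ENNReal.ofReal (finiteRank b ψ (x, y)) ∂γ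
      = ENNReal.ofReal (∑ j, ψ j x * ∑ k, b j k * ∫ y, ψ k y ∂γ) := by
  have hi : ∀ k, Integrable (ψ k) γ := fun k => integrable_of_bounded (hψ k) (C := 1) fun x => by
    rw [abs_of_nonneg (hψ0 k x)]; exact hψ1 k x
  have hi2 : ∀ j k, Integrable (fun y => b j k * ψ j x * ψ k y) γ := fun j k => (hi k).const_mul _
  rw [← ofReal_integral_eq_lintegral_ofReal]
  · congr 1
    simp only [finiteRank]
    rw [integral_finsetSum _ fun j _ => integrable_finsetSum _ fun k _ => hi2 j k]
    refine Finset.sum_congr rfl fun j _ => ?_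
    rw [integral_finsetSum _ fun k _ => hi2 j k, Finset.mul_sum]
    refine Finset.sum_congr rfl fun k _ => ?_
    rw [integral_const_mul]; ring
  · exact integrable_finsetSum _ fun j _ => integrable_finsetSum _ fun k _ => hi2 j k
  · exact ae_of_all _ fun y => finiteRank_nonneg hb hψ0 _

theorem lintegral_finiteRank_fst (hψ : ∀ k, Measurable (ψ k)) (hb : ∀ j k, 0 ≤ b j k)
    (hψ0 : ∀ k x, 0 ≤ ψ k x) (hψ1 : ∀ k x, ψ k x ≤ 1) (α : Measure X) [IsFiniteMeasure α] (y : X) :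
    ∫⁻ x, ENNReal.ofReal (finiteRank b ψ (x, y)) ∂α
      = ENNReal.ofReal (∑ k, ψ k y * ∑ j, b j k * ∫ x, ψ j x ∂α) := by
  rw [← lintegral_finiteRank_snd (b := fun j k => b k j) hψ (fun j k => hb k j) hψ0 hψ1 α y]
  refine lintegral_congr fun x => ?_
  simp only [finiteRank]
  rw [Finset.sum_comm]
  congr 1
  refine Finset.sum_congr rfl fun j _ => Finset.sum_congr rfl fun k _ => ?_
  ring

theorem lintegral_finiteRank_prod (hψ : ∀ k, Measurable (ψ k)) (hb : ∀ j k, 0 ≤ b j k)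
    (hψ0 : ∀ k x, 0 ≤ ψ k x) (hψ1 : ∀ k x, ψ k x ≤ 1) (α γ : Measure X) [IsFiniteMeasure α]
    [IsFiniteMeasure γ] :
    ∫⁻ p, ENNReal.ofReal (finiteRank b ψ p) ∂(α.prod γ)
      = ENNReal.ofReal (∑ j, ∑ k, b j k * (∫ x, ψ j x ∂α) * ∫ y, ψ k y ∂γ) := by
  have hi : ∀ k, Integrable (ψ k) α := fun k => integrable_of_bounded (hψ k) (C := 1) fun x => by
    rw [abs_of_nonneg (hψ0 k x)]; exact hψ1 k x
  rw [lintegral_prod _ (measurable_finiteRank hψ).ennreal_ofReal.aemeasurable]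
  simp only [lintegral_finiteRank_snd hψ hb hψ0 hψ1 γ]
  rw [← ofReal_integral_eq_lintegral_ofReal]
  · congr 1
    rw [integral_finsetSum _ fun j _ => (hi j).mul_const _]
    refine Finset.sum_congr rfl fun j _ => ?_
    rw [integral_mul_const, Finset.mul_sum]
    refine Finset.sum_congr rfl fun k _ => ?_
    ring
  · exact integrable_finsetSum _ fun j _ => (hi j).mul_const _
  · refine ae_of_all _ fun x => Finset.sum_nonneg fun j _ => mul_nonneg (hψ0 j x)
      (Finset.sum_nonneg fun k _ => mul_nonneg (hb j k) (integral_nonneg (hψ0 k)))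

/-- Removing `A'` and `G'` from the marginals costs `h` no more than the mass removed, because rows
and columns have integral at most `1`. -/
theorem lintegral_prod_add_le {h : X × X → ℝ≥0∞} (hh : Measurable h) {A A' G G' : Measure X}
    [IsFiniteMeasure A] [IsFiniteMeasure A'] [IsFiniteMeasure G] [IsFiniteMeasure G']
    (hG : ∀ x, ∫⁻ y, h (x, y) ∂(G + G') ≤ 1) (hA : ∀ y, ∫⁻ x, h (x, y) ∂(A + A') ≤ 1) :
    ∫⁻ p, h p ∂((A + A').prod (G + G'))
      ≤ ∫⁻ p, h p ∂(A.prod G) + A' Set.univ + G' Set.univ := by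
  have hm : ∀ ρ : Measure X, ∀ [IsFiniteMeasure ρ], Measurable fun x => ∫⁻ y, h (x, y) ∂ρ :=
    fun ρ _ => hh.lintegral_prod_right'
  rw [lintegral_prod _ hh.aemeasurable, lintegral_prod _ hh.aemeasurable, lintegral_add_measure]
  have h1 : ∫⁻ x, ∫⁻ y, h (x, y) ∂(G + G') ∂A' ≤ A' Set.univ := by
    refine (lintegral_mono hG).trans ?_
    simp
  have h2 : ∫⁻ x, ∫⁻ y, h (x, y) ∂(G + G') ∂A
      ≤ ∫⁻ x, ∫⁻ y, h (x, y) ∂G ∂A + G' Set.univ := by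
    simp only [lintegral_add_measure]
    rw [lintegral_add_left (hm G)]
    gcongr
    rw [lintegral_lintegral_swap (f := fun x y => h (x, y)) hh.aemeasurable]
    refine (lintegral_mono (g := fun _ => 1) fun y => ?_).trans (by simp)
    exact (lintegral_mono' (Measure.le_add_right le_rfl) le_rfl).trans (hA y)
  calc _ ≤ _ := add_le_add h2 h1
    _ = _ := by ring

end FiniteRank

/-- A continuous cutoff function, equal to `1` on the ball of radius `R` and to `0` outside the
ball of radius `2 * R`. -/
def cutoff {Y : Type*} [MetricSpace Y] (o : Y) (R : ℝ) (z : Y) : ℝ :=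
  max 0 (min 1 (2 - dist z o / R))

section Cutoff

variable {Y : Type*} [MetricSpace Y] (o : Y) {R : ℝ}

theorem continuous_cutoff (R : ℝ) : Continuous (cutoff o R) := by
  unfold cutoff
  fun_prop

theorem cutoff_nonneg (R : ℝ) (z : Y) : 0 ≤ cutoff o R z := le_max_left _ _

theorem cutoff_le_one (R : ℝ) (z : Y) : cutoff o R z ≤ 1 :=
  max_le zero_le_one (min_le_left _ _)

theorem dist_lt_of_cutoff_ne_zero (hR : 0 < R) {z : Y} (h : cutoff o R z ≠ 0) :
    dist z o < 2 * R := by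
  by_contra hcon
  refine h (max_eq_left ((min_le_right _ _).trans ?_))
  have : 2 ≤ dist z o / R := by rw [le_div_iff₀ hR]; linarith
  linarith

theorem cutoff_eq_one (hR : 0 < R) {z : Y} (h : dist z o ≤ R) : cutoff o R z = 1 := by
  have : dist z o / R ≤ 1 := by rw [div_le_one hR]; exact h
  unfold cutoff
  rw [min_eq_left (by linarith), max_eq_right zero_le_one]

end Cutoff

/-! ### Limits of near-optimal couplings are optimal -/

section

variable {Y : Type*} [MetricSpace Y]

/-- The cutoff, on `Y × Y`, to the pairs of points in the ball of radius `2 * R`. -/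
def pairCutoff (o : Y) (R : ℝ) (p : Y × Y) : ℝ := cutoff o R p.1 * cutoff o R p.2

/-- A bounded continuous lower approximation of the squared distance. -/
def truncCost (o : Y) (R η : ℝ) (p : Y × Y) : ℝ :=
  pairCutoff o R p * max 0 (dist p.1 p.2 - 2 * η) ^ 2

theorem continuous_pairCutoff (o : Y) (R : ℝ) : Continuous (pairCutoff o R) :=
  ((continuous_cutoff o R).comp continuous_fst).mul ((continuous_cutoff o R).comp continuous_snd)

theorem pairCutoff_nonneg (o : Y) (R : ℝ) (p : Y × Y) : 0 ≤ pairCutoff o R p :=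
  mul_nonneg (cutoff_nonneg o R _) (cutoff_nonneg o R _)

theorem pairCutoff_le_one (o : Y) (R : ℝ) (p : Y × Y) : pairCutoff o R p ≤ 1 :=
  mul_le_one₀ (cutoff_le_one o R _) (cutoff_nonneg o R _) (cutoff_le_one o R _)

theorem continuous_truncCost (o : Y) (R η : ℝ) : Continuous (truncCost o R η) :=
  (continuous_pairCutoff o R).mul (by fun_prop)

theorem truncCost_nonneg (o : Y) (R η : ℝ) (p : Y × Y) : 0 ≤ truncCost o R η p :=
  mul_nonneg (pairCutoff_nonneg o R p) (by positivity)

theorem truncCost_le (o : Y) {R η : ℝ} (hR : 0 < R) (hη : 0 < η) (p : Y × Y) :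
    truncCost o R η p ≤ (4 * R) ^ 2 := by
  by_cases h1 : cutoff o R p.1 = 0
  · simp only [truncCost, pairCutoff, h1, zero_mul]; positivity
  by_cases h2 : cutoff o R p.2 = 0
  · simp only [truncCost, pairCutoff, h2, zero_mul, mul_zero]; positivity
  have d1 := dist_lt_of_cutoff_ne_zero o hR h1
  have d2 := dist_lt_of_cutoff_ne_zero o hR h2
  have d3 := dist_triangle_right p.1 p.2 o
  have h3 : max 0 (dist p.1 p.2 - 2 * η) ≤ 4 * R := max_le (by linarith) (by linarith)
  calc truncCost o R η p ≤ 1 * max 0 (dist p.1 p.2 - 2 * η) ^ 2 :=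
        mul_le_mul_of_nonneg_right (pairCutoff_le_one o R p) (by positivity)
    _ ≤ (4 * R) ^ 2 := by rw [one_mul]; gcongr

variable {X : Type*} [MetricSpace X] [MeasurableSpace X] [BorelSpace X]
  [SecondCountableTopology X] [MeasurableSpace Y] [BorelSpace Y] [SecondCountableTopology Y]

/-- The estimate before passing to the limit. The part of `P` seen by the cutoff and by the set
where `e ≤ η` is replaced by the plan with kernel `∑ c j k φ_j(T x) φ_k(T y)`. The terms on the
right are the cost of the new plan, the squared diameter times the mass the kernel fails to
transport, the non-optimality `ε`, and the exceptional set. The competitor enters only through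
finitely many numbers, so the right-hand side behaves well under weak convergence. -/
theorem lintegral_truncCost_le {T : X → Y} (hT : Measurable T) {e : X → ℝ} (he : Measurable e)
    (hTe : ∀ x x', |dist x x' - dist (T x) (T x')| ≤ e x + e x')
    {P : Measure (X × X)} [IsProbabilityMeasure P] {ε : ℝ≥0∞}
    (hfin : ∫⁻ p, edist p.1 p.2 ^ 2 ∂P ≠ ⊤)
    (hopt : ∀ q ∈ couplings (P.map Prod.fst) (P.map Prod.snd),
      ∫⁻ p, edist p.1 p.2 ^ 2 ∂P ≤ ∫⁻ p, edist p.1 p.2 ^ 2 ∂q + ε)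
    {N : ℕ} {z : Fin N → Y} {φ : Fin N → Y → ℝ} {η κ R : ℝ} (hη : 0 < η)
    (hκ : 0 < κ) (hR : 0 < R) (hφ : ∀ k, Continuous (φ k)) (hφ0 : ∀ k y, 0 ≤ φ k y)
    (hφ1 : ∀ y, ∑ k, φ k y ≤ 1) (hφz : ∀ k y, φ k y ≠ 0 → dist y (z k) < 2 * η)
    {c : Fin N → Fin N → ℝ} (hc : ∀ j k, 0 ≤ c j k) {a g : Fin N → ℝ}
    (ha : ∀ k, ∫ p, φ k (T p.1) ∂P = a k) (hg : ∀ k, ∫ p, φ k (T p.2) ∂P = g k)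
    (hrow : ∀ j, ∑ k, c j k * g k ≤ 1 + κ) (hcol : ∀ k, ∑ j, c j k * a j ≤ 1 + κ) (o : Y)
    {b : ℝ≥0∞} (hb : P {p | e p.1 ≤ η ∧ e p.2 ≤ η}ᶜ ≤ b) :
    ∫⁻ p, ENNReal.ofReal (truncCost o R η (T p.1, T p.2)) ∂P
      ≤ ENNReal.ofReal (∑ j, ∑ k, c j k * (dist (z j) (z k) + 6 * η) ^ 2 * a j * g k)
        + ENNReal.ofReal (4 * R + 2 * η) ^ 2
          * (ENNReal.ofReal (1 - ∑ j, ∑ k, c j k / (1 + κ) * a j * g k)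
            + 2 * (∫⁻ p, ENNReal.ofReal (1 - pairCutoff o R (T p.1, T p.2)) ∂P + b))
        + ε + ENNReal.ofReal ((4 * R) ^ 2) * b := by
  classical
  have hκ1 : 0 < 1 + κ := by linarith
  set B : Set (X × X) := {p | e p.1 ≤ η ∧ e p.2 ≤ η} with hB
  have hBm : MeasurableSet B :=
    (measurableSet_le (he.comp measurable_fst) measurable_const).inter
      (measurableSet_le (he.comp measurable_snd) measurable_const)
  have hTT : Measurable fun p : X × X => (T p.1, T p.2) :=
    (hT.comp measurable_fst).prodMk (hT.comp measurable_snd)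
  have hcut : Measurable fun p : X × X => pairCutoff o R (T p.1, T p.2) :=
    (continuous_pairCutoff o R).measurable.comp hTT
  set f : X × X → ℝ≥0∞ := B.indicator fun p => ENNReal.ofReal (pairCutoff o R (T p.1, T p.2))
    with hf
  have hfm : Measurable f := hcut.ennreal_ofReal.indicator hBm
  have hf1 : ∀ p, f p ≤ 1 := fun p => by
    refine (Set.indicator_le_self _ _ p).trans ?_
    rw [← ENNReal.ofReal_one]
    exact ENNReal.ofReal_le_ofReal (pairCutoff_le_one o R _)
  set ψ : Fin N → X → ℝ := fun k x => φ k (T x) with hψ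
  have hψm : ∀ k, Measurable (ψ k) := fun k => (hφ k).measurable.comp hT
  have hψ0 : ∀ k x, 0 ≤ ψ k x := fun k x => hφ0 k _
  have hψs : ∀ x, ∑ k, ψ k x ≤ 1 := fun x => hφ1 _
  have hψ1 : ∀ k x, ψ k x ≤ 1 := fun k x =>
    (Finset.single_le_sum (f := fun k => ψ k x) (fun j _ => hψ0 j x) (Finset.mem_univ k)).trans
      (hψs x)
  -- The weights `a`, `g` belong to `P` and not to its limit, so rows and columns are bounded only
  -- by `1 + κ`; the division restores the bound `1`.
  set c' : Fin N → Fin N → ℝ := fun j k => c j k / (1 + κ) with hc'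
  have hc'0 : ∀ j k, 0 ≤ c' j k := fun j k => div_nonneg (hc j k) hκ1.le
  set h : X × X → ℝ≥0∞ := fun p => ENNReal.ofReal (finiteRank c' ψ p) with hh
  have hhm : Measurable h := (measurable_finiteRank hψm).ennreal_ofReal
  set A := (P.withDensity f).map Prod.fst with hA
  set G := (P.withDensity f).map Prod.snd with hG
  set A' := (P.withDensity fun p => 1 - f p).map Prod.fst with hA'
  set G' := (P.withDensity fun p => 1 - f p).map Prod.snd with hG'
  have hd1 : ∫⁻ p, (1 - f p) ∂P ≠ ⊤ :=
    ne_top_of_le_ne_top (b := ∫⁻ _, 1 ∂P) (by simp) (lintegral_mono fun p => tsub_le_self)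
  have hf1' : ∫⁻ p, f p ∂P ≠ ⊤ :=
    ne_top_of_le_ne_top (b := ∫⁻ _, 1 ∂P) (by simp) (lintegral_mono hf1)
  have hw1 : IsFiniteMeasure (P.withDensity f) := isFiniteMeasure_withDensity hf1'
  have hw2 : IsFiniteMeasure (P.withDensity fun p => 1 - f p) := isFiniteMeasure_withDensity hd1
  have hsplit : P.withDensity f + P.withDensity (fun p => 1 - f p) = P := by
    rw [← withDensity_add_left hfm]
    have : (f + fun p => 1 - f p) = 1 := by
      ext p; simp [add_tsub_cancel_of_le (hf1 p)]
    rw [this, withDensity_one]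
  have hAA : A + A' = P.map Prod.fst := by
    rw [hA, hA', ← Measure.map_add _ _ measurable_fst, hsplit]
  have hGG : G + G' = P.map Prod.snd := by
    rw [hG, hG', ← Measure.map_add _ _ measurable_snd, hsplit]
  have hα : IsProbabilityMeasure (P.map Prod.fst) :=
    Measure.isProbabilityMeasure_map measurable_fst.aemeasurable
  have hγ : IsProbabilityMeasure (P.map Prod.snd) :=
    Measure.isProbabilityMeasure_map measurable_snd.aemeasurable
  have ha' : ∀ k, ∫ x, ψ k x ∂(P.map Prod.fst) = a k := fun k => by
    rw [integral_map measurable_fst.aemeasurable (hψm k).aestronglyMeasurable, ← ha k]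
  have hg' : ∀ k, ∫ x, ψ k x ∂(P.map Prod.snd) = g k := fun k => by
    rw [integral_map measurable_snd.aemeasurable (hψm k).aestronglyMeasurable, ← hg k]
  have hrowsum : ∀ x, ∫⁻ y, h (x, y) ∂(G + G') ≤ 1 := fun x => by
    rw [hGG, hh, lintegral_finiteRank_snd hψm hc'0 hψ0 hψ1, ← ENNReal.ofReal_one]
    refine ENNReal.ofReal_le_ofReal ?_
    calc ∑ j, ψ j x * ∑ k, c' j k * ∫ y, ψ k y ∂(P.map Prod.snd)
        ≤ ∑ j, ψ j x * 1 := by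
          refine Finset.sum_le_sum fun j _ => mul_le_mul_of_nonneg_left ?_ (hψ0 j x)
          simp only [hg', hc', div_mul_eq_mul_div]
          rw [← Finset.sum_div, div_le_one hκ1]
          exact hrow j
      _ ≤ 1 := by simpa using hψs x
  have hcolsum : ∀ y, ∫⁻ x, h (x, y) ∂(A + A') ≤ 1 := fun y => by
    rw [hAA, hh, lintegral_finiteRank_fst hψm hc'0 hψ0 hψ1, ← ENNReal.ofReal_one]
    refine ENNReal.ofReal_le_ofReal ?_
    calc ∑ k, ψ k y * ∑ j, c' j k * ∫ x, ψ j x ∂(P.map Prod.fst)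
        ≤ ∑ k, ψ k y * 1 := by
          refine Finset.sum_le_sum fun k _ => mul_le_mul_of_nonneg_left ?_ (hψ0 k y)
          simp only [ha', hc', div_mul_eq_mul_div]
          rw [← Finset.sum_div, div_le_one hκ1]
          exact hcol k
      _ ≤ 1 := by simpa using hψs y
  set S : Set X := {x | e x ≤ η ∧ dist (T x) o < 2 * R} with hS
  have hSm : MeasurableSet S := (measurableSet_le he measurable_const).inter
    (measurableSet_lt (hT.dist measurable_const) measurable_const)
  have hfS : ∀ p, f p ≠ 0 → p.1 ∈ S ∧ p.2 ∈ S := by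
    intro p hp
    have hpB : p ∈ B := Set.mem_of_indicator_ne_zero hp
    have hpc : pairCutoff o R (T p.1, T p.2) ≠ 0 := by
      intro h0
      rw [hf, Set.indicator_of_mem hpB, h0] at hp
      simp at hp
    exact ⟨⟨hpB.1, dist_lt_of_cutoff_ne_zero o hR (left_ne_zero_of_mul hpc)⟩,
      ⟨hpB.2, dist_lt_of_cutoff_ne_zero o hR (right_ne_zero_of_mul hpc)⟩⟩
  have hdist : ∀ x y, e x ≤ η → e y ≤ η → dist x y ≤ dist (T x) (T y) + 2 * η := by
    intro x y hx hy
    have := (abs_le.1 (hTe x y)).2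
    linarith
  have hM : ∀ x ∈ S, ∀ y ∈ S, edist x y ≤ ENNReal.ofReal (4 * R + 2 * η) := by
    intro x hx y hy
    rw [edist_dist]
    refine ENNReal.ofReal_le_ofReal ?_
    have := hdist x y hx.1 hy.1
    have h2 := dist_triangle_right (T x) (T y) o
    linarith [hx.2, hy.2]
  have hmain := lintegral_le_of_nearOptimal hfin hopt hfm hf1 hhm hA.symm hG.symm
    (fun x => (lintegral_mono' (Measure.le_add_right le_rfl) le_rfl).trans (hrowsum x))
    (fun y => (lintegral_mono' (Measure.le_add_right le_rfl) le_rfl).trans (hcolsum y)) hSm hfS hM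
  -- the cost of the new part
  have hcost : ∫⁻ p, h p * edist p.1 p.2 ^ 2 ∂(A.prod G)
      ≤ ENNReal.ofReal (∑ j, ∑ k, c j k * (dist (z j) (z k) + 6 * η) ^ 2 * a j * g k) := by
    set d : Fin N → Fin N → ℝ := fun j k => c j k * (dist (z j) (z k) + 6 * η) ^ 2 with hd
    have hd0 : ∀ j k, 0 ≤ d j k := fun j k => mul_nonneg (hc j k) (by positivity)
    have hdm : Measurable fun p => ENNReal.ofReal (finiteRank d ψ p) :=
      (measurable_finiteRank hψm).ennreal_ofReal
    calc ∫⁻ p, h p * edist p.1 p.2 ^ 2 ∂(A.prod G)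
        ≤ ∫⁻ p, ENNReal.ofReal (finiteRank d ψ p) ∂(A.prod G) := by
          refine lintegral_mono_ae ?_
          filter_upwards [ae_mem_prod_of_withDensity hA.symm hG.symm hSm hfS] with p hp
          rw [hh, edist_dist, ← ENNReal.ofReal_pow dist_nonneg,
            ← ENNReal.ofReal_mul (finiteRank_nonneg hc'0 hψ0 p)]
          refine ENNReal.ofReal_le_ofReal ?_
          simp only [finiteRank, Finset.sum_mul]
          refine Finset.sum_le_sum fun j _ => Finset.sum_le_sum fun k _ => ?_
          by_cases hj : ψ j p.1 = 0
          · simp [hj]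
          by_cases hk : ψ k p.2 = 0
          · simp [hk]
          -- The constant `6 * η` consists of `2 * η` for the distortion of `T` and `2 * η` for each
          -- of the two bump supports.
          have h1 := hφz j _ hj
          have h2 := hφz k _ hk
          have h3 := hdist p.1 p.2 hp.1.1 hp.2.1
          have h4 := dist_triangle4 (T p.1) (z j) (z k) (T p.2)
          rw [dist_comm (z k)] at h4
          have h5 : dist p.1 p.2 ^ 2 ≤ (dist (z j) (z k) + 6 * η) ^ 2 := by
            gcongr
            linarith
          have h6 : c' j k ≤ c j k := div_le_self (hc j k) (by linarith)
          calc c' j k * ψ j p.1 * ψ k p.2 * dist p.1 p.2 ^ 2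
              = c' j k * dist p.1 p.2 ^ 2 * (ψ j p.1 * ψ k p.2) := by ring
            _ ≤ d j k * (ψ j p.1 * ψ k p.2) := by
                refine mul_le_mul_of_nonneg_right ?_ (mul_nonneg (hψ0 _ _) (hψ0 _ _))
                exact mul_le_mul h6 h5 (by positivity) (hc j k)
            _ = _ := by ring
      _ ≤ ∫⁻ p, ENNReal.ofReal (finiteRank d ψ p) ∂((P.map Prod.fst).prod (P.map Prod.snd)) := by
          rw [lintegral_prod _ hdm.aemeasurable, lintegral_prod _ hdm.aemeasurable]
          refine lintegral_mono' (hAA ▸ Measure.le_add_right le_rfl) fun x => ?_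
          exact lintegral_mono' (hGG ▸ Measure.le_add_right le_rfl) le_rfl
      _ = _ := by
          rw [lintegral_finiteRank_prod hψm hd0 hψ0 hψ1]
          simp only [ha', hg', hd]
  -- the mass defect
  have hA'u : A' Set.univ = ∫⁻ p, (1 - f p) ∂P := by
    rw [hA', Measure.map_apply measurable_fst .univ, Set.preimage_univ,
      withDensity_apply _ .univ, setLIntegral_univ]
  have hG'u : G' Set.univ = ∫⁻ p, (1 - f p) ∂P := by
    rw [hG', Measure.map_apply measurable_snd .univ, Set.preimage_univ,
      withDensity_apply _ .univ, setLIntegral_univ]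
  have hmass : ∫⁻ p, f p ∂P - ∫⁻ p, h p ∂(A.prod G)
      ≤ ENNReal.ofReal (1 - ∑ j, ∑ k, c j k / (1 + κ) * a j * g k)
        + 2 * ∫⁻ p, (1 - f p) ∂P := by
    have h1 := lintegral_prod_add_le hhm hrowsum hcolsum
    rw [hAA, hGG, hh, lintegral_finiteRank_prod hψm hc'0 hψ0 hψ1, hA'u, hG'u] at h1
    simp only [ha', hg', hc'] at h1
    rw [tsub_le_iff_right]
    calc ∫⁻ p, f p ∂P ≤ ENNReal.ofReal 1 := by
          rw [ENNReal.ofReal_one]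
          exact (lintegral_mono hf1).trans (by simp)
      _ ≤ ENNReal.ofReal (1 - ∑ j, ∑ k, c j k / (1 + κ) * a j * g k)
          + ENNReal.ofReal (∑ j, ∑ k, c j k / (1 + κ) * a j * g k) := by
          refine le_trans ?_ ENNReal.ofReal_add_le
          rw [sub_add_cancel]
      _ ≤ _ := by
          refine (add_le_add le_rfl h1).trans (le_of_eq ?_)
          ring
  have hdef : ∫⁻ p, (1 - f p) ∂P
      ≤ ∫⁻ p, ENNReal.ofReal (1 - pairCutoff o R (T p.1, T p.2)) ∂P + b := by
    calc ∫⁻ p, (1 - f p) ∂P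
        ≤ ∫⁻ p, (ENNReal.ofReal (1 - pairCutoff o R (T p.1, T p.2)) + Bᶜ.indicator 1 p) ∂P := by
          refine lintegral_mono fun p => ?_
          by_cases hp : p ∈ B
          · rw [hf, Set.indicator_of_mem hp, Set.indicator_of_notMem (by simpa using hp), add_zero,
              ENNReal.ofReal_sub _ (pairCutoff_nonneg o R _), ENNReal.ofReal_one]
          · rw [hf, Set.indicator_of_notMem hp, Set.indicator_of_mem (by simpa using hp)]
            simp
      _ ≤ _ := by
          rw [lintegral_add_left (by fun_prop), lintegral_indicator_one hBm.compl]
          gcongr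
  -- On `B` the map `T` enlarges distances by at most `2 * η`, the shift built into `truncCost`. Off
  -- `B` the uniform bound of the truncated cost is used.
  have hleft : ∫⁻ p, ENNReal.ofReal (truncCost o R η (T p.1, T p.2)) ∂P
      ≤ ∫⁻ p, f p * edist p.1 p.2 ^ 2 ∂P + ENNReal.ofReal ((4 * R) ^ 2) * b := by
    calc ∫⁻ p, ENNReal.ofReal (truncCost o R η (T p.1, T p.2)) ∂P
        ≤ ∫⁻ p, (f p * edist p.1 p.2 ^ 2
            + Bᶜ.indicator (fun _ => ENNReal.ofReal ((4 * R) ^ 2)) p) ∂P := by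
          refine lintegral_mono fun p => ?_
          by_cases hp : p ∈ B
          · rw [hf, Set.indicator_of_mem hp, Set.indicator_of_notMem (by simpa using hp), add_zero,
              edist_dist, ← ENNReal.ofReal_pow dist_nonneg,
              ← ENNReal.ofReal_mul (pairCutoff_nonneg o R _)]
            refine ENNReal.ofReal_le_ofReal
              (mul_le_mul_of_nonneg_left ?_ (pairCutoff_nonneg o R _))
            have h1 := (abs_le.1 (hTe p.1 p.2)).1
            have h2 : max 0 (dist (T p.1) (T p.2) - 2 * η) ≤ dist p.1 p.2 :=
              max_le dist_nonneg (by linarith [hp.1, hp.2])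
            gcongr
          · rw [hf, Set.indicator_of_notMem hp, Set.indicator_of_mem (by simpa using hp), zero_mul,
              zero_add]
            exact ENNReal.ofReal_le_ofReal (truncCost_le o hR hη _)
      _ ≤ _ := by
          rw [lintegral_add_left (f := fun p => f p * edist p.1 p.2 ^ 2)
              (hfm.mul measurable_edist_sq),
            lintegral_indicator_const hBm.compl]
          gcongr
  refine hleft.trans ?_
  refine add_le_add (hmain.trans ?_) le_rfl
  refine add_le_add (add_le_add hcost ?_) le_rfl
  gcongr
  refine hmass.trans ?_
  gcongr

end

/-! ### Passage to the limit in the optimality estimate -/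

section

variable {ι : Type*} {l : Filter ι} [l.NeBot] {X : ι → Type*} [∀ i, MetricSpace (X i)]
  [∀ i, MeasurableSpace (X i)] [∀ i, BorelSpace (X i)] [∀ i, SecondCountableTopology (X i)]
  {Y : Type*} [MetricSpace Y] [MeasurableSpace Y] [BorelSpace Y] [SecondCountableTopology Y]
  {T : ∀ i, X i → Y} {e : ∀ i, X i → ℝ} {P : ∀ i, Measure (X i × X i)}
  [∀ i, IsProbabilityMeasure (P i)] {ε : ι → ℝ≥0∞} {π q : Measure (Y × Y)}
  [IsProbabilityMeasure π]

/-- The competitor `q` is replaced by its averages `Q j k` over products of bumps. Relative to the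
limiting marginals, the kernel with coefficients `Q j k / (a j * g k)` has rows and columns at most
`1`; relative to the marginals of `P i` they are eventually at most `1 + κ`. With the bumps fixed,
every remaining quantity is an integral of a bounded continuous function or tends to zero. -/
theorem lintegral_truncCost_limit_le (hT : ∀ i, Measurable (T i)) (he : ∀ i, Measurable (e i))
    (hTe : ∀ i x x', |dist x x' - dist (T i x) (T i x')| ≤ e i x + e i x')
    (he1 : ∀ η : ℝ, 0 < η → Tendsto (fun i => P i {p | η < e i p.1}) l (𝓝 0))
    (he2 : ∀ η : ℝ, 0 < η → Tendsto (fun i => P i {p | η < e i p.2}) l (𝓝 0))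
    (hε : Tendsto ε l (𝓝 0)) (hfin : ∀ i, ∫⁻ p, edist p.1 p.2 ^ 2 ∂(P i) ≠ ⊤)
    (hopt : ∀ i, ∀ q ∈ couplings ((P i).map Prod.fst) ((P i).map Prod.snd),
      ∫⁻ p, edist p.1 p.2 ^ 2 ∂(P i) ≤ ∫⁻ p, edist p.1 p.2 ^ 2 ∂q + ε i)
    (hlim : WeakLimit l (fun i p => (T i p.1, T i p.2)) P π)
    (hq : q ∈ couplings (π.map Prod.fst) (π.map Prod.snd)) (o : Y) {R η κ : ℝ} (hR : 0 < R)
    (hη : 0 < η) (hκ : 0 < κ) :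
    ∫⁻ p, ENNReal.ofReal (truncCost o R η p) ∂π
      ≤ ∫⁻ p, ENNReal.ofReal ((dist p.1 p.2 + 10 * η) ^ 2) ∂q
        + ENNReal.ofReal (4 * R + 2 * η) ^ 2
          * (ENNReal.ofReal (2 * κ) + 2 * ∫⁻ p, ENNReal.ofReal (1 - pairCutoff o R p) ∂π) := by
  have : Nonempty Y := ⟨o⟩
  set α := π.map Prod.fst with hα
  set γ := π.map Prod.snd with hγ
  have : IsProbabilityMeasure α := Measure.isProbabilityMeasure_map measurable_fst.aemeasurable
  have : IsProbabilityMeasure γ := Measure.isProbabilityMeasure_map measurable_snd.aemeasurable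
  have : IsProbabilityMeasure q := isProbabilityMeasure_of_mem_couplings hq
  obtain ⟨N, z, φ, hφ, hφ0, hφ1, hφz, hφρ⟩ := exists_bumps (α + γ) hη hκ
  have hφm : ∀ k, Measurable (φ k) := fun k => (hφ k).measurable
  have hφle : ∀ k y, φ k y ≤ 1 := fun k y =>
    (Finset.single_le_sum (f := fun k => φ k y) (fun j _ => hφ0 j y) (Finset.mem_univ k)).trans
      (hφ1 y)
  have hφb : ∀ k y, |φ k y| ≤ 1 := fun k y => by rw [abs_of_nonneg (hφ0 k y)]; exact hφle k y
  set a : Fin N → ℝ := fun k => ∫ p, φ k p.1 ∂π with ha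
  set g : Fin N → ℝ := fun k => ∫ p, φ k p.2 ∂π with hg
  have haq : ∀ k, a k = ∫ p, φ k p.1 ∂q := fun k => by
    rw [← integral_map (φ := Prod.fst) measurable_fst.aemeasurable (hφm k).aestronglyMeasurable,
      hq.1, integral_map measurable_fst.aemeasurable (hφm k).aestronglyMeasurable]
  have hgq : ∀ k, g k = ∫ p, φ k p.2 ∂q := fun k => by
    rw [← integral_map (φ := Prod.snd) measurable_snd.aemeasurable (hφm k).aestronglyMeasurable,
      hq.2, integral_map measurable_snd.aemeasurable (hφm k).aestronglyMeasurable]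
  have ha0 : ∀ k, 0 ≤ a k := fun k => integral_nonneg fun p => hφ0 k _
  have hg0 : ∀ k, 0 ≤ g k := fun k => integral_nonneg fun p => hφ0 k _
  set Q : Fin N → Fin N → ℝ := fun j k => ∫ p, φ j p.1 * φ k p.2 ∂q with hQ
  have hQ0 : ∀ j k, 0 ≤ Q j k := fun j k => integral_nonneg fun p => mul_nonneg (hφ0 _ _) (hφ0 _ _)
  have hiQ : ∀ j k, Integrable (fun p : Y × Y => φ j p.1 * φ k p.2) q := fun j k =>
    integrable_of_bounded (C := 1) (by have := hφm j; have := hφm k; fun_prop) fun p => by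
      rw [abs_mul]; exact mul_le_one₀ (hφb _ _) (abs_nonneg _) (hφb _ _)
  have hi1 : ∀ k, Integrable (fun p : Y × Y => φ k p.1) q := fun k =>
    integrable_of_bounded (C := 1) (by have := hφm k; fun_prop) fun p => hφb _ _
  have hi2 : ∀ k, Integrable (fun p : Y × Y => φ k p.2) q := fun k =>
    integrable_of_bounded (C := 1) (by have := hφm k; fun_prop) fun p => hφb _ _
  have hQrow : ∀ j, ∑ k, Q j k ≤ a j := fun j => by
    rw [haq, ← integral_finsetSum _ fun k _ => hiQ j k]
    refine integral_mono (integrable_finsetSum _ fun k _ => hiQ j k) (hi1 j) fun p => ?_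
    simp only [← Finset.mul_sum]
    exact mul_le_of_le_one_right (hφ0 _ _) (hφ1 _)
  have hQcol : ∀ k, ∑ j, Q j k ≤ g k := fun k => by
    rw [hgq, ← integral_finsetSum _ fun j _ => hiQ j k]
    refine integral_mono (integrable_finsetSum _ fun j _ => hiQ j k) (hi2 k) fun p => ?_
    simp only [← Finset.sum_mul]
    exact mul_le_of_le_one_left (hφ0 _ _) (hφ1 _)
  have hQa : ∀ j k, a j = 0 → Q j k = 0 := fun j k h0 =>
    le_antisymm ((Finset.single_le_sum (f := fun k => Q j k) (fun i _ => hQ0 j i)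
      (Finset.mem_univ k)).trans ((hQrow j).trans h0.le)) (hQ0 j k)
  have hQg : ∀ j k, g k = 0 → Q j k = 0 := fun j k h0 =>
    le_antisymm ((Finset.single_le_sum (f := fun j => Q j k) (fun i _ => hQ0 i k)
      (Finset.mem_univ j)).trans ((hQcol k).trans h0.le)) (hQ0 j k)
  -- Division by zero does no harm: by `hQa` and `hQg` a vanishing weight forces `Q j k = 0`.
  set c : Fin N → Fin N → ℝ := fun j k => Q j k / (a j * g k) with hc
  have hc0 : ∀ j k, 0 ≤ c j k := fun j k => div_nonneg (hQ0 j k) (mul_nonneg (ha0 j) (hg0 k))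
  have hcag : ∀ j k, c j k * (a j * g k) = Q j k := fun j k => by
    by_cases h1 : a j = 0
    · simp [h1, hQa j k h1]
    by_cases h2 : g k = 0
    · simp [h2, hQg j k h2]
    rw [hc]; field_simp
  have hrow : ∀ j, ∑ k, c j k * g k ≤ 1 := fun j => by
    by_cases h1 : a j = 0
    · simp [hc, h1]
    · have h2 : a j * ∑ k, c j k * g k ≤ a j * 1 := by
        rw [Finset.mul_sum, mul_one]
        refine le_trans (le_of_eq (Finset.sum_congr rfl fun k _ => ?_)) (hQrow j)
        rw [← hcag j k]; ring
      exact le_of_mul_le_mul_left h2 ((ha0 j).lt_of_ne' h1)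
  have hcol : ∀ k, ∑ j, c j k * a j ≤ 1 := fun k => by
    by_cases h1 : g k = 0
    · simp [hc, h1]
    · have h2 : g k * ∑ j, c j k * a j ≤ g k * 1 := by
        rw [Finset.mul_sum, mul_one]
        refine le_trans (le_of_eq (Finset.sum_congr rfl fun j _ => ?_)) (hQcol k)
        rw [← hcag j k]; ring
      exact le_of_mul_le_mul_left h2 ((hg0 k).lt_of_ne' h1)
  -- The discretisation loses only pairs with a coordinate in `V`, where the bumps do not sum to
  -- `1`. Their mass is at most `α V + γ V ≤ κ`, which is why the bumps were chosen for `α + γ`.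
  have hQsum : 1 - κ ≤ ∑ j, ∑ k, Q j k := by
    set V : Set Y := {y | ∑ k, φ k y < 1} with hV
    have hVm : MeasurableSet V :=
      measurableSet_lt (Finset.measurable_fun_sum _ fun k _ => hφm k) measurable_const
    have h1 : ∑ j, ∑ k, Q j k = ∫ p, (∑ j, φ j p.1) * (∑ k, φ k p.2) ∂q := by
      simp only [Finset.sum_mul_sum]
      rw [integral_finsetSum _ fun j _ => integrable_finsetSum _ fun k _ => hiQ j k]
      exact Finset.sum_congr rfl fun j _ => (integral_finsetSum _ fun k _ => hiQ j k).symm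
    have hI0 : Integrable ((Prod.fst ⁻¹' V).indicator fun _ => (1 : ℝ)) q :=
      (integrable_const _).indicator (measurable_fst hVm)
    have hI1 : Integrable (fun p => 1 - (Prod.fst ⁻¹' V).indicator (fun _ => (1 : ℝ)) p) q :=
      (integrable_const _).sub hI0
    have hI2 : Integrable ((Prod.snd ⁻¹' V).indicator fun _ => (1 : ℝ)) q :=
      (integrable_const _).indicator (measurable_snd hVm)
    have h2 : ∫ p, (1 - (Prod.fst ⁻¹' V).indicator (fun _ => (1 : ℝ)) p
        - (Prod.snd ⁻¹' V).indicator (fun _ => (1 : ℝ)) p) ∂q ≤ ∑ j, ∑ k, Q j k := by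
      rw [h1]
      refine integral_mono (hI1.sub hI2) ?_ ?_
      · simp only [Finset.sum_mul_sum]
        exact integrable_finsetSum _ fun j _ => integrable_finsetSum _ fun k _ => hiQ j k
      · intro p
        have n1 : 0 ≤ ∑ j, φ j p.1 := Finset.sum_nonneg fun j _ => hφ0 _ _
        have n2 : 0 ≤ ∑ j, φ j p.2 := Finset.sum_nonneg fun j _ => hφ0 _ _
        have hnn := mul_nonneg n1 n2
        by_cases hp1 : p.1 ∈ V
        · have hp2 : 0 ≤ (Prod.snd ⁻¹' V).indicator (fun _ => (1 : ℝ)) p :=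
            Set.indicator_nonneg (fun _ _ => zero_le_one) _
          have hp1' : (Prod.fst ⁻¹' V).indicator (fun _ => (1 : ℝ)) p = 1 :=
            Set.indicator_of_mem (by exact hp1) _
          simp only [hp1']
          linarith
        · have hp1' : (Prod.fst ⁻¹' V).indicator (fun _ => (1 : ℝ)) p = 0 :=
            Set.indicator_of_notMem (by exact hp1) _
          by_cases hp2 : p.2 ∈ V
          · have hp2' : (Prod.snd ⁻¹' V).indicator (fun _ => (1 : ℝ)) p = 1 :=
              Set.indicator_of_mem (by exact hp2) _
            simp only [hp1', hp2']
            linarith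
          · have hp2' : (Prod.snd ⁻¹' V).indicator (fun _ => (1 : ℝ)) p = 0 :=
              Set.indicator_of_notMem (by exact hp2) _
            simp only [hp1', hp2']
            have e1 : 1 ≤ ∑ j, φ j p.1 := not_lt.1 hp1
            have e2 : 1 ≤ ∑ j, φ j p.2 := not_lt.1 hp2
            nlinarith
    rw [integral_sub hI1 hI2, integral_sub (integrable_const _) hI0,
      integral_indicator_const _ (measurable_fst hVm),
      integral_indicator_const _ (measurable_snd hVm)] at h2
    have e1 : q.real (Prod.fst ⁻¹' V) = α.real V := by
      rw [← hq.1, map_measureReal_apply measurable_fst hVm]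
    have e2 : q.real (Prod.snd ⁻¹' V) = γ.real V := by
      rw [← hq.2, map_measureReal_apply measurable_snd hVm]
    rw [measureReal_add_apply] at hφρ
    simp only [integral_const, probReal_univ, smul_eq_mul, mul_one, e1, e2] at h2
    linarith
  -- passage to the limit
  have hat : ∀ k, Tendsto (fun i => ∫ p, φ k (T i p.1) ∂P i) l (𝓝 (a k)) := fun k =>
    hlim.tendsto_integral (f := fun p => φ k p.1) ((hφ k).comp continuous_fst) fun p => hφb k _
  have hgt : ∀ k, Tendsto (fun i => ∫ p, φ k (T i p.2) ∂P i) l (𝓝 (g k)) := fun k =>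
    hlim.tendsto_integral (f := fun p => φ k p.2) ((hφ k).comp continuous_snd) fun p => hφb k _
  have hrow' : ∀ᶠ i in l, ∀ j, ∑ k, c j k * ∫ p, φ k (T i p.2) ∂P i ≤ 1 + κ := by
    refine eventually_all.2 fun j => ?_
    have := tendsto_finsetSum Finset.univ fun k _ => (hgt k).const_mul (c j k)
    exact (this.eventually_lt_const (u := 1 + κ) (by linarith [hrow j])).mono fun i hi => hi.le
  have hcol' : ∀ᶠ i in l, ∀ k, ∑ j, c j k * ∫ p, φ j (T i p.1) ∂P i ≤ 1 + κ := by
    refine eventually_all.2 fun k => ?_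
    have := tendsto_finsetSum Finset.univ fun j _ => (hat j).const_mul (c j k)
    exact (this.eventually_lt_const (u := 1 + κ) (by linarith [hcol k])).mono fun i hi => hi.le
  set b : ι → ℝ≥0∞ := fun i => P i {p | η < e i p.1} + P i {p | η < e i p.2} with hb
  have hbt : Tendsto b l (𝓝 0) := by simpa using (he1 η hη).add (he2 η hη)
  have hbi : ∀ i, P i {p | e i p.1 ≤ η ∧ e i p.2 ≤ η}ᶜ ≤ b i := fun i => by
    refine (measure_mono fun p hp => ?_).trans (measure_union_le _ _)
    simp only [Set.mem_compl_iff, Set.mem_ofPred_eq, not_and_or, not_le] at hp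
    exact hp
  have hineq : ∀ᶠ i in l, ∫⁻ p, ENNReal.ofReal (truncCost o R η (T i p.1, T i p.2)) ∂(P i)
      ≤ ENNReal.ofReal (∑ j, ∑ k, c j k * (dist (z j) (z k) + 6 * η) ^ 2
            * (∫ p, φ j (T i p.1) ∂P i) * ∫ p, φ k (T i p.2) ∂P i)
        + ENNReal.ofReal (4 * R + 2 * η) ^ 2
          * (ENNReal.ofReal (1 - ∑ j, ∑ k, c j k / (1 + κ)
              * (∫ p, φ j (T i p.1) ∂P i) * ∫ p, φ k (T i p.2) ∂P i)
            + 2 * (∫⁻ p, ENNReal.ofReal (1 - pairCutoff o R (T i p.1, T i p.2)) ∂(P i) + b i))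
        + ε i + ENNReal.ofReal ((4 * R) ^ 2) * b i := by
    filter_upwards [hrow', hcol'] with i h1 h2
    exact lintegral_truncCost_le (hT i) (he i) (hTe i) (hfin i) (hopt i) hη hκ hR hφ hφ0 hφ1 hφz
      hc0 (fun _ => rfl) (fun _ => rfl) h1 h2 o (hbi i)
  have hofReal : ∀ F : Y × Y → ℝ, Continuous F → (∀ p, 0 ≤ F p) → ∀ C : ℝ, (∀ p, F p ≤ C) →
      Tendsto (fun i => ∫⁻ p, ENNReal.ofReal (F (T i p.1, T i p.2)) ∂(P i)) l
        (𝓝 (∫⁻ p, ENNReal.ofReal (F p) ∂π)) := by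
    intro F hF hF0 C hFC
    have hFb : ∀ p, |F p| ≤ C := fun p => by rw [abs_of_nonneg (hF0 p)]; exact hFC p
    rw [← ofReal_integral_eq_lintegral_ofReal (integrable_of_bounded hF.measurable hFb)
      (ae_of_all _ hF0)]
    have h1 := ENNReal.tendsto_ofReal (hlim.tendsto_integral hF hFb)
    refine h1.congr fun i => ?_
    have hTT : Measurable fun p : X i × X i => (T i p.1, T i p.2) :=
      ((hT i).comp measurable_fst).prodMk ((hT i).comp measurable_snd)
    exact ofReal_integral_eq_lintegral_ofReal (integrable_of_bounded (hF.measurable.comp hTT)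
      fun p => hFb _) (ae_of_all _ fun p => hF0 _)
  have hL := hofReal (truncCost o R η) (continuous_truncCost o R η) (truncCost_nonneg o R η) _
    (truncCost_le o hR hη)
  have hC1 := hofReal (fun p => 1 - pairCutoff o R p) (continuous_const.sub
    (continuous_pairCutoff o R)) (fun p => sub_nonneg.2 (pairCutoff_le_one o R p)) 1
    (fun p => by linarith [pairCutoff_nonneg o R p])
  have hsum : ∀ d : Fin N → Fin N → ℝ, Tendsto (fun i => ∑ j, ∑ k, d j k
      * (∫ p, φ j (T i p.1) ∂P i) * ∫ p, φ k (T i p.2) ∂P i) l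
      (𝓝 (∑ j, ∑ k, d j k * a j * g k)) := fun d =>
    tendsto_finsetSum _ fun j _ => tendsto_finsetSum _ fun k _ =>
      ((hat j).const_mul _).mul (hgt k)
  have hR' := (((ENNReal.tendsto_ofReal
    (hsum fun j k => c j k * (dist (z j) (z k) + 6 * η) ^ 2)).add
    (ENNReal.Tendsto.const_mul (a := ENNReal.ofReal (4 * R + 2 * η) ^ 2)
      ((ENNReal.tendsto_ofReal ((hsum fun j k => c j k / (1 + κ)).const_sub 1)).add
        (ENNReal.Tendsto.const_mul (a := 2) (hC1.add hbt) (Or.inr (by simp))))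
      (Or.inr (by finiteness)))).add hε).add
    (ENNReal.Tendsto.const_mul (a := ENNReal.ofReal ((4 * R) ^ 2)) hbt (Or.inr (by finiteness)))
  refine (le_of_tendsto_of_tendsto hL hR' hineq).trans ?_
  simp only [add_zero, mul_zero]
  refine add_le_add ?_ ?_
  -- Returning from the centres of the bumps to the points of the support costs another `4 * η`,
  -- hence `10 * η`.
  · have hdom : ∀ p : Y × Y, ∑ j, ∑ k, (dist (z j) (z k) + 6 * η) ^ 2 * (φ j p.1 * φ k p.2)
        ≤ (dist p.1 p.2 + 10 * η) ^ 2 := by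
      intro p
      calc ∑ j, ∑ k, (dist (z j) (z k) + 6 * η) ^ 2 * (φ j p.1 * φ k p.2)
          ≤ ∑ j, ∑ k, (dist p.1 p.2 + 10 * η) ^ 2 * (φ j p.1 * φ k p.2) := by
            refine Finset.sum_le_sum fun j _ => Finset.sum_le_sum fun k _ => ?_
            by_cases hj : φ j p.1 = 0
            · simp [hj]
            by_cases hk : φ k p.2 = 0
            · simp [hk]
            refine mul_le_mul_of_nonneg_right ?_ (mul_nonneg (hφ0 _ _) (hφ0 _ _))
            have h1 := hφz j _ hj
            have h2 := hφz k _ hk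
            have h3 := dist_triangle4 (z j) p.1 p.2 (z k)
            rw [dist_comm (z j) p.1] at h3
            exact pow_le_pow_left₀ (by positivity) (by linarith) 2
        _ = (dist p.1 p.2 + 10 * η) ^ 2 * ((∑ j, φ j p.1) * ∑ k, φ k p.2) := by
            rw [Finset.sum_mul_sum]
            simp only [Finset.mul_sum]
        _ ≤ (dist p.1 p.2 + 10 * η) ^ 2 * 1 := by
            refine mul_le_mul_of_nonneg_left ?_ (by positivity)
            exact mul_le_one₀ (hφ1 _) (Finset.sum_nonneg fun j _ => hφ0 _ _) (hφ1 _)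
        _ = _ := mul_one _
    have h_int : ∀ j k, Integrable (fun p : Y × Y =>
        (dist (z j) (z k) + 6 * η) ^ 2 * (φ j p.1 * φ k p.2)) q := fun j k => (hiQ j k).const_mul _
    have e1 : ∑ j, ∑ k, c j k * (dist (z j) (z k) + 6 * η) ^ 2 * a j * g k
        = ∫ p, ∑ j, ∑ k, (dist (z j) (z k) + 6 * η) ^ 2 * (φ j p.1 * φ k p.2) ∂q := by
      rw [integral_finsetSum _ fun j _ => integrable_finsetSum _ fun k _ => h_int j k]
      refine Finset.sum_congr rfl fun j _ => ?_
      rw [integral_finsetSum _ fun k _ => h_int j k]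
      refine Finset.sum_congr rfl fun k _ => ?_
      rw [integral_const_mul]
      change _ = _ * Q j k
      rw [← hcag j k]; ring
    rw [e1, ofReal_integral_eq_lintegral_ofReal (integrable_finsetSum _ fun j _ =>
      integrable_finsetSum _ fun k _ => h_int j k)
      (ae_of_all _ fun p => Finset.sum_nonneg fun j _ =>
        Finset.sum_nonneg fun k _ => mul_nonneg (by positivity) (mul_nonneg (hφ0 _ _) (hφ0 _ _)))]
    exact lintegral_mono fun p => ENNReal.ofReal_le_ofReal (hdom p)
  · gcongr
    -- The untransported mass is at most `1 - (1 - κ) / (1 + κ)`, which is at most `2 * κ`.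
    have e2 : ∑ j, ∑ k, c j k / (1 + κ) * a j * g k = (∑ j, ∑ k, Q j k) / (1 + κ) := by
      simp only [Finset.sum_div]
      refine Finset.sum_congr rfl fun j _ => Finset.sum_congr rfl fun k _ => ?_
      rw [← hcag j k]; ring
    rw [e2, sub_le_iff_le_add, ← sub_le_iff_le_add', le_div_iff₀ (by linarith)]
    nlinarith

/-- Weak limits of near-optimal couplings are optimal. -/
theorem lintegral_le_of_weakLimit_nearOptimal (hT : ∀ i, Measurable (T i))
    (he : ∀ i, Measurable (e i))
    (hTe : ∀ i x x', |dist x x' - dist (T i x) (T i x')| ≤ e i x + e i x')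
    (he1 : ∀ η : ℝ, 0 < η → Tendsto (fun i => P i {p | η < e i p.1}) l (𝓝 0))
    (he2 : ∀ η : ℝ, 0 < η → Tendsto (fun i => P i {p | η < e i p.2}) l (𝓝 0))
    (hε : Tendsto ε l (𝓝 0)) (hfin : ∀ i, ∫⁻ p, edist p.1 p.2 ^ 2 ∂(P i) ≠ ⊤)
    (hopt : ∀ i, ∀ q ∈ couplings ((P i).map Prod.fst) ((P i).map Prod.snd),
      ∫⁻ p, edist p.1 p.2 ^ 2 ∂(P i) ≤ ∫⁻ p, edist p.1 p.2 ^ 2 ∂q + ε i)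
    (hlim : WeakLimit l (fun i p => (T i p.1, T i p.2)) P π)
    (hq : q ∈ couplings (π.map Prod.fst) (π.map Prod.snd)) (o : Y)
    (hm1 : ∫⁻ p, edist p.1 o ^ 2 ∂π ≠ ⊤) (hm2 : ∫⁻ p, edist p.2 o ^ 2 ∂π ≠ ⊤) :
    ∫⁻ p, edist p.1 p.2 ^ 2 ∂π ≤ ∫⁻ p, edist p.1 p.2 ^ 2 ∂q := by
  by_cases hqt : ∫⁻ p, edist p.1 p.2 ^ 2 ∂q = ⊤
  · rw [hqt]; exact le_top
  have : IsProbabilityMeasure (π.map Prod.fst) :=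
    Measure.isProbabilityMeasure_map measurable_fst.aemeasurable
  have : IsProbabilityMeasure q := isProbabilityMeasure_of_mem_couplings hq
  have hed : ∀ a b : Y, edist a b ^ 2 = ENNReal.ofReal (dist a b ^ 2) := fun a b => by
    rw [edist_dist, ENNReal.ofReal_pow dist_nonneg]
  have hn0 : ∀ n : ℕ, (0 : ℝ) < (n : ℝ) + 1 := fun n => by positivity
  have hev : ∀ r : ℝ, ∀ᶠ n : ℕ in atTop, r ≤ (n : ℝ) + 1 := fun r => by
    obtain ⟨N, hN⟩ := exists_nat_ge r
    filter_upwards [eventually_ge_atTop N] with n hn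
    have : (N : ℝ) ≤ n := by exact_mod_cast hn
    linarith
  have hcut1 : ∀ p : Y × Y, ∀ᶠ n : ℕ in atTop, pairCutoff o ((n : ℝ) + 1) p = 1 := fun p => by
    filter_upwards [hev (dist p.1 o), hev (dist p.2 o)] with n h1 h2
    rw [pairCutoff, cutoff_eq_one o (hn0 n) h1, cutoff_eq_one o (hn0 n) h2, one_mul]
  have hηt := tendsto_one_div_add_atTop_nhds_zero_nat (𝕜 := ℝ)
  -- left-hand side
  have hleft : ∫⁻ p, edist p.1 p.2 ^ 2 ∂π ≤ liminf (fun n : ℕ =>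
      ∫⁻ p, ENNReal.ofReal (truncCost o ((n : ℝ) + 1) (1 / ((n : ℝ) + 1)) p) ∂π) atTop := by
    have hpt : ∀ p : Y × Y, Tendsto (fun n : ℕ =>
        ENNReal.ofReal (truncCost o ((n : ℝ) + 1) (1 / ((n : ℝ) + 1)) p)) atTop
        (𝓝 (edist p.1 p.2 ^ 2)) := fun p => by
      rw [hed]
      refine ENNReal.tendsto_ofReal ?_
      have h1 : Tendsto (fun n : ℕ => max 0 (dist p.1 p.2 - 2 * (1 / ((n : ℝ) + 1))) ^ 2) atTop
          (𝓝 (max 0 (dist p.1 p.2 - 2 * 0) ^ 2)) :=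
        ((tendsto_const_nhds.max ((hηt.const_mul 2).const_sub _)).pow 2)
      rw [mul_zero, sub_zero, max_eq_right dist_nonneg] at h1
      refine h1.congr' ?_
      filter_upwards [hcut1 p] with n hn
      rw [truncCost, hn, one_mul]
    calc ∫⁻ p, edist p.1 p.2 ^ 2 ∂π
        = ∫⁻ p, liminf (fun n : ℕ =>
          ENNReal.ofReal (truncCost o ((n : ℝ) + 1) (1 / ((n : ℝ) + 1)) p)) atTop ∂π :=
          lintegral_congr fun p => (hpt p).liminf_eq.symm
      _ ≤ _ := lintegral_liminf_le fun n => (continuous_truncCost o _ _).measurable.ennreal_ofReal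
  -- right-hand side
  have hI : Tendsto (fun n : ℕ =>
      ∫⁻ p, ENNReal.ofReal ((dist p.1 p.2 + 10 * (1 / ((n : ℝ) + 1))) ^ 2) ∂q) atTop
      (𝓝 (∫⁻ p, edist p.1 p.2 ^ 2 ∂q)) := by
    refine tendsto_lintegral_of_dominated_convergence
      (fun p => 2 * edist p.1 p.2 ^ 2 + ENNReal.ofReal 200) (fun n => by fun_prop)
      (fun n => ae_of_all _ fun p => ?_) ?_ (ae_of_all _ fun p => ?_)
    · simp only
      rw [hed, ← ENNReal.ofReal_ofNat 2, ← ENNReal.ofReal_mul (by norm_num),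
        ← ENNReal.ofReal_add (by positivity) (by norm_num)]
      refine ENNReal.ofReal_le_ofReal ?_
      have h1 : 1 / ((n : ℝ) + 1) ≤ 1 := by
        rw [div_le_one (hn0 n)]; linarith [(Nat.cast_nonneg n : (0 : ℝ) ≤ n)]
      have h2 : 0 < 1 / ((n : ℝ) + 1) := by positivity
      nlinarith [sq_nonneg (dist p.1 p.2 - 10 * (1 / ((n : ℝ) + 1)))]
    · rw [lintegral_add_right _ measurable_const, lintegral_const_mul _ measurable_edist_sq]
      simp only [lintegral_const, measure_univ, mul_one]
      exact ENNReal.add_ne_top.2 ⟨ENNReal.mul_ne_top (by simp) hqt, by simp⟩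
    · rw [hed]
      refine ENNReal.tendsto_ofReal ?_
      have := ((hηt.const_mul 10).const_add (dist p.1 p.2)).pow 2
      simpa using this
  -- Outside the cutoff the squared radius is at most the squared distance to `o` of one of the two
  -- points, so the finite second moments of `π` dominate the integrand.
  have hK : Tendsto (fun n : ℕ =>
      ∫⁻ p, ENNReal.ofReal (((n : ℝ) + 1) ^ 2 * (1 - pairCutoff o ((n : ℝ) + 1) p)) ∂π) atTop
      (𝓝 0) := by
    have h0 : (0 : ℝ≥0∞) = ∫⁻ _ : Y × Y, 0 ∂π := by simp
    rw [h0]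
    refine tendsto_lintegral_of_dominated_convergence
      (fun p => edist p.1 o ^ 2 + edist p.2 o ^ 2) (fun n => ?_)
      (fun n => ae_of_all _ fun p => ?_) ?_ (ae_of_all _ fun p => ?_)
    · exact ((continuous_const.sub
        (continuous_pairCutoff o _)).const_mul _).measurable.ennreal_ofReal
    · simp only
      rw [hed, hed, ← ENNReal.ofReal_add (by positivity) (by positivity)]
      refine ENNReal.ofReal_le_ofReal ?_
      have hc0 := pairCutoff_nonneg o ((n : ℝ) + 1) p
      have hle : ((n : ℝ) + 1) ^ 2 * (1 - pairCutoff o ((n : ℝ) + 1) p) ≤ ((n : ℝ) + 1) ^ 2 :=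
        mul_le_of_le_one_right (by positivity) (by linarith)
      by_cases h1 : dist p.1 o ≤ (n : ℝ) + 1
      · by_cases h2 : dist p.2 o ≤ (n : ℝ) + 1
        · rw [pairCutoff, cutoff_eq_one o (hn0 n) h1, cutoff_eq_one o (hn0 n) h2]
          simp only [mul_one, sub_self, mul_zero]
          positivity
        · have : ((n : ℝ) + 1) ^ 2 ≤ dist p.2 o ^ 2 := by gcongr; exact (not_le.1 h2).le
          nlinarith [sq_nonneg (dist p.1 o)]
      · have : ((n : ℝ) + 1) ^ 2 ≤ dist p.1 o ^ 2 := by gcongr; exact (not_le.1 h1).le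
        nlinarith [sq_nonneg (dist p.2 o)]
    · rw [lintegral_add_left (by fun_prop)]
      exact ENNReal.add_ne_top.2 ⟨hm1, hm2⟩
    · refine tendsto_const_nhds.congr' ?_
      filter_upwards [hcut1 p] with n hn
      simp [hn]
  have hJ : Tendsto (fun n : ℕ => ENNReal.ofReal (72 * (1 / ((n : ℝ) + 1)))) atTop (𝓝 0) := by
    have := ENNReal.tendsto_ofReal (hηt.const_mul 72)
    simpa using this
  have hall := (hI.add (hJ.add (ENNReal.Tendsto.const_mul (a := ENNReal.ofReal 72) hK
    (Or.inr (by finiteness)))))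
  rw [mul_zero, add_zero, add_zero] at hall
  rw [← hall.liminf_eq]
  refine hleft.trans (liminf_le_liminf (Eventually.of_forall fun n => ?_))
  have hs := hn0 n
  have hs1 : (1 : ℝ) ≤ (n : ℝ) + 1 := by linarith [(Nat.cast_nonneg n : (0 : ℝ) ≤ n)]
  set s : ℝ := (n : ℝ) + 1
  -- With `R = s` the squared diameter is at most `36 * s ^ 2`; `κ = 1 / s ^ 3` then makes the
  -- discretisation error `72 / s`.
  refine (lintegral_truncCost_limit_le hT he hTe he1 he2 hε hfin hopt hlim hq o hs
    (η := 1 / s) (κ := 1 / s ^ 3) (by positivity) (by positivity)).trans ?_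
  refine add_le_add le_rfl ?_
  have h6 : ENNReal.ofReal (4 * s + 2 * (1 / s)) ^ 2 ≤ ENNReal.ofReal (36 * s ^ 2) := by
    rw [← ENNReal.ofReal_pow (by positivity)]
    refine ENNReal.ofReal_le_ofReal ?_
    have h1 : 1 / s ≤ 1 := by rw [div_le_one hs]; exact hs1
    have h2 : 0 < 1 / s := by positivity
    have : 4 * s + 2 * (1 / s) ≤ 6 * s := by linarith
    calc (4 * s + 2 * (1 / s)) ^ 2 ≤ (6 * s) ^ 2 := by gcongr
      _ = _ := by ring
  refine (mul_le_mul_left h6 _).trans ?_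
  rw [mul_add]
  refine add_le_add (le_of_eq ?_) (le_of_eq ?_)
  · rw [← ENNReal.ofReal_mul (by positivity)]
    congr 1
    field_simp
    ring
  · simp only [ENNReal.ofReal_mul (sq_nonneg s)]
    rw [lintegral_const_mul' _ _ (by finiteness), ENNReal.ofReal_mul (by norm_num),
      show (72 : ℝ) = 36 * 2 by norm_num, ENNReal.ofReal_mul (by norm_num), ENNReal.ofReal_ofNat 2]
    ring

end

/-! ### Limits of Wasserstein geodesics -/

/-- The defect of `y` from being the point between `x` and `z` at parameter `θ`. -/
def betweenDefect {X : Type*} [MetricSpace X] (θ : ℝ) (ω : (X × X) × X) : ℝ :=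
  min 1 (|(1 - θ) * dist ω.1.1 ω.1.2 - θ * dist ω.1.2 ω.2|
    + |dist ω.1.1 ω.1.2 + dist ω.1.2 ω.2 - dist ω.1.1 ω.2|)

theorem continuous_betweenDefect {X : Type*} [MetricSpace X] (θ : ℝ) :
    Continuous (betweenDefect (X := X) θ) := by
  unfold betweenDefect
  fun_prop

theorem betweenDefect_nonneg {X : Type*} [MetricSpace X] (θ : ℝ) (ω : (X × X) × X) :
    0 ≤ betweenDefect θ ω := le_min zero_le_one (by positivity)

theorem abs_betweenDefect_le {X : Type*} [MetricSpace X] (θ : ℝ) (ω : (X × X) × X) :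
    |betweenDefect θ ω| ≤ 1 := by
  rw [abs_of_nonneg (betweenDefect_nonneg θ ω)]
  exact min_le_left _ _

theorem integrable_dist_sq {Ω X : Type*} [MeasurableSpace Ω] [MetricSpace X] {P : Measure Ω}
    {f g : Ω → X} (hm : Measurable fun ω => dist (f ω) (g ω))
    (h : ∫⁻ ω, edist (f ω) (g ω) ^ 2 ∂P ≠ ⊤) : Integrable (fun ω => dist (f ω) (g ω) ^ 2) P := by
  refine ⟨(hm.pow_const 2).aestronglyMeasurable, ?_⟩
  rw [hasFiniteIntegral_iff_ofReal (ae_of_all _ fun ω => sq_nonneg _)]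
  simp only [ENNReal.ofReal_pow dist_nonneg, ← edist_dist]
  exact h.lt_top

theorem ofReal_integral_dist_sq {Ω X : Type*} [MeasurableSpace Ω] [MetricSpace X] {P : Measure Ω}
    {f g : Ω → X} (hm : Measurable fun ω => dist (f ω) (g ω))
    (h : ∫⁻ ω, edist (f ω) (g ω) ^ 2 ∂P ≠ ⊤) :
    ENNReal.ofReal (∫ ω, dist (f ω) (g ω) ^ 2 ∂P) = ∫⁻ ω, edist (f ω) (g ω) ^ 2 ∂P := by
  rw [ofReal_integral_eq_lintegral_ofReal (integrable_dist_sq hm h)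
    (ae_of_all _ fun ω => sq_nonneg _)]
  simp only [ENNReal.ofReal_pow dist_nonneg, ← edist_dist]

/-! ### Gluing near-optimal couplings along a geodesic -/

section Glued

variable {X : Type*} [MetricSpace X] [CompleteSpace X] [SecondCountableTopology X]
  [MeasurableSpace X] [BorelSpace X]

/-- Two couplings with cost within `s ^ 2` of the infimum are glued. With `x`, `y` the distances to
the middle point and `z` the outer distance, `(1-θ)x² + θy² - θ(1-θ)z² = ((1-θ)x - θy)² +
θ(1-θ)((x+y)² - z²)`. The mean of the left side is at most `s²`, because the outer cost cannot fall
below `W₂ α γ ^ 2`; both squares on the right, hence the betweenness defect, are then small in mean.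
Dropping the second-order terms gives near-optimality of the outer coupling. -/
theorem exists_glued_near_geodesic {α β γ : Measure X} [IsProbabilityMeasure α]
    [IsProbabilityMeasure β] {L : ℝ≥0∞} (hL : L ≠ ⊤) {θ : ℝ} (hθ0 : 0 < θ) (hθ1 : θ < 1)
    (h1 : W₂ α β = ENNReal.ofReal θ * L) (h2 : W₂ β γ = ENNReal.ofReal (1 - θ) * L)
    (h3 : W₂ α γ = L) {s : ℝ} (hs : 0 < s) :
    ∃ P : Measure ((X × X) × X), IsProbabilityMeasure P ∧ P.map (fun ω => ω.1.1) = α ∧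
      P.map (fun ω => ω.1.2) = β ∧ P.map (fun ω => ω.2) = γ ∧
      ∫⁻ ω, edist ω.1.1 ω.2 ^ 2 ∂P ≤ L ^ 2 + ENNReal.ofReal (s ^ 2 / (θ * (1 - θ))) ∧
      ∫ ω, betweenDefect θ ω ∂P ≤ s * (3 + 1 / (θ * (1 - θ))) := by
  have : Nonempty X := nonempty_of_isProbabilityMeasure α
  have hθ' : 0 < 1 - θ := by linarith
  set r := L.toReal with hr
  have hr0 : 0 ≤ r := ENNReal.toReal_nonneg
  have hLr : L = ENNReal.ofReal r := (ENNReal.ofReal_toReal hL).symm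
  have hs2 : 0 < ENNReal.ofReal (s ^ 2) := ENNReal.ofReal_pos.2 (by positivity)
  have hlt : ∀ {μ ν : Measure X} {t : ℝ}, 0 ≤ t → W₂ μ ν = ENNReal.ofReal t * L →
      W₂ μ ν ^ 2 < ENNReal.ofReal (t ^ 2 * r ^ 2 + s ^ 2) := by
    intro μ ν t ht h
    rw [h, hLr, ← ENNReal.ofReal_mul ht, ← ENNReal.ofReal_pow (by positivity)]
    refine (ENNReal.ofReal_lt_ofReal_iff (by positivity)).2 ?_
    nlinarith [sq_pos_of_pos hs]
  obtain ⟨p, hp, hpc⟩ := exists_coupling_lt (hlt hθ0.le h1)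
  obtain ⟨q, hq, hqc⟩ := exists_coupling_lt (hlt hθ'.le h2)
  obtain ⟨P, hP, hP1, hP2⟩ := exists_gluing hp hq
  have m1 : P.map (fun ω : (X × X) × X => ω.1.1) = α := by
    rw [← hp.1, ← hP1, Measure.map_map (by fun_prop) (by fun_prop)]; rfl
  have m2 : P.map (fun ω : (X × X) × X => ω.1.2) = β := by
    rw [← hp.2, ← hP1, Measure.map_map (by fun_prop) (by fun_prop)]; rfl
  have m3 : P.map (fun ω : (X × X) × X => ω.2) = γ := by
    rw [← hq.2, ← hP2, Measure.map_map (by fun_prop) (by fun_prop)]; rfl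
  have c1 : ∫⁻ ω, edist ω.1.1 ω.1.2 ^ 2 ∂P < ENNReal.ofReal (θ ^ 2 * r ^ 2 + s ^ 2) := by
    rw [← hP1, lintegral_map measurable_edist_sq (by fun_prop)] at hpc
    exact hpc
  have c2 : ∫⁻ ω, edist ω.1.2 ω.2 ^ 2 ∂P < ENNReal.ofReal ((1 - θ) ^ 2 * r ^ 2 + s ^ 2) := by
    rw [← hP2, lintegral_map measurable_edist_sq (by fun_prop)] at hqc
    exact hqc
  have d1 : Measurable fun ω : (X × X) × X => dist ω.1.1 ω.1.2 := by fun_prop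
  have d2 : Measurable fun ω : (X × X) × X => dist ω.1.2 ω.2 := by fun_prop
  have d3 : Measurable fun ω : (X × X) × X => dist ω.1.1 ω.2 := by fun_prop
  have i1 := integrable_dist_sq d1 c1.ne_top
  have i2 := integrable_dist_sq d2 c2.ne_top
  have i3 : Integrable (fun ω : (X × X) × X => dist ω.1.1 ω.2 ^ 2) P := by
    refine ((i1.const_mul 2).add (i2.const_mul 2)).mono' (d3.pow_const 2).aestronglyMeasurable
      (ae_of_all _ fun ω => ?_)
    rw [Real.norm_of_nonneg (sq_nonneg _)]
    have ht := dist_triangle ω.1.1 ω.1.2 ω.2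
    have : dist ω.1.1 ω.2 ^ 2 ≤ (dist ω.1.1 ω.1.2 + dist ω.1.2 ω.2) ^ 2 := by gcongr
    simp only [Pi.add_apply]
    nlinarith [sq_nonneg (dist ω.1.1 ω.1.2 - dist ω.1.2 ω.2)]
  have f3 : ∫⁻ ω, edist ω.1.1 ω.2 ^ 2 ∂P ≠ ⊤ := by
    have := (hasFiniteIntegral_iff_ofReal (ae_of_all _ fun ω : (X × X) × X =>
      sq_nonneg (dist ω.1.1 ω.2))).1 i3.2
    simp only [ENNReal.ofReal_pow dist_nonneg, ← edist_dist] at this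
    exact this.ne
  have b1 : ∫ ω, dist ω.1.1 ω.1.2 ^ 2 ∂P ≤ θ ^ 2 * r ^ 2 + s ^ 2 := by
    rw [← ofReal_integral_dist_sq d1 c1.ne_top] at c1
    exact (ENNReal.ofReal_le_ofReal_iff (by positivity)).1 c1.le
  have b2 : ∫ ω, dist ω.1.2 ω.2 ^ 2 ∂P ≤ (1 - θ) ^ 2 * r ^ 2 + s ^ 2 := by
    rw [← ofReal_integral_dist_sq d2 c2.ne_top] at c2
    exact (ENNReal.ofReal_le_ofReal_iff (by positivity)).1 c2.le
  have b3 : r ^ 2 ≤ ∫ ω, dist ω.1.1 ω.2 ^ 2 ∂P := by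
    have hc := W₂_sq_le (map_prodMk_mem_couplings P (f := fun ω : (X × X) × X => ω.1.1)
      (g := fun ω => ω.2) (by fun_prop) (by fun_prop))
    rw [m1, m3, h3, lintegral_map measurable_edist_sq (by fun_prop),
      ← ofReal_integral_dist_sq d3 f3, hLr, ← ENNReal.ofReal_pow hr0] at hc
    exact (ENNReal.ofReal_le_ofReal_iff (integral_nonneg fun ω => sq_nonneg _)).1 hc
  refine ⟨P, hP, m1, m2, m3, ?_, ?_⟩
  · rw [← ofReal_integral_dist_sq d3 f3, hLr, ← ENNReal.ofReal_pow hr0,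
      ← ENNReal.ofReal_add (by positivity) (by positivity)]
    refine ENNReal.ofReal_le_ofReal ?_
    have hpt : ∀ ω : (X × X) × X, dist ω.1.1 ω.2 ^ 2
        ≤ dist ω.1.1 ω.1.2 ^ 2 * θ⁻¹ + dist ω.1.2 ω.2 ^ 2 * (1 - θ)⁻¹ := by
      intro ω
      have ht := dist_triangle ω.1.1 ω.1.2 ω.2
      have h4 : dist ω.1.1 ω.2 ^ 2 ≤ (dist ω.1.1 ω.1.2 + dist ω.1.2 ω.2) ^ 2 := by gcongr
      refine h4.trans ?_
      have h5 : dist ω.1.1 ω.1.2 ^ 2 * θ⁻¹ + dist ω.1.2 ω.2 ^ 2 * (1 - θ)⁻¹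
          - (dist ω.1.1 ω.1.2 + dist ω.1.2 ω.2) ^ 2
          = ((1 - θ) * dist ω.1.1 ω.1.2 - θ * dist ω.1.2 ω.2) ^ 2 / (θ * (1 - θ)) := by
        field_simp
        ring
      have h6 : 0 ≤ ((1 - θ) * dist ω.1.1 ω.1.2 - θ * dist ω.1.2 ω.2) ^ 2 / (θ * (1 - θ)) := by
        positivity
      linarith
    refine (integral_mono i3 ((i1.mul_const _).fun_add (i2.mul_const _)) hpt).trans ?_
    rw [integral_add (i1.mul_const _) (i2.mul_const _), integral_mul_const, integral_mul_const]
    have h7 : (∫ ω, dist ω.1.1 ω.1.2 ^ 2 ∂P) * θ⁻¹ ≤ (θ ^ 2 * r ^ 2 + s ^ 2) * θ⁻¹ := by gcongr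
    have h8 : (∫ ω, dist ω.1.2 ω.2 ^ 2 ∂P) * (1 - θ)⁻¹
        ≤ ((1 - θ) ^ 2 * r ^ 2 + s ^ 2) * (1 - θ)⁻¹ := by gcongr
    have h9 : (θ ^ 2 * r ^ 2 + s ^ 2) * θ⁻¹ + ((1 - θ) ^ 2 * r ^ 2 + s ^ 2) * (1 - θ)⁻¹
        = r ^ 2 + s ^ 2 / (θ * (1 - θ)) := by
      field_simp
      ring
    linarith
  · set k := (θ * (1 - θ))⁻¹ with hk
    have hk0 : 0 < k := by positivity
    have hpt : ∀ ω : (X × X) × X, betweenDefect θ ω ≤ 2 * s + s⁻¹ * (1 + k) *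
        ((1 - θ) * dist ω.1.1 ω.1.2 ^ 2 + θ * dist ω.1.2 ω.2 ^ 2
          - θ * (1 - θ) * dist ω.1.1 ω.2 ^ 2) := by
      intro ω
      have ht := dist_triangle ω.1.1 ω.1.2 ω.2
      have hn1 : 0 ≤ dist ω.1.1 ω.2 := dist_nonneg
      unfold betweenDefect
      set x := dist ω.1.1 ω.1.2
      set y := dist ω.1.2 ω.2
      set z := dist ω.1.1 ω.2
      refine (min_le_right _ _).trans ?_
      set u := (1 - θ) * x - θ * y
      set v := x + y - z
      -- Since the mean of the squares is of order `s ^ 2`, weighting the square by `s⁻¹` gives a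
      -- first moment of order `s`.
      have hab : ∀ w : ℝ, |w| ≤ s + s⁻¹ * w ^ 2 := by
        intro w
        have : s * |w| ≤ s * (s + s⁻¹ * w ^ 2) := by
          rw [mul_add, ← mul_assoc, mul_inv_cancel₀ hs.ne', one_mul, ← sq_abs w]
          nlinarith [sq_nonneg (s - |w|), abs_nonneg w]
        exact le_of_mul_le_mul_left this hs
      have hE : (1 - θ) * x ^ 2 + θ * y ^ 2 - θ * (1 - θ) * z ^ 2
          = u ^ 2 + θ * (1 - θ) * ((x + y) ^ 2 - z ^ 2) := by ring
      have hv : v ^ 2 ≤ (x + y) ^ 2 - z ^ 2 := by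
        have hv0 : 0 ≤ v := by linarith
        have : (x + y) ^ 2 - z ^ 2 - v ^ 2 = 2 * z * v := by ring
        nlinarith [mul_nonneg hn1 hv0]
      have hvE : v ^ 2 ≤ k * (u ^ 2 + θ * (1 - θ) * ((x + y) ^ 2 - z ^ 2)) := by
        rw [mul_add, ← mul_assoc, hk, inv_mul_cancel₀ (by positivity), one_mul]
        have : 0 ≤ (θ * (1 - θ))⁻¹ * u ^ 2 := by positivity
        linarith
      have huE : u ^ 2 ≤ u ^ 2 + θ * (1 - θ) * ((x + y) ^ 2 - z ^ 2) := by
        have : 0 ≤ θ * (1 - θ) * ((x + y) ^ 2 - z ^ 2) :=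
          mul_nonneg (by positivity) ((sq_nonneg v).trans hv)
        linarith
      rw [hE]
      have hsi : 0 < s⁻¹ := inv_pos.2 hs
      have e1 := mul_le_mul_of_nonneg_left huE hsi.le
      have e2 := mul_le_mul_of_nonneg_left hvE hsi.le
      have e3 := hab u
      have e4 := hab v
      rw [mul_assoc, add_mul, mul_add, one_mul]
      linarith
    have iE : Integrable (fun ω : (X × X) × X => (1 - θ) * dist ω.1.1 ω.1.2 ^ 2
        + θ * dist ω.1.2 ω.2 ^ 2 - θ * (1 - θ) * dist ω.1.1 ω.2 ^ 2) P :=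
      ((i1.const_mul _).add (i2.const_mul _)).sub (i3.const_mul _)
    have iF : Integrable (betweenDefect (X := X) θ) P :=
      integrable_of_bounded (continuous_betweenDefect θ).measurable (abs_betweenDefect_le θ)
    refine (integral_mono iF ((integrable_const _).fun_add (iE.const_mul _)) hpt).trans ?_
    rw [integral_add (integrable_const _) (iE.const_mul _), integral_const_mul (s⁻¹ * (1 + k)),
      integral_sub ((i1.const_mul _).fun_add (i2.const_mul _)) (i3.const_mul _),
      integral_add (i1.const_mul _) (i2.const_mul _), integral_const_mul (1 - θ),
      integral_const_mul θ, integral_const_mul (θ * (1 - θ))]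
    simp only [integral_const, probReal_univ, smul_eq_mul, one_mul]
    have e1 := mul_le_mul_of_nonneg_left b1 hθ'.le
    have e2 := mul_le_mul_of_nonneg_left b2 hθ0.le
    have e3 := mul_le_mul_of_nonneg_left b3 (mul_pos hθ0 hθ').le
    have e4 : (1 - θ) * ∫ ω, dist ω.1.1 ω.1.2 ^ 2 ∂P + θ * ∫ ω, dist ω.1.2 ω.2 ^ 2 ∂P
        - θ * (1 - θ) * ∫ ω, dist ω.1.1 ω.2 ^ 2 ∂P ≤ s ^ 2 := by
      have : (1 - θ) * (θ ^ 2 * r ^ 2 + s ^ 2) + θ * ((1 - θ) ^ 2 * r ^ 2 + s ^ 2)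
          - θ * (1 - θ) * r ^ 2 = s ^ 2 := by ring
      linarith
    have e5 := mul_le_mul_of_nonneg_left e4
      (mul_nonneg (inv_pos.2 hs).le (by linarith : (0 : ℝ) ≤ 1 + k))
    have e6 : s⁻¹ * (1 + k) * s ^ 2 = s * (1 + k) := by field_simp
    have e7 : 1 / (θ * (1 - θ)) = k := one_div _
    rw [e7]
    linarith

end Glued

/-- A tight sequence of measures has a weak limit along any ultrafilter. -/
theorem exists_weakLimit {ι : Type*} (U : Ultrafilter ι) {Ω : ι → Type*}
    [∀ i, MeasurableSpace (Ω i)] {Z : Type*} [MetricSpace Z] [MeasurableSpace Z] [BorelSpace Z]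
    {T : ∀ i, Ω i → Z} (hT : ∀ i, Measurable (T i)) (P : ∀ i, Measure (Ω i))
    [∀ i, IsProbabilityMeasure (P i)]
    (ht : IsTightMeasureSet (Set.range fun i => (P i).map (T i))) :
    ∃ ν : ProbabilityMeasure Z, WeakLimit (U : Filter ι) T P (ν : Measure Z) := by
  let ρ : ι → ProbabilityMeasure Z := fun i =>
    ⟨(P i).map (T i), Measure.isProbabilityMeasure_map (hT i).aemeasurable⟩
  have hc : IsCompact (closure (Set.range ρ)) := by
    refine isCompact_closure_of_isTightMeasureSet (ht.subset ?_)
    rintro _ ⟨_, ⟨i, rfl⟩, rfl⟩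
    exact ⟨i, rfl⟩
  obtain ⟨ν, -, hν⟩ := hc.ultrafilter_le_nhds (U.map ρ) (by
    rw [le_principal_iff]
    exact Filter.mem_map.2 (Eventually.of_forall fun i => subset_closure ⟨i, rfl⟩))
  refine ⟨ν, fun F => ?_⟩
  have h1 : Tendsto ρ (U : Filter ι) (𝓝 ν) := hν
  have h2 := ProbabilityMeasure.tendsto_iff_forall_integral_tendsto.1 h1 F
  refine h2.congr fun i => ?_
  exact integral_map (hT i).aemeasurable F.continuous.measurable.aestronglyMeasurable

theorem WeakLimit.unique {ι : Type*} {l : Filter ι} [l.NeBot] {Ω : ι → Type*}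
    [∀ i, MeasurableSpace (Ω i)] {Z : Type*} [MetricSpace Z] [MeasurableSpace Z] [BorelSpace Z]
    {T : ∀ i, Ω i → Z} {P : ∀ i, Measure (Ω i)} {ν ν' : Measure Z} [IsFiniteMeasure ν]
    [IsFiniteMeasure ν'] (h : WeakLimit l T P ν) (h' : WeakLimit l T P ν') : ν = ν' :=
  ext_of_forall_integral_eq_of_IsFiniteMeasure fun F => tendsto_nhds_unique (h F) (h' F)

theorem WeakLimit.of_map {ι : Type*} {l : Filter ι} {Ω Ω' : ι → Type*}
    [∀ i, MeasurableSpace (Ω i)] [∀ i, MeasurableSpace (Ω' i)] {Z : Type*} [MetricSpace Z]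
    [MeasurableSpace Z] [BorelSpace Z] {T : ∀ i, Ω' i → Z} (hT : ∀ i, Measurable (T i))
    {P : ∀ i, Measure (Ω i)} {P' : ∀ i, Measure (Ω' i)} {g : ∀ i, Ω i → Ω' i}
    (hg : ∀ i, Measurable (g i)) (hP : ∀ i, (P i).map (g i) = P' i) {ν : Measure Z} :
    WeakLimit l T P' ν ↔ WeakLimit l (fun i x => T i (g i x)) P ν := by
  refine forall_congr' fun F => tendsto_congr fun i => ?_
  rw [← hP i, integral_map (f := fun x => F (T i x)) (hg i).aemeasurable
    (F.continuous.measurable.comp (hT i)).aestronglyMeasurable]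

/-! ### Weak limits of three times of a geodesic -/

section GeodesicLimit

variable {X : ℕ → Type*} [∀ i, MetricSpace (X i)] [∀ i, CompleteSpace (X i)]
  [∀ i, MeasurableSpace (X i)] [∀ i, BorelSpace (X i)] [∀ i, SecondCountableTopology (X i)]
  {Y : Type*} [MetricSpace Y] [MeasurableSpace Y] [BorelSpace Y]
  [SecondCountableTopology Y] {T : ∀ i, X i → Y} {e : ∀ i, X i → ℝ}

/-- Measures `α i` on the spaces `X i` which are asymptotically supported in `Y` and whose images
in `Y` are tight. -/
structure TightThrough (U : Filter ℕ) (T : ∀ i, X i → Y) (e : ∀ i, X i → ℝ)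
    (α : ∀ i, Measure (X i)) : Prop where
  tight : IsTightMeasureSet (Set.range fun i => (α i).map (T i))
  small : ∀ η : ℝ, 0 < η → Tendsto (fun i => α i {x | η < e i x}) U (𝓝 0)

/-- Each distance changes by at most the errors at its two ends. The two absolute values change by
`e₁ + 2e₂ + e₃` and `2(e₁ + e₂ + e₃)`, and the truncation at `1` is a contraction. -/
theorem abs_betweenDefect_sub_le {X Y : Type*} [MetricSpace X] [MetricSpace Y] {T : X → Y}
    {e : X → ℝ} (hTe : ∀ x x', |dist x x' - dist (T x) (T x')| ≤ e x + e x') {θ : ℝ} (hθ0 : 0 ≤ θ)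
    (hθ1 : θ ≤ 1) (ω : (X × X) × X) :
    |betweenDefect θ ((T ω.1.1, T ω.1.2), T ω.2) - betweenDefect θ ω|
      ≤ 4 * (e ω.1.1 + e ω.1.2 + e ω.2) := by
  have h1 := abs_le.1 (hTe ω.1.1 ω.1.2)
  have h2 := abs_le.1 (hTe ω.1.2 ω.2)
  have h3 := abs_le.1 (hTe ω.1.1 ω.2)
  have e1 : 0 ≤ e ω.1.1 := by have := hTe ω.1.1 ω.1.1; simp at this; linarith
  have e2 : 0 ≤ e ω.1.2 := by have := hTe ω.1.2 ω.1.2; simp at this; linarith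
  have e3 : 0 ≤ e ω.2 := by have := hTe ω.2 ω.2; simp at this; linarith
  unfold betweenDefect
  refine (abs_min_sub_min_le_max _ _ _ _).trans ?_
  rw [sub_self, abs_zero]
  refine max_le (by positivity) ?_
  simp only
  set x := dist ω.1.1 ω.1.2
  set y := dist ω.1.2 ω.2
  set z := dist ω.1.1 ω.2
  set x' := dist (T ω.1.1) (T ω.1.2)
  set y' := dist (T ω.1.2) (T ω.2)
  set z' := dist (T ω.1.1) (T ω.2)
  have k1 : |(|(1 - θ) * x' - θ * y'| - |(1 - θ) * x - θ * y|)|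
      ≤ (e ω.1.1 + e ω.1.2) + (e ω.1.2 + e ω.2) := by
    refine (abs_abs_sub_abs_le_abs_sub _ _).trans ?_
    rw [show (1 - θ) * x' - θ * y' - ((1 - θ) * x - θ * y)
      = (1 - θ) * (x' - x) - θ * (y' - y) by ring]
    refine (abs_sub _ _).trans (add_le_add ?_ ?_)
    · rw [abs_mul, abs_of_nonneg (by linarith : 0 ≤ 1 - θ), abs_sub_comm]
      exact (mul_le_of_le_one_left (abs_nonneg _) (by linarith)).trans (hTe _ _)
    · rw [abs_mul, abs_of_nonneg hθ0, abs_sub_comm]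
      exact (mul_le_of_le_one_left (abs_nonneg _) hθ1).trans (hTe _ _)
  have k2 : |(|x' + y' - z'| - |x + y - z|)|
      ≤ (e ω.1.1 + e ω.1.2) + (e ω.1.2 + e ω.2) + (e ω.1.1 + e ω.2) := by
    refine (abs_abs_sub_abs_le_abs_sub _ _).trans ?_
    rw [abs_le]
    constructor <;> linarith
  rw [show |(1 - θ) * x' - θ * y'| + |x' + y' - z'| - (|(1 - θ) * x - θ * y| + |x + y - z|)
    = (|(1 - θ) * x' - θ * y'| - |(1 - θ) * x - θ * y|)
      + (|x' + y' - z'| - |x + y - z|) by ring]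
  refine (abs_add_le _ _).trans ?_
  linarith

/-- Intermediate points of Wasserstein geodesics pass to the limit. -/
theorem W₂_le_of_weakLimit {U : Ultrafilter ℕ} (hU : (U : Filter ℕ) ≤ atTop)
    (hT : ∀ i, Measurable (T i)) (he : ∀ i, Measurable (e i))
    (hTe : ∀ i x x', |dist x x' - dist (T i x) (T i x')| ≤ e i x + e i x')
    {α β γ : ∀ i, Measure (X i)} [∀ i, IsProbabilityMeasure (α i)]
    [∀ i, IsProbabilityMeasure (β i)] (hα : TightThrough U T e α) (hβ : TightThrough U T e β)
    (hγ : TightThrough U T e γ) {α' β' γ' : Measure Y} [IsProbabilityMeasure α']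
    [IsProbabilityMeasure β'] [IsProbabilityMeasure γ'] (hα' : WeakLimit U T α α')
    (hβ' : WeakLimit U T β β') (hγ' : WeakLimit U T γ γ') {θ : ℝ} (hθ0 : 0 < θ) (hθ1 : θ < 1)
    {L : ℕ → ℝ≥0∞} (hL : ∀ i, L i ≠ ⊤) (h1 : ∀ i, W₂ (α i) (β i) = ENNReal.ofReal θ * L i)
    (h2 : ∀ i, W₂ (β i) (γ i) = ENNReal.ofReal (1 - θ) * L i) (h3 : ∀ i, W₂ (α i) (γ i) = L i)
    (o : Y) (hm1 : ∫⁻ y, edist y o ^ 2 ∂α' ≠ ⊤) (hm2 : ∫⁻ y, edist y o ^ 2 ∂γ' ≠ ⊤) :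
    W₂ α' β' ≤ ENNReal.ofReal θ * W₂ α' γ' ∧ W₂ β' γ' ≤ ENNReal.ofReal (1 - θ) * W₂ α' γ' := by
  have hs : ∀ i : ℕ, (0 : ℝ) < 1 / ((i : ℝ) + 1) := fun i => by positivity
  have hst : Tendsto (fun i : ℕ => 1 / ((i : ℝ) + 1)) U (𝓝 0) :=
    tendsto_one_div_add_atTop_nhds_zero_nat.mono_left hU
  choose P hP m1 m2 m3 hPc hPd using fun i =>
    exists_glued_near_geodesic (hL i) hθ0 hθ1 (h1 i) (h2 i) (h3 i) (hs i)
  let TT : ∀ i, (X i × X i) × X i → (Y × Y) × Y := fun i ω => ((T i ω.1.1, T i ω.1.2), T i ω.2)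
  have hTT : ∀ i, Measurable (TT i) := fun i => by
    have := hT i
    fun_prop
  have htight : IsTightMeasureSet (Set.range fun i => (P i).map (TT i)) := by
    refine IsTightMeasureSet.prodMk (IsTightMeasureSet.prodMk (hα.tight.subset ?_)
      (hβ.tight.subset ?_)) (hγ.tight.subset ?_)
    · rintro _ ⟨_, ⟨_, ⟨i, rfl⟩, rfl⟩, rfl⟩
      refine ⟨i, ?_⟩
      simp only [Measure.fst]
      rw [Measure.map_map measurable_fst (hTT i), Measure.map_map measurable_fst
        (measurable_fst.comp (hTT i)), ← m1 i, Measure.map_map (hT i) (by fun_prop)]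
      rfl
    · rintro _ ⟨_, ⟨_, ⟨i, rfl⟩, rfl⟩, rfl⟩
      refine ⟨i, ?_⟩
      simp only [Measure.fst, Measure.snd]
      rw [Measure.map_map measurable_fst (hTT i), Measure.map_map measurable_snd
        (measurable_fst.comp (hTT i)), ← m2 i, Measure.map_map (hT i) (by fun_prop)]
      rfl
    · rintro _ ⟨_, ⟨i, rfl⟩, rfl⟩
      refine ⟨i, ?_⟩
      simp only [Measure.snd]
      rw [Measure.map_map measurable_snd (hTT i), ← m3 i, Measure.map_map (hT i) (by fun_prop)]
      rfl
  obtain ⟨ν, hν⟩ := exists_weakLimit U hTT P htight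
  have n1 : (ν : Measure ((Y × Y) × Y)).map (fun ω => ω.1.1) = α' :=
    (hν.comp (g := fun ω : (Y × Y) × Y => ω.1.1) (by fun_prop)).unique
      ((WeakLimit.of_map hT (fun i => by fun_prop) m1).1 hα')
  have n2 : (ν : Measure ((Y × Y) × Y)).map (fun ω => ω.1.2) = β' :=
    (hν.comp (g := fun ω : (Y × Y) × Y => ω.1.2) (by fun_prop)).unique
      ((WeakLimit.of_map hT (fun i => by fun_prop) m2).1 hβ')
  have n3 : (ν : Measure ((Y × Y) × Y)).map (fun ω => ω.2) = γ' :=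
    (hν.comp (g := fun ω : (Y × Y) × Y => ω.2) (by fun_prop)).unique
      ((WeakLimit.of_map hT (fun i => by fun_prop) m3).1 hγ')
  have hsm : ∀ i, ∀ η : ℝ, MeasurableSet {x | η < e i x} := fun i η =>
    measurableSet_lt measurable_const (he i)
  have s1 : ∀ η : ℝ, 0 < η → Tendsto (fun i => P i {ω | η < e i ω.1.1}) U (𝓝 0) := fun η hη =>
    (hα.small η hη).congr fun i => by
      rw [← m1 i, Measure.map_apply (by fun_prop) (hsm i η)]; rfl
  have s2 : ∀ η : ℝ, 0 < η → Tendsto (fun i => P i {ω | η < e i ω.1.2}) U (𝓝 0) := fun η hη =>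
    (hβ.small η hη).congr fun i => by
      rw [← m2 i, Measure.map_apply (by fun_prop) (hsm i η)]; rfl
  have s3 : ∀ η : ℝ, 0 < η → Tendsto (fun i => P i {ω | η < e i ω.2}) U (𝓝 0) := fun η hη =>
    (hγ.small η hη).congr fun i => by
      rw [← m3 i, Measure.map_apply (by fun_prop) (hsm i η)]; rfl
  -- The defect is truncated so as to be bounded and continuous. Its mean tends to zero in the
  -- approximating spaces, and replacing points by their images changes it little in probability.
  have hzero : ∫ ω, betweenDefect θ ω ∂(ν : Measure ((Y × Y) × Y)) = 0 := by
    have t1 := hν.tendsto_integral (continuous_betweenDefect θ) (abs_betweenDefect_le θ)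
    have t2 : Tendsto (fun i => ∫ ω, betweenDefect θ ω ∂(P i)) U (𝓝 0) := by
      refine squeeze_zero (fun i => integral_nonneg fun ω => betweenDefect_nonneg θ ω) hPd ?_
      have := hst.mul_const (3 + 1 / (θ * (1 - θ)))
      rwa [zero_mul] at this
    have t3 := tendsto_integral_sub_of_tendsto_measure (l := (U : Filter ℕ)) (P := P)
      (A := fun i ω => betweenDefect θ (TT i ω)) (B := fun i ω => betweenDefect θ ω)
      (fun i => (continuous_betweenDefect θ).measurable.comp (hTT i))
      (fun i => (continuous_betweenDefect θ).measurable) (C := 1)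
      (fun i ω => abs_betweenDefect_le θ _) (fun i ω => abs_betweenDefect_le θ _) (by
        intro η hη
        -- Three points, each with its error multiplied by `4`.
        have hη' : 0 < η / 12 := by positivity
        have hsum := ((s1 _ hη').add (s2 _ hη')).add (s3 _ hη')
        rw [add_zero, add_zero] at hsum
        refine tendsto_of_tendsto_of_tendsto_of_le_of_le tendsto_const_nhds hsum
          (fun i => bot_le) (fun i => ?_)
        refine (measure_mono fun ω hω => ?_).trans ((measure_union_le _ _).trans
          (add_le_add (measure_union_le _ _) le_rfl))
        have hω' : η < |betweenDefect θ (TT i ω) - betweenDefect θ ω| := hω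
        have := abs_betweenDefect_sub_le (hTe i) hθ0.le hθ1.le ω
        by_contra hcon
        simp only [Set.mem_union, Set.mem_ofPred_eq, not_or, not_lt] at hcon
        have hlt := hω'.trans_le this
        linarith [hcon.1.1, hcon.1.2, hcon.2])
    have t4 := t1.sub t2
    exact (sub_zero (∫ ω, betweenDefect θ ω ∂(ν : Measure ((Y × Y) × Y)))) ▸
      tendsto_nhds_unique t4 t3
  have hae : ∀ᵐ ω ∂(ν : Measure ((Y × Y) × Y)), dist ω.1.1 ω.1.2 = θ * dist ω.1.1 ω.2
      ∧ dist ω.1.2 ω.2 = (1 - θ) * dist ω.1.1 ω.2 := by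
    have := (integral_eq_zero_iff_of_nonneg (fun ω => betweenDefect_nonneg θ ω)
      (integrable_of_bounded (continuous_betweenDefect θ).measurable
        (abs_betweenDefect_le θ))).1 hzero
    filter_upwards [this] with ω hω
    have hω' : betweenDefect θ ω = 0 := hω
    unfold betweenDefect at hω'
    set u := (1 - θ) * dist ω.1.1 ω.1.2 - θ * dist ω.1.2 ω.2
    set v := dist ω.1.1 ω.1.2 + dist ω.1.2 ω.2 - dist ω.1.1 ω.2
    have huv : |u| + |v| ≤ 0 := by
      rcases min_cases 1 (|u| + |v|) with ⟨h, -⟩ | ⟨h, -⟩ <;> linarith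
    have hu : u = 0 := abs_nonpos_iff.1 (by linarith [abs_nonneg v])
    have hv : v = 0 := abs_nonpos_iff.1 (by linarith [abs_nonneg u])
    have hu' : (1 - θ) * dist ω.1.1 ω.1.2 - θ * dist ω.1.2 ω.2 = 0 := hu
    have hv' : dist ω.1.1 ω.1.2 + dist ω.1.2 ω.2 - dist ω.1.1 ω.2 = 0 := hv
    constructor
    · linear_combination hu' + θ * hv'
    · linear_combination -hu' + (1 - θ) * hv'
  let Q₂ : ∀ i, Measure (X i × X i) := fun i => (P i).map fun ω => (ω.1.1, ω.2)
  let π : Measure (Y × Y) := (ν : Measure ((Y × Y) × Y)).map fun ω => (ω.1.1, ω.2)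
  have hpm : ∀ i, Measurable fun ω : (X i × X i) × X i => (ω.1.1, ω.2) := fun i => by fun_prop
  have hpm' : Measurable fun ω : (Y × Y) × Y => (ω.1.1, ω.2) := by fun_prop
  have hQ₂p : ∀ i, IsProbabilityMeasure (Q₂ i) := fun i =>
    Measure.isProbabilityMeasure_map (hpm i).aemeasurable
  have hπp : IsProbabilityMeasure π := Measure.isProbabilityMeasure_map hpm'.aemeasurable
  have hQ₂ : ∀ i, Q₂ i ∈ couplings (α i) (γ i) := fun i => by
    have := map_prodMk_mem_couplings (P i) (f := fun ω : (X i × X i) × X i => ω.1.1)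
      (g := fun ω => ω.2) (by fun_prop) (by fun_prop)
    rwa [m1 i, m3 i] at this
  have hπ : π ∈ couplings α' γ' := by
    have := map_prodMk_mem_couplings (ν : Measure ((Y × Y) × Y))
      (f := fun ω : (Y × Y) × Y => ω.1.1) (g := fun ω => ω.2) (by fun_prop) (by fun_prop)
    rwa [n1, n3] at this
  have hQ₂cost : ∀ i, ∫⁻ p, edist p.1 p.2 ^ 2 ∂(Q₂ i) = ∫⁻ ω, edist ω.1.1 ω.2 ^ 2 ∂(P i) := fun i =>
    lintegral_map measurable_edist_sq (hpm i)
  -- The outer marginals of the glued plans are optimal up to a vanishing error, so their limit is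
  -- optimal.
  have hopt : ∫⁻ ω, edist ω.1.1 ω.2 ^ 2 ∂(ν : Measure ((Y × Y) × Y)) ≤ W₂ α' γ' ^ 2 := by
    rw [W₂_sq]
    refine le_iInf₂ fun q hq => ?_
    have := lintegral_le_of_weakLimit_nearOptimal (l := (U : Filter ℕ)) (P := Q₂) (π := π) (q := q)
      (ε := fun i => ENNReal.ofReal ((1 / ((i : ℝ) + 1)) ^ 2 / (θ * (1 - θ)))) hT he hTe
      (fun η hη => (s1 η hη).congr fun i => 
        (Measure.map_apply (hpm i) (measurable_fst (hsm i η))).symm)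
      (fun η hη => (s3 η hη).congr fun i => 
        (Measure.map_apply (hpm i) (measurable_snd (hsm i η))).symm)
      (by
        have := ENNReal.tendsto_ofReal ((hst.pow 2).div_const (θ * (1 - θ)))
        simpa using this)
      (fun i => by
        rw [hQ₂cost]
        exact ne_top_of_le_ne_top (ENNReal.add_ne_top.2 ⟨by simp [hL i], by simp⟩) (hPc i))
      (fun i q' hq' => by
        rw [hQ₂cost]
        refine (hPc i).trans (add_le_add ?_ le_rfl)
        rw [(hQ₂ i).1, (hQ₂ i).2] at hq'
        rw [← h3 i]
        exact W₂_sq_le hq')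
      ((WeakLimit.of_map (fun i => ((hT i).comp measurable_fst).prodMk
        ((hT i).comp measurable_snd)) hpm (fun i => rfl)).2 (hν.comp (g := fun ω : (Y × Y) × Y =>
          (ω.1.1, ω.2)) (by fun_prop)))
      (by rw [hπ.1, hπ.2]; exact hq) o
      (by rw [lintegral_fst_of_mem_couplings hπ (f := fun y => edist y o ^ 2) (by fun_prop)]
          exact hm1)
      (by rw [lintegral_snd_of_mem_couplings hπ (f := fun y => edist y o ^ 2) (by fun_prop)]
          exact hm2)
    rwa [lintegral_map measurable_edist_sq hpm'] at this
  -- Exact betweenness makes the cost of the inner couplings a fixed multiple of the optimal outer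
  -- cost. Only upper bounds result; equality comes later from the triangle inequality.
  have hfinal : ∀ {μ₁ μ₂ : Measure Y} {t : ℝ} {f g : (Y × Y) × Y → Y}, 0 ≤ t → Measurable f →
      Measurable g → (ν : Measure ((Y × Y) × Y)).map f = μ₁ →
      (ν : Measure ((Y × Y) × Y)).map g = μ₂ →
      (∀ᵐ ω ∂(ν : Measure ((Y × Y) × Y)), dist (f ω) (g ω) = t * dist ω.1.1 ω.2) →
      W₂ μ₁ μ₂ ≤ ENNReal.ofReal t * W₂ α' γ' := by
    intro μ₁ μ₂ t f g ht hf hg e1 e2 hd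
    have hc := W₂_sq_le (map_prodMk_mem_couplings (ν : Measure ((Y × Y) × Y)) hf hg)
    rw [e1, e2, lintegral_map measurable_edist_sq (hf.prodMk hg)] at hc
    rw [← sq_le_sq_ennreal, mul_pow]
    calc W₂ μ₁ μ₂ ^ 2 ≤ ∫⁻ ω, ENNReal.ofReal t ^ 2 * edist ω.1.1 ω.2 ^ 2
          ∂(ν : Measure ((Y × Y) × Y)) := by
          refine hc.trans (le_of_eq (lintegral_congr_ae ?_))
          filter_upwards [hd] with ω hω
          rw [edist_dist, hω, edist_dist, ENNReal.ofReal_mul ht, mul_pow]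
      _ = ENNReal.ofReal t ^ 2 * ∫⁻ ω, edist ω.1.1 ω.2 ^ 2 ∂(ν : Measure ((Y × Y) × Y)) :=
          lintegral_const_mul' _ _ (by finiteness)
      _ ≤ _ := by gcongr
  exact ⟨hfinal hθ0.le (by fun_prop) (by fun_prop) n1 n2 (hae.mono fun ω h => h.1),
    hfinal (by linarith) (by fun_prop) (by fun_prop) n2 n3 (hae.mono fun ω h => h.2)⟩

end GeodesicLimit

/-! ### Couplings of metrics -/

section MetricCoupling

variable {X Y : Type*} [MetricSpace X] [MetricSpace Y] (δ : MetricCoupling X Y)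

/-- The distance between a point of `X` and a point of `Y`. -/
def MetricCoupling.cross (x : X) (y : Y) : ℝ := δ.d (Sum.inl x) (Sum.inr y)

theorem MetricCoupling.cross_nonneg (x : X) (y : Y) : 0 ≤ δ.cross x y := by
  have h := δ.d_triangle (Sum.inl x) (Sum.inr y) (Sum.inl x)
  rw [δ.d_self, δ.d_comm (Sum.inr y)] at h
  unfold MetricCoupling.cross
  linarith

theorem MetricCoupling.cross_le_left (x x' : X) (y : Y) :
    δ.cross x y ≤ dist x x' + δ.cross x' y := by
  rw [← δ.d_inl]
  exact δ.d_triangle _ _ _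

theorem MetricCoupling.cross_le_right (x : X) (y y' : Y) :
    δ.cross x y ≤ δ.cross x y' + dist y' y := by
  rw [← δ.d_inr]
  exact δ.d_triangle _ _ _

theorem MetricCoupling.dist_left_le (x x' : X) (y : Y) :
    dist x x' ≤ δ.cross x y + δ.cross x' y := by
  have h := δ.d_triangle (Sum.inl x) (Sum.inr y) (Sum.inl x')
  rwa [δ.d_inl, δ.d_comm (Sum.inr y)] at h

theorem MetricCoupling.dist_right_le (x : X) (y y' : Y) :
    dist y y' ≤ δ.cross x y + δ.cross x y' := by
  have h := δ.d_triangle (Sum.inr y) (Sum.inl x) (Sum.inr y')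
  rwa [δ.d_inr, δ.d_comm (Sum.inr y)] at h

/-- With `y = T x` and `y' = T x'` this supplies the distortion hypothesis `hTe` used above, the
error function being `cross x (T x)`. -/
theorem MetricCoupling.abs_dist_sub_dist_le (x x' : X) (y y' : Y) :
    |dist x x' - dist y y'| ≤ δ.cross x y + δ.cross x' y' := by
  have h1 := δ.dist_left_le x x' y
  have h2 := δ.cross_le_right x' y y'
  have h3 := δ.dist_right_le x y y'
  have h4 := δ.cross_le_left x x' y'
  rw [dist_comm y' y] at h2
  rw [abs_le]
  constructor <;> linarith

theorem MetricCoupling.continuous_cross : Continuous fun p : X × Y => δ.cross p.1 p.2 := by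
  refine continuous_iff_continuousAt.2 fun p => ?_
  rw [ContinuousAt, tendsto_iff_dist_tendsto_zero]
  have h : Tendsto (fun p' : X × Y => dist p'.1 p.1 + dist p'.2 p.2) (𝓝 p) (𝓝 0) := by
    have : Continuous fun p' : X × Y => dist p'.1 p.1 + dist p'.2 p.2 := by fun_prop
    simpa using this.tendsto p
  refine squeeze_zero (fun _ => dist_nonneg) (fun p' => ?_) h
  have h1 := δ.cross_le_left p'.1 p.1 p'.2
  have h2 := δ.cross_le_right p.1 p'.2 p.2
  have h3 := δ.cross_le_left p.1 p'.1 p.2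
  have h4 := δ.cross_le_right p'.1 p.2 p'.2
  rw [dist_comm p.2] at h2
  rw [dist_comm p.1] at h3
  rw [Real.dist_eq, abs_le]
  constructor <;> linarith

theorem MetricCoupling.measurable_cross_left [MeasurableSpace X] [OpensMeasurableSpace X] (y : Y) :
    Measurable fun x => δ.cross x y :=
  (δ.continuous_cross.comp (Continuous.prodMk_left y)).measurable

theorem MetricCoupling.measurable_cross_right [MeasurableSpace Y] [OpensMeasurableSpace Y] (x : X) :
    Measurable fun y => δ.cross x y :=
  (δ.continuous_cross.comp (Continuous.prodMk_right x)).measurable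

theorem MetricCoupling.measurable_cross [MeasurableSpace X] [OpensMeasurableSpace X]
    [MeasurableSpace Y] [OpensMeasurableSpace Y] [SecondCountableTopology X]
    [SecondCountableTopology Y] : Measurable fun p : X × Y => δ.cross p.1 p.2 :=
  δ.continuous_cross.measurable

/-- The points of `X` which are not within distance `η` of the finite set `F` in `Y`. -/
def MetricCoupling.farSet (F : Finset Y) (η : ℝ) : Set X := {x | ∀ z ∈ F, η < δ.cross x z}

theorem MetricCoupling.measurableSet_farSet [MeasurableSpace X] [OpensMeasurableSpace X]
    (F : Finset Y) (η : ℝ) : MeasurableSet (δ.farSet F η) := by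
  have : δ.farSet F η = ⋂ z ∈ F, {x | η < δ.cross x z} := by
    ext x; simp [MetricCoupling.farSet]
  rw [this]
  exact Finset.measurableSet_biInter F fun z _ =>
    measurableSet_lt measurable_const (δ.measurable_cross_left z)

end MetricCoupling

/-- Measurable choice of almost minimizers. -/
theorem exists_measurable_almost_minimizer {A B : Type*} [MeasurableSpace A] [TopologicalSpace B]
    [MeasurableSpace B] [TopologicalSpace.SeparableSpace B] [Nonempty B] {f : A → B → ℝ}
    (hf0 : ∀ a b, 0 ≤ f a b) (hfm : ∀ b, Measurable fun a => f a b)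
    (hfc : ∀ a, Continuous (f a)) {ε : ℝ} (hε : 0 < ε) :
    ∃ T : A → B, Measurable T ∧ ∀ a b, f a (T a) ≤ f a b + ε := by
  classical
  obtain ⟨u, hu⟩ := TopologicalSpace.exists_dense_seq B
  -- Choosing the least index of an almost minimiser in a dense sequence is measurable in `a`;
  -- continuity extends the inequality from the sequence to all `b`.
  have hex : ∀ a, ∃ k, ∀ j, f a (u k) ≤ f a (u j) + ε := by
    intro a
    have hbdd : BddBelow (Set.range fun j => f a (u j)) := ⟨0, by
      rintro _ ⟨j, rfl⟩; exact hf0 a _⟩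
    obtain ⟨k, hk⟩ := exists_lt_of_ciInf_lt (show ⨅ j, f a (u j) < (⨅ j, f a (u j)) + ε by linarith)
    exact ⟨k, fun j => by linarith [ciInf_le hbdd j]⟩
  refine ⟨fun a => u (Nat.find (hex a)), ?_, fun a b => ?_⟩
  · have h1 : Measurable fun a => Nat.find (hex a) := by
      refine measurable_find hex fun k => ?_
      have : {a | ∀ j, f a (u k) ≤ f a (u j) + ε} = ⋂ j, {a | f a (u k) ≤ f a (u j) + ε} := by
        ext; simp
      rw [this]
      exact MeasurableSet.iInter fun j =>
        measurableSet_le (hfm _) ((hfm _).add_const _)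
    exact (measurable_of_countable u).comp h1
  · have hcl : IsClosed {b | f a (u (Nat.find (hex a))) ≤ f a b + ε} :=
      isClosed_le continuous_const ((hfc a).add continuous_const)
    have : closure (Set.range u) ⊆ {b | f a (u (Nat.find (hex a))) ≤ f a b + ε} := by
      refine hcl.closure_subset_iff.2 ?_
      rintro _ ⟨j, rfl⟩
      exact Nat.find_spec (hex a) j
    exact this (hu b)

/-! ### Asymptotic tightness -/

theorem exists_finset_measure_far_le {Y : Type*} [MetricSpace Y] [CompleteSpace Y]
    [SecondCountableTopology Y] [MeasurableSpace Y] [BorelSpace Y] (ρ : Measure Y)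
    [IsFiniteMeasure ρ] {ε : ℝ≥0∞} (hε : 0 < ε) {η : ℝ} (hη : 0 < η) :
    ∃ F : Finset Y, ρ {y | ∀ z ∈ F, η < dist y z} ≤ ε := by
  obtain ⟨K, hK, hKρ⟩ := isTightMeasureSet_iff_exists_isCompact_measure_compl_le.1
    (isTightMeasureSet_singleton (μ := ρ)) ε hε
  obtain ⟨t, -, htf, htK⟩ := hK.finite_cover_balls hη
  refine ⟨htf.toFinset, (measure_mono fun y hy hyK => ?_).trans (hKρ ρ rfl)⟩
  obtain ⟨z, hz, hyz⟩ := Set.mem_iUnion₂.1 (htK hyK)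
  exact (hy z (htf.mem_toFinset.2 hz)).not_gt (Metric.mem_ball.1 hyz)

/-- Finitely many initial indices are harmless since each single measure is tight. Intersecting
neighbourhoods of finite sets over the scales `1/(k+1)`, with summable exceptional masses, gives a
closed totally bounded set, hence a compact one. -/
theorem isTightMeasureSet_range_of_eventually {Y : Type*} [MetricSpace Y] [CompleteSpace Y]
    [SecondCountableTopology Y] [MeasurableSpace Y] [BorelSpace Y] (ρ : ℕ → Measure Y)
    [∀ n, IsFiniteMeasure (ρ n)]
    (h : ∀ ε : ℝ≥0∞, 0 < ε → ∀ η : ℝ, 0 < η →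
      ∃ F : Finset Y, ∀ᶠ n in atTop, ρ n {y | ∀ z ∈ F, η < dist y z} ≤ ε) :
    IsTightMeasureSet (Set.range ρ) := by
  classical
  have hall : ∀ ε : ℝ≥0∞, 0 < ε → ∀ η : ℝ, 0 < η →
      ∃ F : Finset Y, ∀ n, ρ n {y | ∀ z ∈ F, η < dist y z} ≤ ε := by
    intro ε hε η hη
    obtain ⟨F, hF⟩ := h ε hε η hη
    obtain ⟨N, hN⟩ := eventually_atTop.1 hF
    choose G hG using fun n => exists_finset_measure_far_le (ρ n) hε hη
    refine ⟨F ∪ (Finset.range N).biUnion G, fun n => ?_⟩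
    rcases le_or_gt N n with hn | hn
    · refine le_trans (measure_mono ?_) (hN n hn)
      exact fun y hy z hz => hy z (Finset.mem_union_left _ hz)
    · refine le_trans (measure_mono ?_) (hG n)
      exact fun y hy z hz => hy z (Finset.mem_union_right _
        (Finset.mem_biUnion.2 ⟨n, Finset.mem_range.2 hn, hz⟩))
  rw [isTightMeasureSet_iff_exists_isCompact_measure_compl_le]
  intro ε hε
  obtain ⟨ε', hε'0, hε'⟩ := ENNReal.exists_pos_sum_of_countable' hε.ne' ℕ
  choose F hF using fun k : ℕ => hall (ε' k) (hε'0 k) (1 / ((k : ℝ) + 1)) (by positivity)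
  let C : ℕ → Set Y := fun k => ⋃ z ∈ F k, Metric.closedBall z (1 / ((k : ℝ) + 1))
  have hcl : IsClosed (⋂ k, C k) := isClosed_iInter fun k =>
    (F k).finite_toSet.isClosed_biUnion fun z _ => Metric.isClosed_closedBall
  refine ⟨⋂ k, C k, ?_, ?_⟩
  · refine TotallyBounded.isCompact_of_isClosed ?_ hcl
    refine Metric.totallyBounded_iff.2 fun s hs => ?_
    obtain ⟨k, hk⟩ := exists_nat_one_div_lt hs
    refine ⟨F k, (F k).finite_toSet, fun y hy => ?_⟩
    obtain ⟨z, hz, hyz⟩ := Set.mem_iUnion₂.1 (Set.mem_iInter.1 hy k)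
    exact Set.mem_iUnion₂.2 ⟨z, hz, (Metric.mem_closedBall.1 hyz).trans_lt hk⟩
  · rintro _ ⟨n, rfl⟩
    rw [Set.compl_iInter]
    refine (measure_iUnion_le _).trans (le_trans (ENNReal.tsum_le_tsum fun k => ?_) hε'.le)
    refine (measure_mono fun y hy z hz => ?_).trans (hF k n)
    by_contra hcon
    exact hy (Set.mem_iUnion₂.2 ⟨z, hz, not_lt.1 hcon⟩)

section AsympTight

variable {X : ℕ → Type*} [∀ n, MetricSpace (X n)] [∀ n, MeasurableSpace (X n)]
  {Y : Type*} [MetricSpace Y]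

/-- Measures on the spaces `X n` which are, up to small mass and small distance and for large `n`,
carried by a finite subset of `Y`. -/
def AsympTight (δ : ∀ n, MetricCoupling (X n) Y) (α : ∀ n, Measure (X n)) : Prop :=
  ∀ ε : ℝ≥0∞, 0 < ε → ∀ η : ℝ, 0 < η →
    ∃ F : Finset Y, ∀ᶠ n in atTop, α n ((δ n).farSet F η) ≤ ε

variable [CompleteSpace Y] [SecondCountableTopology Y] [MeasurableSpace Y] [BorelSpace Y]
  {δ : ∀ n, MetricCoupling (X n) Y}

/-- A point near some element of `F` is at least almost as near to its image under `T n`. So outside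
`farSet` the error is small and the image lies near `F`. -/
theorem AsympTight.tightThrough {α : ∀ n, Measure (X n)} [∀ n, IsProbabilityMeasure (α n)]
    (h : AsympTight δ α) {U : Filter ℕ} (hU : U ≤ atTop) {T : ∀ n, X n → Y}
    (hT : ∀ n, Measurable (T n))
    (hTδ : ∀ n x y, (δ n).cross x (T n x) ≤ (δ n).cross x y + 1 / ((n : ℝ) + 1)) :
    TightThrough U T (fun n x => (δ n).cross x (T n x)) α := by
  have hsmall : ∀ η : ℝ, 0 < η → ∀ᶠ n : ℕ in atTop, 1 / ((n : ℝ) + 1) < η := fun η hη =>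
    tendsto_one_div_add_atTop_nhds_zero_nat.eventually_lt_const hη
  refine ⟨?_, fun η hη => ?_⟩
  · have : ∀ n, IsProbabilityMeasure ((α n).map (T n)) := fun n =>
      Measure.isProbabilityMeasure_map (hT n).aemeasurable
    refine isTightMeasureSet_range_of_eventually _ fun ε hε η hη => ?_
    obtain ⟨F, hF⟩ := h ε hε (η / 3) (by positivity)
    refine ⟨F, ?_⟩
    filter_upwards [hF, hsmall (η / 3) (by positivity)] with n hn hn'
    have hms : MeasurableSet {y : Y | ∀ z ∈ F, η < dist y z} := by
      have : {y : Y | ∀ z ∈ F, η < dist y z} = ⋂ z ∈ F, {y | η < dist y z} := by ext; simp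
      rw [this]
      exact Finset.measurableSet_biInter F fun z _ =>
        measurableSet_lt measurable_const (by fun_prop)
    rw [Measure.map_apply (hT n) hms]
    refine (measure_mono fun x hx z hz => ?_).trans hn
    have h1 : η < dist (T n x) z := hx z hz
    have h2 := (δ n).dist_right_le x (T n x) z
    have h3 := hTδ n x z
    linarith
  · refine ENNReal.tendsto_nhds_zero.2 fun ε hε => ?_
    obtain ⟨F, hF⟩ := h ε hε (η / 2) (by positivity)
    refine hU ?_
    filter_upwards [hF, hsmall (η / 2) (by positivity)] with n hn hn'
    refine (measure_mono fun x hx z hz => ?_).trans hn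
    have h1 : η < (δ n).cross x (T n x) := hx
    have h3 := hTδ n x z
    linarith

/-- A finite set adapted to `ρ` at scale `η / 2` works for `α n` at scale `η`, as the plans rarely
move points by more than `η / 2`. It serves for the reference measures with `c = 1` and for recovery
sequences with `c = 2`. -/
theorem asympTight_of_couplings [∀ n, BorelSpace (X n)] [∀ n, SecondCountableTopology (X n)]
    {p : ∀ n, Measure (X n × Y)}
    {α : ∀ n, Measure (X n)} (hα : ∀ n, (p n).map Prod.fst = α n) {ρ : Measure Y}
    [IsFiniteMeasure ρ] {c : ℝ≥0∞} (hc : c ≠ ⊤) (hρ : ∀ᶠ n in atTop, (p n).map Prod.snd ≤ c • ρ)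
    (hp : ∀ η : ℝ, 0 < η → Tendsto (fun n => p n {ω | η < (δ n).cross ω.1 ω.2}) atTop (𝓝 0)) :
    AsympTight δ α := by
  intro ε hε η hη
  have hε' : 0 < ε / 2 := ENNReal.half_pos hε.ne'
  have hcε : 0 < ε / 2 / c := ENNReal.div_pos hε'.ne' hc
  obtain ⟨F, hF⟩ := exists_finset_measure_far_le ρ hcε (half_pos hη)
  refine ⟨F, ?_⟩
  have hms : MeasurableSet {y : Y | ∀ z ∈ F, η / 2 < dist y z} := by
    have : {y : Y | ∀ z ∈ F, η / 2 < dist y z} = ⋂ z ∈ F, {y | η / 2 < dist y z} := by ext; simp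
    rw [this]
    exact Finset.measurableSet_biInter F fun z _ =>
      measurableSet_lt measurable_const (by fun_prop)
  filter_upwards [hρ, (hp (η / 2) (half_pos hη)).eventually_le_const hε'] with n hn hn'
  rw [← hα n, Measure.map_apply measurable_fst ((δ n).measurableSet_farSet F η)]
  calc p n (Prod.fst ⁻¹' (δ n).farSet F η)
      ≤ p n ({ω | η / 2 < (δ n).cross ω.1 ω.2} ∪ Prod.snd ⁻¹' {y | ∀ z ∈ F, η / 2 < dist y z}) := by
        refine measure_mono fun ω hω => ?_
        by_contra hcon
        rw [Set.mem_union, not_or] at hcon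
        obtain ⟨h1, h2⟩ := hcon
        refine h2 fun z hz => ?_
        have h3 : η < (δ n).cross ω.1 z := hω z hz
        have h4 := (δ n).cross_le_right ω.1 z ω.2
        have h5 : (δ n).cross ω.1 ω.2 ≤ η / 2 := not_lt.1 h1
        linarith
    _ ≤ ε / 2 + ε / 2 := by
        refine (measure_union_le _ _).trans (add_le_add hn' ?_)
        rw [← Measure.map_apply measurable_snd hms]
        refine (hn _).trans ?_
        rw [Measure.smul_apply, smul_eq_mul]
        refine (mul_le_mul_right hF c).trans ?_
        exact ENNReal.mul_div_le
    _ = ε := ENNReal.add_halves ε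

end AsympTight

/-! ### Propagation of tightness along geodesics -/

/-- Once the middle entropy is real, neither endpoint entropy can be infinite: nonnegativity rules
out a cancelling `⊥`. The Ricci inequality can then be rearranged in `ℝ`. -/
theorem EReal_add_le_of_sub_two_mul_add_le {a c : EReal} (ha : 0 ≤ a) (hc : 0 ≤ c) {b k : ℝ}
    (h : a - 2 * (b : EReal) + c ≤ (k : EReal)) :
    ∃ a' c' : ℝ, a = a' ∧ c = c' ∧ a' + c' ≤ k + 2 * b := by
  have h2 : (2 : EReal) * (b : EReal) = ((2 * b : ℝ) : EReal) := by
    rw [EReal.coe_mul]; rfl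
  rw [h2] at h
  have ha' : a ≠ ⊥ := fun h => by rw [h] at ha; simp at ha
  have hc' : c ≠ ⊥ := fun h => by rw [h] at hc; simp at hc
  have hat : a ≠ ⊤ := by
    rintro rfl
    rw [EReal.top_sub_coe, EReal.top_add_of_ne_bot hc'] at h
    simp at h
  lift a to ℝ using ⟨hat, ha'⟩
  have hct : c ≠ ⊤ := by
    rintro rfl
    rw [← EReal.coe_sub, EReal.coe_add_top] at h
    simp at h
  lift c to ℝ using ⟨hct, hc'⟩
  refine ⟨a, c, rfl, rfl, ?_⟩
  rw [← EReal.coe_sub, ← EReal.coe_add, EReal.coe_le_coe_iff] at h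
  linarith

theorem EReal_mul_sq_le {a : EReal} {k r : ℝ} (ha : a ≤ (k : EReal)) (hk : 0 ≤ k) (hr0 : 0 ≤ r)
    (hr1 : r ≤ 1) : a * ((r ^ 2 : ℝ) : EReal) ≤ (k : EReal) := by
  have h0 : (0 : EReal) ≤ ((r ^ 2 : ℝ) : EReal) := by exact_mod_cast sq_nonneg r
  refine (mul_le_mul_of_nonneg_right ha h0).trans ?_
  rw [← EReal.coe_mul, EReal.coe_le_coe_iff]
  exact mul_le_of_le_one_right hk (pow_le_one₀ hr0 hr1)

theorem entropy_cond_le {X : Type*} [MeasurableSpace X] (m : Measure X) [IsProbabilityMeasure m]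
    {A : Set X} (hA : MeasurableSet A) (hmA : m A ≠ 0) :
    entropy m (ProbabilityTheory.cond m A) ≤ ((-Real.log (m.real A) : ℝ) : EReal) := by
  have : IsProbabilityMeasure (ProbabilityTheory.cond m A) :=
    ProbabilityTheory.cond_isProbabilityMeasure hmA
  have hpos : 0 < m.real A := ENNReal.toReal_pos hmA (by finiteness)
  have hfun : (fun x => A.indicator (fun _ => (m.real A)⁻¹) x
      * Real.log (A.indicator (fun _ => (m.real A)⁻¹) x))
      = A.indicator fun _ => (m.real A)⁻¹ * Real.log (m.real A)⁻¹ := by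
    ext x
    by_cases hx : x ∈ A <;> simp [hx]
  have h_int : ∫ x, A.indicator (fun _ => (m.real A)⁻¹) x
      * Real.log (A.indicator (fun _ => (m.real A)⁻¹) x) ∂m = -Real.log (m.real A) := by
    rw [hfun, integral_indicator_const _ hA, smul_eq_mul, ← mul_assoc,
      mul_inv_cancel₀ hpos.ne', one_mul, Real.log_inv]
  rw [← h_int]
  refine entropy_map_le (g := id) (measurable_const.indicator hA)
    (fun x => Set.indicator_nonneg (fun _ _ => by positivity) x)
    ((integrable_const _).indicator hA) ?_ ?_ measurable_id Measure.map_id ?_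
  · rw [integral_indicator_const _ hA, smul_eq_mul, mul_inv_cancel₀ hpos.ne']
  · rw [hfun]
    exact (integrable_const _).indicator hA
  · rw [Measure.map_id]
    have : (fun x => ENNReal.ofReal (A.indicator (fun _ => (m.real A)⁻¹) x))
        = A.indicator fun _ => (m A)⁻¹ := by
      ext x
      by_cases hx : x ∈ A
      · simp [hx, ENNReal.ofReal_inv_of_pos hpos, ofReal_measureReal]
      · simp [hx]
    rw [this, withDensity_indicator hA, withDensity_const]
    rfl

/-! ### One short step under the Ricci bound -/

section Step

variable {X Y : Type*} [MetricSpace X] [SecondCountableTopology X]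
  [MeasurableSpace X] [BorelSpace X] [MetricSpace Y]

/-- Chebyshev's inequality for the second moment at `y`. -/
theorem measure_dist_gt_le_of_W₂_dirac_le {μ : Measure X} [IsProbabilityMeasure μ] {y : X} {R : ℝ}
    (hR : 0 < R) (h : W₂ μ (Measure.dirac y) ≤ ENNReal.ofReal R) :
    μ.real {w | 2 * R < dist w y} ≤ 1 / 4 := by
  have h1 : ENNReal.ofReal ((2 * R) ^ 2) * μ {w | 2 * R < dist w y} ≤ ENNReal.ofReal (R ^ 2) := by
    refine le_trans ?_ (a := _) (b := ∫⁻ z, edist z y ^ 2 ∂μ) ?_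
    · refine le_trans ?_ (mul_meas_ge_le_lintegral (by fun_prop) (ENNReal.ofReal ((2 * R) ^ 2)))
      refine mul_le_mul_right (measure_mono fun w hw => ?_) _
      have hw' : 2 * R < dist w y := hw
      change ENNReal.ofReal ((2 * R) ^ 2) ≤ edist w y ^ 2
      rw [edist_dist, ← ENNReal.ofReal_pow dist_nonneg]
      exact ENNReal.ofReal_le_ofReal (by gcongr)
    · rw [← W₂_dirac_sq, ENNReal.ofReal_pow hR.le]
      exact pow_le_pow_left₀ bot_le h 2
  have h2 := ENNReal.toReal_mono (by finiteness) h1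
  rw [ENNReal.toReal_mul, ENNReal.toReal_ofReal (by positivity),
    ENNReal.toReal_ofReal (by positivity)] at h2
  change (2 * R) ^ 2 * μ.real {w | 2 * R < dist w y} ≤ R ^ 2 at h2
  have : 0 < R ^ 2 := by positivity
  nlinarith

/-- A space with a robust upper Ricci bound cannot leave the region of noticeable mass in one short
step. -/
theorem exists_near_of_robust {m : Measure X} [IsProbabilityMeasure m] {K : ℝ} {Kbar : ℝ → EReal}
    (hRic : HasRobustUpperRicciBoundWith m K Kbar) (δ : MetricCoupling X Y) {h ρ c k t : ℝ}
    (hh : 0 < h) (hh1 : h ≤ 1 / 18) (hk : 0 ≤ k)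
    (hK : ∀ r : ℝ, 0 < r → r ≤ 2 * h → Kbar r ≤ (k : EReal)) (hρ0 : 0 < ρ) (hρ : 2 * ρ < h ^ 8)
    (hc : 0 < c) {z : Y} (hz : c ≤ m.real {x | δ.cross x z < ρ})
    (ht : 4 * (k - 2 * Real.log c + Real.log 2) < t) {A : Set X} (hA : MeasurableSet A)
    (hmA : m.real A ≤ Real.exp (-t)) {x y : X} (hx : δ.cross x z ≤ 9 * h ^ 2) (hxy : dist x y ≤ h) :
    δ.cross y z ≤ 9 * h ^ 2 ∨ ∃ w ∉ A, dist w y ≤ 8 * h ^ 2 := by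
  set B : Set X := {x | δ.cross x z < ρ} with hB
  have hBm : MeasurableSet B := measurableSet_lt (δ.measurable_cross_left z) measurable_const
  have hmB : m B ≠ 0 := fun h0 => by
    rw [measureReal_def, h0, ENNReal.toReal_zero] at hz
    linarith
  obtain ⟨x', hx'⟩ := nonempty_of_measure_ne_zero hmB
  have hx'ρ : δ.cross x' z < ρ := hx'
  have hh8 : h ^ 8 ≤ h ^ 2 := pow_le_pow_of_le_one hh.le (by linarith) (by norm_num)
  -- The bound `h ≤ 1 / 18` makes the error `9 * h ^ 2` at most half a step, which yields `r ≤ 2 *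
  -- h`.
  have hh2 : 18 * h ^ 2 ≤ h := by nlinarith
  have hh20 : 0 < h ^ 2 := by positivity
  set r := dist x' y with hr
  have hr2 : r ≤ 2 * h := by
    have := dist_triangle x' x y
    have := δ.dist_left_le x' x z
    linarith
  -- If `x'` is already this close to `y`, then `z` itself is near `y`. Otherwise `r ≥ h ^ 2`, so `2
  -- * ρ < h ^ 8 ≤ r ^ 4` and the normalised restriction to `B` is an admissible initial measure.
  by_cases hrs : r < h ^ 2
  · left
    have := δ.cross_le_left y x' z
    rw [dist_comm] at this
    linarith
  right
  push Not at hrs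
  have hr0 : 0 < r := hh20.trans_le hrs
  have hprob : IsProbabilityMeasure (ProbabilityTheory.cond m B) :=
    ProbabilityTheory.cond_isProbabilityMeasure hmB
  have hW : W₂ (ProbabilityTheory.cond m B) (Measure.dirac x') < ENNReal.ofReal (r ^ 4) := by
    have h1 : W₂ (ProbabilityTheory.cond m B) (Measure.dirac x') ≤ ENNReal.ofReal (2 * ρ) := by
      rw [← sq_le_sq_ennreal, W₂_dirac_sq]
      calc ∫⁻ w, edist w x' ^ 2 ∂(ProbabilityTheory.cond m B)
          ≤ ∫⁻ _, ENNReal.ofReal (2 * ρ) ^ 2 ∂(ProbabilityTheory.cond m B) := by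
            refine lintegral_mono_ae ?_
            filter_upwards [ProbabilityTheory.ae_cond_mem (μ := m) hBm] with w hw
            have hwρ : δ.cross w z < ρ := hw
            have := δ.dist_left_le w x' z
            rw [edist_dist]
            gcongr
            linarith
        _ = ENNReal.ofReal (2 * ρ) ^ 2 := by simp
    refine h1.trans_lt ((ENNReal.ofReal_lt_ofReal_iff (by positivity)).2 ?_)
    calc 2 * ρ < h ^ 8 := hρ
      _ = (h ^ 2) ^ 4 := by ring
      _ ≤ r ^ 4 := by gcongr
  obtain ⟨μ, -, hμ0, hμ1, hS⟩ := hRic.2 r hr0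
    ((hK r hr0 hr2).trans_lt (EReal.coe_lt_top k)) x' y rfl
    ⟨ProbabilityTheory.cond m B, hprob⟩ hW
  have hS0 : entropy m (μ 0) ≤ ((-Real.log c : ℝ) : EReal) := by
    rw [hμ0]
    refine (entropy_cond_le m hBm hmB).trans ?_
    rw [EReal.coe_le_coe_iff]
    exact neg_le_neg (Real.log_le_log hc hz)
  have hS0' : ∃ s : ℝ, entropy m (μ 0) = s ∧ s ≤ -Real.log c := by
    have hnt : entropy m (μ 0 : Measure X) ≠ ⊤ := (hS0.trans_lt (EReal.coe_lt_top _)).ne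
    have hnb : entropy m (μ 0 : Measure X) ≠ ⊥ := fun hb => by
      have := entropy_nonneg (m := m) (μ := (μ 0 : Measure X))
      rw [hb] at this; simp at this
    refine ⟨_, (EReal.coe_toReal hnt hnb).symm, ?_⟩
    rwa [← EReal.coe_le_coe_iff, EReal.coe_toReal hnt hnb]
  obtain ⟨s, hs, hsc⟩ := hS0'
  rw [hs] at hS
  obtain ⟨s₁, s₂, e1, e2, hss⟩ := EReal_add_le_of_sub_two_mul_add_le entropy_nonneg entropy_nonneg
    (hS.trans (EReal_mul_sq_le (hK r hr0 hr2) hk hr0.le (by linarith)))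
  have hs2 : 0 ≤ s₂ := by
    have := entropy_nonneg (m := m) (μ := (μ (-1) : Measure X))
    rw [e2] at this
    exact_mod_cast this
  have hlog := Real.log_le_log hc (hz.trans measureReal_le_one)
  rw [Real.log_one] at hlog
  have ht0 : 0 < t := by
    have := Real.log_nonneg (by norm_num : (1 : ℝ) ≤ 2)
    linarith
  -- The entropy at time `-1` is nonnegative and may be dropped from the Ricci inequality.
  have hE : entropy m (μ 1) ≤ ((k - 2 * Real.log c : ℝ) : EReal) := by
    rw [e1, EReal.coe_le_coe_iff]; linarith
  have hμA := mul_measureReal_le_of_entropy_le hE ht0.le hA hmA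
  have hμA' : (μ 1 : Measure X).real A < 1 / 4 := by
    by_contra hcon
    push Not at hcon
    have := mul_le_mul_of_nonneg_left hcon ht0.le
    linarith
  have hμd := measure_dist_gt_le_of_W₂_dirac_le (by positivity : 0 < r ^ 2) hμ1
  by_contra hcon
  push Not at hcon
  -- Were every point outside `A` further than `8 * h ^ 2 ≥ 2 * r ^ 2` from `y`, two sets of `μ
  -- 1`-mass at most `1 / 4` would cover the space.
  have huniv : (Set.univ : Set X) ⊆ A ∪ {w | 2 * r ^ 2 < dist w y} := by
    intro w _
    by_cases hw : w ∈ A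
    · exact Or.inl hw
    · refine Or.inr ?_
      have h1 := hcon w hw
      have h2 : r ^ 2 ≤ (2 * h) ^ 2 := by gcongr
      change 2 * r ^ 2 < dist w y
      nlinarith
  have h3 := measureReal_mono (μ := (μ 1 : Measure X)) huniv
  have h4 := measureReal_union_le (μ := (μ 1 : Measure X)) A {w | 2 * r ^ 2 < dist w y}
  rw [probReal_univ] at h3
  linarith

end Step

/-- In a coupling of cost below `s ^ 2` only mass `s ^ 2 / h ^ 2` moves further than `h`; all other
mass obeys `hstep`. -/
theorem MetricCoupling.measure_farSet_le {X Y : Type*} [MetricSpace X] [SecondCountableTopology X]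
    [MeasurableSpace X] [BorelSpace X] [MetricSpace Y] (δ : MetricCoupling X Y) {F F' : Finset Y}
    {h η s : ℝ} (hh : 0 < h)
    (hstep : ∀ x y : X, x ∉ δ.farSet F η → dist x y ≤ h → y ∉ δ.farSet F' η)
    {α β : Measure X} (hW : W₂ α β ^ 2 < ENNReal.ofReal (s ^ 2)) :
    β (δ.farSet F' η) ≤ α (δ.farSet F η) + ENNReal.ofReal (s ^ 2 / h ^ 2) := by
  obtain ⟨q, hq, hqc⟩ := exists_coupling_lt hW
  have hC : q {p | h < dist p.1 p.2} ≤ ENNReal.ofReal (s ^ 2 / h ^ 2) := by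
    rw [ENNReal.ofReal_div_of_pos (by positivity),
      ENNReal.le_div_iff_mul_le (by left; simp [hh.ne']) (by left; simp), mul_comm]
    refine le_trans ?_ hqc.le
    refine le_trans ?_ (mul_meas_ge_le_lintegral measurable_edist_sq (ENNReal.ofReal (h ^ 2)))
    refine mul_le_mul_right (measure_mono fun p hp => ?_) _
    have hp' : h < dist p.1 p.2 := hp
    change ENNReal.ofReal (h ^ 2) ≤ edist p.1 p.2 ^ 2
    rw [edist_dist, ← ENNReal.ofReal_pow dist_nonneg]
    exact ENNReal.ofReal_le_ofReal (by gcongr)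
  have h1 := Measure.map_apply (μ := q) measurable_fst (δ.measurableSet_farSet F η)
  have h2 := Measure.map_apply (μ := q) measurable_snd (δ.measurableSet_farSet F' η)
  rw [hq.1] at h1
  rw [hq.2] at h2
  rw [h1, h2]
  refine le_trans (measure_mono ?_) ((measure_union_le _ _).trans (add_le_add le_rfl hC))
  intro p hp
  by_contra hcon
  rw [Set.mem_union, not_or] at hcon
  exact hstep p.1 p.2 hcon.1 (not_lt.1 hcon.2) hp

/-! ### Chains of short steps -/

section Propagation

variable {X : ℕ → Type*} [∀ n, MetricSpace (X n)] [∀ n, MeasurableSpace (X n)]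
  [∀ n, BorelSpace (X n)] {Y : Type*} [MetricSpace Y] {δ : ∀ n, MetricCoupling (X n) Y}

/-- The finite set changes from step to step but the radius `η` does not. It depends on `F` and the
number of steps only, so one threshold for `n` serves all chains of measures. -/
theorem exists_eventually_measure_farSet_chain_le
    [∀ n, SecondCountableTopology (X n)] {h η s : ℝ} (hh : 0 < h)
    (hstep : ∀ F : Finset Y, ∃ F' : Finset Y, ∀ᶠ n in atTop, ∀ x y : X n,
      x ∉ (δ n).farSet F η → dist x y ≤ h → y ∉ (δ n).farSet F' η) (F : Finset Y) (k : ℕ) :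
    ∃ F' : Finset Y, ∀ᶠ n in atTop, ∀ μ : ℕ → Measure (X n),
      (∀ j < k, W₂ (μ j) (μ (j + 1)) ^ 2 < ENNReal.ofReal (s ^ 2)) →
      μ k ((δ n).farSet F' η) ≤ μ 0 ((δ n).farSet F η) + k * ENNReal.ofReal (s ^ 2 / h ^ 2) := by
  induction k with
  | zero => exact ⟨F, Eventually.of_forall fun n μ _ => by simp⟩
  | succ k ih =>
    obtain ⟨F₁, hF₁⟩ := ih
    obtain ⟨F₂, hF₂⟩ := hstep F₁
    refine ⟨F₂, ?_⟩
    filter_upwards [hF₁, hF₂] with n h1 h2 μ hμ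
    refine ((δ n).measure_farSet_le hh h2 (hμ k (Nat.lt_succ_self k))).trans ?_
    rw [Nat.cast_succ, add_mul, one_mul, ← add_assoc]
    exact add_le_add (h1 μ fun j hj => hμ j (hj.trans (Nat.lt_succ_self k))) le_rfl

variable [MeasurableSpace Y] [BorelSpace Y] {m : ∀ n, Measure (X n)}
  [∀ n, IsProbabilityMeasure (m n)] {mY : Measure Y} [IsProbabilityMeasure mY]
  {q : ∀ n, Measure (X n × Y)}

/-- A ball at `z` has positive mass by full support, and `q n` eventually carries at least half of
it to points within `ρ` of `z`. These are the sets on which the reference measures are conditioned.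
-/
theorem exists_eventually_le_measureReal_cross_lt
    (hsupp : ∀ V : Set Y, IsOpen V → V.Nonempty → 0 < mY V)
    (hq : ∀ n, q n ∈ couplings (m n) mY)
    (hqδ : ∀ η : ℝ, 0 < η → Tendsto (fun n => q n {ω | η < (δ n).cross ω.1 ω.2}) atTop (𝓝 0))
    (z : Y) {ρ : ℝ} (hρ : 0 < ρ) :
    ∃ c : ℝ, 0 < c ∧ ∀ᶠ n in atTop, c ≤ (m n).real {x | (δ n).cross x z < ρ} := by
  set b := mY.real (Metric.ball z (ρ / 2)) with hb
  have hb0 : 0 < b := ENNReal.toReal_pos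
    (hsupp _ Metric.isOpen_ball ⟨z, Metric.mem_ball_self (by positivity)⟩).ne' (by finiteness)
  refine ⟨b / 2, by positivity, ?_⟩
  filter_upwards [(hqδ (ρ / 4) (by positivity)).eventually_le_const
    (ENNReal.ofReal_pos.2 (half_pos hb0))] with n hn
  have := isProbabilityMeasure_of_mem_couplings (hq n)
  have h1 : b = (q n).real (Prod.snd ⁻¹' Metric.ball z (ρ / 2)) := by
    rw [hb, ← (hq n).2, map_measureReal_apply measurable_snd Metric.isOpen_ball.measurableSet]
  have h2 : (m n).real {x | (δ n).cross x z < ρ}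
      = (q n).real (Prod.fst ⁻¹' {x | (δ n).cross x z < ρ}) := by
    rw [← map_measureReal_apply measurable_fst
      (measurableSet_lt ((δ n).measurable_cross_left z) measurable_const), (hq n).1]
  have h3 : (q n).real {ω | ρ / 4 < (δ n).cross ω.1 ω.2} ≤ b / 2 :=
    ENNReal.toReal_le_of_le_ofReal (by positivity) hn
  have h4 : (q n).real (Prod.snd ⁻¹' Metric.ball z (ρ / 2))
      ≤ (q n).real ({ω | ρ / 4 < (δ n).cross ω.1 ω.2}
        ∪ Prod.fst ⁻¹' {x | (δ n).cross x z < ρ}) := by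
    refine measureReal_mono fun ω hω => ?_
    by_contra hcon
    rw [Set.mem_union, not_or] at hcon
    obtain ⟨h5, h6⟩ := hcon
    have h5' : (δ n).cross ω.1 ω.2 ≤ ρ / 4 := not_lt.1 h5
    have h6' : ρ ≤ (δ n).cross ω.1 z := not_lt.1 h6
    have h7 := (δ n).cross_le_right ω.1 z ω.2
    have h8 : dist ω.2 z < ρ / 2 := hω
    linarith
  have h9 := measureReal_union_le (μ := q n) {ω | ρ / 4 < (δ n).cross ω.1 ω.2}
    (Prod.fst ⁻¹' {x | (δ n).cross x z < ρ})
  rw [h2]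
  linarith

variable [∀ n, SecondCountableTopology (X n)] [CompleteSpace Y] [SecondCountableTopology Y]

/-- Let `t` be large enough for all of the finitely many `z ∈ F`, and let `F'` approximate `m n` at
scale `h ^ 2` up to mass `exp (-t)`. A short step starting near `F` either stays near `F` or ends
within `8 * h ^ 2` of a point within `h ^ 2` of `F'`. The total radius is `9 * h ^ 2` again, so
steps can be iterated without loss. -/
theorem exists_eventually_notMem_farSet (hsupp : ∀ V : Set Y, IsOpen V → V.Nonempty → 0 < mY V)
    (hq : ∀ n, q n ∈ couplings (m n) mY)
    (hqδ : ∀ η : ℝ, 0 < η → Tendsto (fun n => q n {ω | η < (δ n).cross ω.1 ω.2}) atTop (𝓝 0))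
    {K : ℝ} {Kbar : ℝ → EReal} (hRic : ∀ n, HasRobustUpperRicciBoundWith (m n) K Kbar) :
    ∃ h₀ : ℝ, 0 < h₀ ∧ ∀ h : ℝ, 0 < h → h ≤ h₀ → ∀ F : Finset Y, ∃ F' : Finset Y,
      ∀ᶠ n in atTop, ∀ x y : X n, x ∉ (δ n).farSet F (9 * h ^ 2) → dist x y ≤ h →
        y ∉ (δ n).farSet F' (9 * h ^ 2) := by
  classical
  set k := |K| + 1 with hk
  have hk0 : 0 ≤ k := by positivity
  have hev : ∀ᶠ r in 𝓝[>] (0 : ℝ), Kbar r < (k : EReal) :=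
    (hRic 0).1.tendsto.eventually_lt_const (by
      rw [EReal.coe_lt_coe_iff]
      linarith [le_abs_self K])
  obtain ⟨r₀, hr₀, hr₀'⟩ := mem_nhdsGT_iff_exists_Ioc_subset.1 hev
  refine ⟨min (1 / 18) (r₀ / 2), lt_min (by norm_num) (half_pos hr₀), fun h hh hhle F => ?_⟩
  have hh1 : h ≤ 1 / 18 := hhle.trans (min_le_left _ _)
  have hh2 : h ≤ r₀ / 2 := hhle.trans (min_le_right _ _)
  have hK : ∀ r : ℝ, 0 < r → r ≤ 2 * h → Kbar r ≤ (k : EReal) := fun r hr hr' =>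
    (hr₀' ⟨hr, by linarith⟩ : Kbar r < k).le
  set ρ := h ^ 8 / 4 with hρ
  have hρ0 : 0 < ρ := by positivity
  choose c hc0 hc using fun z => exists_eventually_le_measureReal_cross_lt hsupp hq hqδ z hρ0
  set t := 1 + ∑ z ∈ F, |4 * (k - 2 * Real.log (c z) + Real.log 2)| with ht
  have htz : ∀ z ∈ F, 4 * (k - 2 * Real.log (c z) + Real.log 2) < t := by
    intro z hz
    have := Finset.single_le_sum (f := fun z => |4 * (k - 2 * Real.log (c z) + Real.log 2)|)
      (fun _ _ => abs_nonneg _) hz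
    have h2 := le_abs_self (4 * (k - 2 * Real.log (c z) + Real.log 2))
    linarith
  have htight : AsympTight δ m := asympTight_of_couplings (fun n => (hq n).1) (ρ := mY)
    ENNReal.one_ne_top (Eventually.of_forall fun n => by rw [(hq n).2, one_smul]) hqδ
  obtain ⟨F', hF'⟩ := htight (ENNReal.ofReal (Real.exp (-t)))
    (ENNReal.ofReal_pos.2 (Real.exp_pos _)) (h ^ 2) (by positivity)
  refine ⟨F ∪ F', ?_⟩
  filter_upwards [hF', (Finset.eventually_all F).2 fun z _ => hc z] with n hn hcn x y hx hxy hy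
  have hx' : ∃ z ∈ F, (δ n).cross x z ≤ 9 * h ^ 2 := by
    by_contra hcon
    push Not at hcon
    exact hx hcon
  obtain ⟨z, hz, hxz⟩ := hx'
  have hρ2 : 2 * ρ < h ^ 8 := by
    have : 0 < h ^ 8 := by positivity
    linarith
  rcases exists_near_of_robust (hRic n) (δ n) hh hh1 hk0 hK hρ0 hρ2 (hc0 z) (hcn z hz) (htz z hz)
    ((δ n).measurableSet_farSet F' (h ^ 2))
    (ENNReal.toReal_le_of_le_ofReal (Real.exp_pos _).le hn) hxz hxy with hyz | ⟨w, hw, hwy⟩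
  · exact (hy z (Finset.mem_union_left _ hz)).not_ge hyz
  · have hw' : ∃ z' ∈ F', (δ n).cross w z' ≤ h ^ 2 := by
      by_contra hcon
      push Not at hcon
      exact hw hcon
    obtain ⟨z', hz', hwz'⟩ := hw'
    refine (hy z' (Finset.mem_union_right _ hz')).not_ge ?_
    have := (δ n).cross_le_left y w z'
    rw [dist_comm] at this
    linarith

/-- Asymptotic tightness propagates along Wasserstein geodesics of bounded length. -/
theorem AsympTight.of_geodesic (hsupp : ∀ V : Set Y, IsOpen V → V.Nonempty → 0 < mY V)
    (hq : ∀ n, q n ∈ couplings (m n) mY)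
    (hqδ : ∀ η : ℝ, 0 < η → Tendsto (fun n => q n {ω | η < (δ n).cross ω.1 ω.2}) atTop (𝓝 0))
    {K : ℝ} {Kbar : ℝ → EReal} (hRic : ∀ n, HasRobustUpperRicciBoundWith (m n) K Kbar)
    {μ : ∀ n, ℝ → ProbabilityMeasure (X n)} (hμ : ∀ n, IsW₂Geodesic (μ n)) {C : ℝ} (hC : 0 ≤ C)
    (hμC : ∀ᶠ n in atTop, W₂ (μ n (-1) : Measure (X n)) (μ n 1) ≤ ENNReal.ofReal C)
    (h0 : AsympTight δ fun n => (μ n 0 : Measure (X n))) {a : ℝ} (ha : a ∈ Set.Icc (-1 : ℝ) 1) :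
    AsympTight δ fun n => (μ n a : Measure (X n)) := by
  intro ε hε η hη
  obtain ⟨h₀, hh₀, hstep⟩ := exists_eventually_notMem_farSet hsupp hq hqδ hRic
  obtain ⟨h, hh, hhh₀, hhη⟩ : ∃ h : ℝ, 0 < h ∧ h ≤ h₀ ∧ 9 * h ^ 2 ≤ η := by
    refine ⟨min h₀ (Real.sqrt (η / 9)), lt_min hh₀ (by positivity), min_le_left _ _, ?_⟩
    have : (min h₀ (Real.sqrt (η / 9))) ^ 2 ≤ (Real.sqrt (η / 9)) ^ 2 :=
      pow_le_pow_left₀ (le_min hh₀.le (by positivity)) (min_le_right _ _) 2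
    rw [Real.sq_sqrt (by positivity)] at this
    linarith
  have hε' : 0 < ε / 2 := ENNReal.half_pos hε.ne'
  obtain ⟨F, hF⟩ := h0 (ε / 2) hε' (9 * h ^ 2) (by positivity)
  -- the number of steps
  obtain ⟨k, hk0, hk⟩ : ∃ k : ℕ, 0 < k ∧
      (k : ℝ≥0∞) * ENNReal.ofReal (((C + 1) / k) ^ 2 / h ^ 2) ≤ ε / 2 := by
    -- Each of `k` pieces loses mass of order `k⁻²`, since the cost is quadratic; the sum is of
    -- order `1/k`. The constant `C + 1` replaces `C` to make the length bound strict.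
    have ht : Tendsto (fun k : ℕ => ENNReal.ofReal ((C + 1) ^ 2 / h ^ 2 / k)) atTop (𝓝 0) := by
      rw [← ENNReal.ofReal_zero]
      exact ENNReal.tendsto_ofReal (tendsto_const_div_atTop_nhds_zero_nat _)
    obtain ⟨k, hk, hk0⟩ := ((ht.eventually_le_const hε').and (eventually_gt_atTop 0)).exists
    refine ⟨k, hk0, le_trans (le_of_eq ?_) hk⟩
    rw [← ENNReal.ofReal_natCast, ← ENNReal.ofReal_mul (by positivity)]
    congr 1
    field_simp
  obtain ⟨F', hF'⟩ := exists_eventually_measure_farSet_chain_le (s := (C + 1) / k) hh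
    (hstep h hh hhh₀) F k
  have hkR : (0 : ℝ) < k := by exact_mod_cast hk0
  refine ⟨F', ?_⟩
  filter_upwards [hF, hF', hμC] with n h1 h2 h3
  -- The chain starts at time `0`, where tightness is given, and ends at time `a`.
  have h4 := h2 (fun j => (μ n (a * (j / k)) : Measure (X n))) (by
    intro j hj
    have hmem : ∀ i : ℕ, i ≤ k → a * ((i : ℝ) / k) ∈ Set.Icc (-1 : ℝ) 1 := by
      intro i hi
      have hi1 : (i : ℝ) / k ≤ 1 := (div_le_one hkR).2 (by exact_mod_cast hi)
      have hi0 : 0 ≤ (i : ℝ) / k := by positivity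
      exact abs_le.1 (by
        rw [abs_mul, abs_of_nonneg hi0]
        exact mul_le_one₀ (abs_le.2 ha) hi0 hi1)
    rw [(hμ n).2 _ (hmem j hj.le) _ (hmem (j + 1) hj)]
    have habs : |a * ((j : ℝ) / k) - a * (((j + 1 : ℕ) : ℝ) / k)| / 2 ≤ 1 / k := by
      have : a * ((j : ℝ) / k) - a * (((j + 1 : ℕ) : ℝ) / k) = -(a / k) := by
        push_cast; field_simp; ring
      rw [this, abs_neg, abs_div, abs_of_pos hkR]
      have h5 : |a| / k ≤ 1 / k := by
        gcongr
        exact abs_le.2 ha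
      have h6 : 0 ≤ |a| / k := by positivity
      linarith
    have hle : ENNReal.ofReal (|a * ((j : ℝ) / k) - a * (((j + 1 : ℕ) : ℝ) / k)| / 2)
        * W₂ (μ n (-1) : Measure (X n)) (μ n 1) ≤ ENNReal.ofReal (C / k) := by
      calc _ ≤ ENNReal.ofReal (1 / k) * ENNReal.ofReal C := by gcongr
        _ = ENNReal.ofReal (C / k) := by
          rw [← ENNReal.ofReal_mul (by positivity)]; congr 1; ring
    refine (pow_le_pow_left₀ bot_le hle 2).trans_lt ?_
    rw [← ENNReal.ofReal_pow (by positivity)]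
    refine (ENNReal.ofReal_lt_ofReal_iff (by positivity)).2 ?_
    gcongr
    linarith)
  have hkk : (k : ℝ) / k = 1 := div_self hkR.ne'
  simp only [Nat.cast_zero, zero_div, mul_zero, hkk, mul_one] at h4
  calc (μ n a : Measure (X n)) ((δ n).farSet F' η)
      ≤ (μ n a : Measure (X n)) ((δ n).farSet F' (9 * h ^ 2)) :=
        measure_mono fun x hx z hz => hhη.trans_lt (hx z hz)
    _ ≤ ε / 2 + ε / 2 := h4.trans (add_le_add h1 hk)
    _ = ε := ENNReal.add_halves ε

end Propagation

/-! ### Recovery sequences for the initial measure -/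

section RestrictedPlan

variable {X Y : Type*} [MeasurableSpace X] [MeasurableSpace Y] {m : Measure X}
  {mY : Measure Y} {q : Measure (X × Y)}

theorem integrable_comp_snd {f : Y → ℝ} (hq : q ∈ couplings m mY) (hf : Integrable f mY) :
    Integrable (fun ω => f ω.2) q := by
  rw [← hq.2] at hf
  exact hf.comp_measurable measurable_snd

theorem integral_comp_snd {f : Y → ℝ} (hq : q ∈ couplings m mY) (hf : Integrable f mY) :
    ∫ ω, f ω.2 ∂q = ∫ y, f y ∂mY := by
  rw [← hq.2] at hf ⊢
  exact (integral_map measurable_snd.aemeasurable hf.aestronglyMeasurable).symm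

variable [IsProbabilityMeasure m] [IsProbabilityMeasure mY] {μ₀ : Measure Y}
  [IsProbabilityMeasure μ₀]

/-- The density of `μ₀`, read on `X × Y`, has the same entropy relative to `q`. Hence a set of tiny
`q`-mass carries little of it, and restricting to `G` is almost lossless. -/
theorem mul_one_sub_setIntegral_le (hq : q ∈ couplings m mY) (hS : entropy mY μ₀ ≠ ⊤)
    {G : Set (X × Y)} (hG : MeasurableSet G) {t : ℝ} (ht : 0 ≤ t)
    (hGt : q.real Gᶜ ≤ Real.exp (-t)) :
    t * (1 - ∫ ω in G, (μ₀.rnDeriv mY ω.2).toReal ∂q)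
      ≤ ∫ y, entropyDensity mY μ₀ y ∂mY + Real.log 2 := by
  have := isProbabilityMeasure_of_mem_couplings hq
  have hac := absolutelyContinuous_of_entropy_ne_top hS
  have hu : Integrable (fun y => (μ₀.rnDeriv mY y).toReal) mY := Measure.integrable_toReal_rnDeriv
  have huq := integrable_comp_snd hq hu
  have hu1 : ∫ ω, (μ₀.rnDeriv mY ω.2).toReal ∂q = 1 := by
    rw [integral_comp_snd hq hu, integral_rnDeriv_toReal_eq_one hac]
  have hum : Measurable fun ω : X × Y => (μ₀.rnDeriv mY ω.2).toReal := by fun_prop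
  have hf := integrable_entropyDensity_of_entropy_ne_top hS
  have hle := entropy_map_le (q := q) (m := q) (g := id)
    (w := fun ω : X × Y => (μ₀.rnDeriv mY ω.2).toReal) hum
    (fun _ => ENNReal.toReal_nonneg) huq hu1 (integrable_comp_snd hq hf) measurable_id
    Measure.map_id rfl
  rw [Measure.map_id] at hle
  have h_int : ∫ ω, (μ₀.rnDeriv mY ω.2).toReal * Real.log (μ₀.rnDeriv mY ω.2).toReal ∂q
      = ∫ y, entropyDensity mY μ₀ y ∂mY := integral_comp_snd hq hf
  rw [h_int] at hle
  have : IsProbabilityMeasure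
      (q.withDensity fun ω => ENNReal.ofReal (μ₀.rnDeriv mY ω.2).toReal) := ⟨by
    rw [withDensity_apply _ .univ, setLIntegral_univ, ← ofReal_integral_eq_lintegral_ofReal huq
      (ae_of_all _ fun _ => ENNReal.toReal_nonneg), hu1, ENNReal.ofReal_one]⟩
  have hE := mul_measureReal_le_of_entropy_le hle ht hG.compl hGt
  rw [measureReal_def, withDensity_apply _ hG.compl, ← ofReal_integral_eq_lintegral_ofReal
    huq.integrableOn (ae_of_all _ fun _ => ENNReal.toReal_nonneg),
    ENNReal.toReal_ofReal (integral_nonneg fun _ => ENNReal.toReal_nonneg)] at hE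
  rwa [← hu1, ← integral_add_compl hG huq, add_sub_cancel_left]

/-- The plan has `q`-density `u(y) / Z` on `G`, where `u` is the density of `μ₀`. Projection to `X`
does not increase entropy (`entropy_map_le`), and omitting `Gᶜ` costs at most `q Gᶜ` because `u log
u ≥ -1`. -/
theorem exists_plan_of_entropy_ne_top (hq : q ∈ couplings m mY) (hS : entropy mY μ₀ ≠ ⊤)
    {G : Set (X × Y)} (hG : MeasurableSet G) {Z : ℝ} (hZ0 : 0 < Z)
    (hZ : ∫ ω in G, (μ₀.rnDeriv mY ω.2).toReal ∂q = Z) :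
    ∃ p : Measure (X × Y), IsProbabilityMeasure p ∧ p Gᶜ = 0 ∧
      p.map Prod.snd ≤ ENNReal.ofReal Z⁻¹ • μ₀ ∧
      entropy m (p.map Prod.fst)
        ≤ (((∫ y, entropyDensity mY μ₀ y ∂mY + q.real Gᶜ) / Z - Real.log Z : ℝ) : EReal) := by
  have := isProbabilityMeasure_of_mem_couplings hq
  have hac := absolutelyContinuous_of_entropy_ne_top hS
  have hu : Integrable (fun y => (μ₀.rnDeriv mY y).toReal) mY := Measure.integrable_toReal_rnDeriv
  have huq := integrable_comp_snd hq hu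
  have hum : Measurable fun ω : X × Y => (μ₀.rnDeriv mY ω.2).toReal := by fun_prop
  have hf := integrable_entropyDensity_of_entropy_ne_top hS
  have hfq := integrable_comp_snd hq hf
  let w : X × Y → ℝ := fun ω => G.indicator (fun ω => (μ₀.rnDeriv mY ω.2).toReal) ω * Z⁻¹
  have hwm : Measurable w := (hum.indicator hG).mul_const _
  have hw0 : ∀ ω, 0 ≤ w ω := fun ω => mul_nonneg
    (Set.indicator_nonneg (fun _ _ => ENNReal.toReal_nonneg) ω) (inv_pos.2 hZ0).le
  have hwi : Integrable w q := (huq.indicator hG).mul_const _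
  have hw1 : ∫ ω, w ω ∂q = 1 := by
    rw [integral_mul_const, integral_indicator hG, hZ, mul_inv_cancel₀ hZ0.ne']
  have hwl : ∀ ω, w ω * Real.log (w ω) = G.indicator (fun ω => entropyDensity mY μ₀ ω.2) ω * Z⁻¹
      - Real.log Z * (G.indicator (fun ω => (μ₀.rnDeriv mY ω.2).toReal) ω * Z⁻¹) := by
    intro ω
    by_cases hω : ω ∈ G
    · simp only [w, Set.indicator_of_mem hω, entropyDensity]
      rcases eq_or_ne (μ₀.rnDeriv mY ω.2).toReal 0 with h0 | h0
      · simp [h0]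
      · rw [Real.log_mul h0 (inv_pos.2 hZ0).ne', Real.log_inv]
        ring
    · simp [w, hω]
  have hi1 : Integrable (fun ω => G.indicator (fun ω => entropyDensity mY μ₀ ω.2) ω * Z⁻¹) q :=
    (hfq.indicator hG).mul_const _
  have hi2 : Integrable (fun ω => Real.log Z *
      (G.indicator (fun ω => (μ₀.rnDeriv mY ω.2).toReal) ω * Z⁻¹)) q := hwi.const_mul _
  have hwli : Integrable (fun ω => w ω * Real.log (w ω)) q := by
    simp only [hwl]
    exact hi1.sub hi2
  have hval : ∫ ω, w ω * Real.log (w ω) ∂q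
      ≤ (∫ y, entropyDensity mY μ₀ y ∂mY + q.real Gᶜ) / Z - Real.log Z := by
    simp only [hwl]
    rw [integral_sub hi1 hi2, integral_mul_const, integral_const_mul, integral_mul_const,
      integral_indicator hG, integral_indicator hG, hZ, mul_inv_cancel₀ hZ0.ne', mul_one,
      div_eq_mul_inv]
    have h1 : ∫ ω in G, entropyDensity mY μ₀ ω.2 ∂q
        ≤ ∫ y, entropyDensity mY μ₀ y ∂mY + q.real Gᶜ := by
      rw [← integral_comp_snd hq hf, ← integral_add_compl hG hfq]
      have h2 : ∫ _ in Gᶜ, (-1 : ℝ) ∂q ≤ ∫ ω in Gᶜ, entropyDensity mY μ₀ ω.2 ∂q :=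
        integral_mono (integrable_const _) hfq.integrableOn fun ω =>
          neg_one_le_entropyDensity mY μ₀ ω.2
      rw [setIntegral_const, smul_eq_mul, mul_neg_one] at h2
      linarith
    have := mul_le_mul_of_nonneg_right h1 (inv_pos.2 hZ0).le
    linarith
  have hp : IsProbabilityMeasure (q.withDensity fun ω => ENNReal.ofReal (w ω)) := ⟨by
    rw [withDensity_apply _ .univ, setLIntegral_univ, ← ofReal_integral_eq_lintegral_ofReal hwi
      (ae_of_all _ hw0), hw1, ENNReal.ofReal_one]⟩
  refine ⟨q.withDensity fun ω => ENNReal.ofReal (w ω), hp, ?_, ?_, ?_⟩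
  · rw [withDensity_apply _ hG.compl, setLIntegral_congr_fun (g := fun _ => 0) hG.compl]
    · simp
    · intro ω hω
      simp [w, Set.indicator_of_notMem hω]
  · refine Measure.le_iff.2 fun A hA => ?_
    have h1 := setLIntegral_map (μ := q) hA (Measure.measurable_rnDeriv μ₀ mY) measurable_snd
    rw [hq.2, Measure.setLIntegral_rnDeriv hac] at h1
    rw [Measure.map_apply measurable_snd hA, withDensity_apply _ (measurable_snd hA),
      Measure.smul_apply, smul_eq_mul, h1, ← lintegral_const_mul' _ _ (by finiteness)]
    refine setLIntegral_mono (by fun_prop) fun ω _ => ?_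
    by_cases hω : ω ∈ G
    · simp only [w, Set.indicator_of_mem hω]
      rw [mul_comm, ENNReal.ofReal_mul (inv_pos.2 hZ0).le]
      gcongr
      exact ENNReal.ofReal_toReal_le
    · simp [w, Set.indicator_of_notMem hω]
  · have : IsProbabilityMeasure
        ((q.withDensity fun ω => ENNReal.ofReal (w ω)).map Prod.fst) :=
      Measure.isProbabilityMeasure_map measurable_fst.aemeasurable
    exact (entropy_map_le hwm hw0 hwi hw1 hwli measurable_fst hq.1 rfl).trans
      (EReal.coe_le_coe_iff.2 hval)

end RestrictedPlan

/-! ### Convergence properties of recovery plans -/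

section Recovery

variable {X : ℕ → Type*} [∀ n, MetricSpace (X n)] [∀ n, MeasurableSpace (X n)] {Y : Type*}
  [MetricSpace Y] [MeasurableSpace Y] {δ : ∀ n, MetricCoupling (X n) Y}

/-- Plans between measures on the spaces `X n` and the measure `μ₀` on `Y`, of vanishing cost; the
second marginal is almost dominated by `μ₀`. -/
structure IsRecovery (δ : ∀ n, MetricCoupling (X n) Y) (μ₀ : Measure Y)
    (p : ∀ n, Measure (X n × Y)) : Prop where
  prob : ∀ n, IsProbabilityMeasure (p n)
  cost : Tendsto (fun n => ∫⁻ ω, ENNReal.ofReal ((δ n).cross ω.1 ω.2 ^ 2) ∂(p n)) atTop (𝓝 0)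
  snd_le : ∃ c : ℕ → ℝ, Tendsto c atTop (𝓝 1) ∧
    ∀ᶠ n in atTop, (p n).map Prod.snd ≤ ENNReal.ofReal (c n) • μ₀

variable {μ₀ : Measure Y} {p : ∀ n, Measure (X n × Y)}

/-- Domination by `c n` times `μ₀` is one-sided, but the masses agree: applied to `M - f` and `f +
M` it bounds the integral from both sides. -/
theorem IsRecovery.tendsto_integral_snd [IsProbabilityMeasure μ₀] (h : IsRecovery δ μ₀ p)
    {f : Y → ℝ} (hf : Measurable f) {M : ℝ} (hM : ∀ y, |f y| ≤ M) :
    Tendsto (fun n => ∫ ω, f ω.2 ∂(p n)) atTop (𝓝 (∫ y, f y ∂μ₀)) := by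
  obtain ⟨c, hc, hcp⟩ := h.snd_le
  have := h.prob
  have h_int : ∀ {ρ : Measure Y} [IsFiniteMeasure ρ], Integrable f ρ := integrable_of_bounded hf hM
  have hpush : ∀ n, ∫ ω, f ω.2 ∂(p n) = ∫ y, f y ∂((p n).map Prod.snd) := fun n =>
    (integral_map measurable_snd.aemeasurable hf.aestronglyMeasurable).symm
  have hprob : ∀ n, IsProbabilityMeasure ((p n).map Prod.snd) := fun n =>
    Measure.isProbabilityMeasure_map measurable_snd.aemeasurable
  have hlow : Tendsto (fun n => M - c n * (M - ∫ y, f y ∂μ₀)) atTop (𝓝 (∫ y, f y ∂μ₀)) := by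
    have := (hc.mul_const (M - ∫ y, f y ∂μ₀)).const_sub M
    simpa using this
  have hupp : Tendsto (fun n => c n * (∫ y, f y ∂μ₀ + M) - M) atTop (𝓝 (∫ y, f y ∂μ₀)) := by
    have := (hc.mul_const (∫ y, f y ∂μ₀ + M)).sub_const M
    simpa using this
  have key : ∀ᶠ n in atTop, ∀ g : Y → ℝ, (∀ y, 0 ≤ g y) → Integrable g μ₀ →
      ∫ y, g y ∂((p n).map Prod.snd) ≤ c n * ∫ y, g y ∂μ₀ := by
    filter_upwards [hcp, hc.eventually_const_lt zero_lt_one] with n hn hcn g hg hgi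
    have := integral_mono_measure hn (ae_of_all _ hg) (hgi.smul_measure (by finiteness))
    rwa [integral_smul_measure, ENNReal.toReal_ofReal hcn.le, smul_eq_mul] at this
  refine tendsto_of_tendsto_of_tendsto_of_le_of_le' hlow hupp ?_ ?_
  · filter_upwards [key] with n hn
    have h1 := hn (fun y => M - f y) (fun y => by linarith [(abs_le.1 (hM y)).2])
      ((integrable_const _).sub h_int)
    rw [integral_sub (integrable_const _) h_int, integral_sub (integrable_const _) h_int] at h1
    simp only [integral_const, probReal_univ, one_smul] at h1
    rw [hpush]
    linarith
  · filter_upwards [key] with n hn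
    have h1 := hn (fun y => f y + M) (fun y => by linarith [(abs_le.1 (hM y)).1])
      (h_int.add (integrable_const _))
    rw [integral_add h_int (integrable_const _), integral_add h_int (integrable_const _)] at h1
    simp only [integral_const, probReal_univ, one_smul] at h1
    rw [hpush]
    linarith

variable [∀ n, SecondCountableTopology (X n)] [∀ n, BorelSpace (X n)] [SecondCountableTopology Y]
  [BorelSpace Y]

theorem measure_lt_cross_le {X : Type*} [MetricSpace X] [SecondCountableTopology X]
    [MeasurableSpace X] [BorelSpace X] (δ : MetricCoupling X Y) (p : Measure (X × Y)) {η : ℝ}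
    (hη : 0 < η) :
    p {ω | η < δ.cross ω.1 ω.2}
      ≤ (∫⁻ ω, ENNReal.ofReal (δ.cross ω.1 ω.2 ^ 2) ∂p) / ENNReal.ofReal (η ^ 2) := by
  refine le_trans (measure_mono fun ω hω => ?_) (meas_ge_le_lintegral_div
    (δ.measurable_cross.pow_const 2).ennreal_ofReal.aemeasurable
    (by simp [hη.ne']) (by simp))
  have hω' : η < δ.cross ω.1 ω.2 := hω
  exact ENNReal.ofReal_le_ofReal (by gcongr)

theorem IsRecovery.tendsto_measure (h : IsRecovery δ μ₀ p) {η : ℝ} (hη : 0 < η) :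
    Tendsto (fun n => p n {ω | η < (δ n).cross ω.1 ω.2}) atTop (𝓝 0) := by
  have h1 := ENNReal.Tendsto.div_const h.cost
    (Or.inr (by simp [hη.ne'] : ENNReal.ofReal (η ^ 2) ≠ 0))
  rw [ENNReal.zero_div] at h1
  exact tendsto_of_tendsto_of_tendsto_of_le_of_le tendsto_const_nhds h1 (fun n => bot_le)
    fun n => measure_lt_cross_le (δ n) (p n) hη

/-- Under the plan, `T n x` and `y` are close in probability, so Lipschitz test functions of the two
have the same limit, and that of the second coordinate is known. -/
theorem IsRecovery.weakLimit [IsProbabilityMeasure μ₀] (h : IsRecovery δ μ₀ p)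
    {T : ∀ n, X n → Y} (hT : ∀ n, Measurable (T n))
    (hTδ : ∀ n x y, (δ n).cross x (T n x) ≤ (δ n).cross x y + 1 / ((n : ℝ) + 1)) :
    WeakLimit atTop T (fun n => (p n).map Prod.fst) μ₀ := by
  have := h.prob
  have hTf : ∀ n, Measurable fun ω : X n × Y => T n ω.1 := fun n => (hT n).comp measurable_fst
  let ρ : ℕ → ProbabilityMeasure Y := fun n => ⟨(p n).map fun ω => T n ω.1,
    Measure.isProbabilityMeasure_map (hTf n).aemeasurable⟩
  have hρ : Tendsto ρ atTop (𝓝 ⟨μ₀, inferInstance⟩) := by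
    refine tendsto_iff_forall_lipschitz_integral_tendsto.2 fun f ⟨C, hC⟩ ⟨L, hL⟩ => ?_
    have hne : Nonempty Y := nonempty_of_isProbabilityMeasure μ₀
    have hM : ∀ y, |f y| ≤ C + |f hne.some| := fun y => by
      have h1 := hC y hne.some
      rw [Real.dist_eq] at h1
      have h2 := abs_sub_abs_le_abs_sub (f y) (f hne.some)
      linarith
    have hfm : Measurable f := hL.continuous.measurable
    have t1 := h.tendsto_integral_snd hfm hM
    have t2 := tendsto_integral_sub_of_tendsto_measure (l := atTop) (P := p)
      (A := fun n ω => f (T n ω.1)) (B := fun n ω => f ω.2) (fun n => hfm.comp (hTf n))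
      (fun n => hfm.comp measurable_snd) (fun n ω => hM _) (fun n ω => hM _) (by
        intro η hη
        set κ := η / (2 * ((L : ℝ) + 1)) / 2 with hκ
        have hL0 : (0 : ℝ) ≤ L := L.2
        have hκ0 : 0 < κ := by positivity
        have hev : ∀ᶠ n : ℕ in atTop, 1 / ((n : ℝ) + 1) < κ :=
          tendsto_one_div_add_atTop_nhds_zero_nat.eventually_lt_const hκ0
        refine tendsto_of_tendsto_of_tendsto_of_le_of_le' tendsto_const_nhds
          (h.tendsto_measure hκ0) (Eventually.of_forall fun n => bot_le) ?_
        filter_upwards [hev] with n hn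
        refine measure_mono fun ω hω => ?_
        have hω' : η < |f (T n ω.1) - f ω.2| := hω
        by_contra hcon
        have h1 : (δ n).cross ω.1 ω.2 ≤ κ := not_lt.1 hcon
        have h2 := (δ n).dist_right_le ω.1 (T n ω.1) ω.2
        have h3 := hTδ n ω.1 ω.2
        have h4 := hL.dist_le_mul (T n ω.1) ω.2
        rw [Real.dist_eq] at h4
        have h5 : dist (T n ω.1) ω.2 ≤ 4 * κ := by linarith
        have h6 : (L : ℝ) * dist (T n ω.1) ω.2 ≤ (L + 1) * (4 * κ) := by
          gcongr
          linarith
        have h7 : ((L : ℝ) + 1) * (4 * κ) = η := by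
          rw [hκ]; field_simp; ring
        linarith)
    have t3 := t2.add t1
    rw [zero_add] at t3
    refine t3.congr fun n => ?_
    rw [sub_add_cancel]
    exact (integral_map (hTf n).aemeasurable hfm.aestronglyMeasurable).symm
  intro F
  have t := ProbabilityMeasure.tendsto_iff_forall_integral_tendsto.1 hρ F
  refine t.congr fun n => ?_
  refine (integral_map (hTf n).aemeasurable F.continuous.measurable.aestronglyMeasurable).trans ?_
  exact (integral_map (f := fun x => F (T n x)) measurable_fst.aemeasurable
    (F.continuous.measurable.comp (hT n)).aestronglyMeasurable).symm

theorem IsRecovery.asympTight [CompleteSpace Y] [IsProbabilityMeasure μ₀]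
    (h : IsRecovery δ μ₀ p) : AsympTight δ fun n => (p n).map Prod.fst := by
  obtain ⟨c, hc, hcp⟩ := h.snd_le
  refine asympTight_of_couplings (fun n => rfl) (ρ := μ₀) (c := ENNReal.ofReal 2) (by simp) ?_
    fun η hη => h.tendsto_measure hη
  filter_upwards [hcp, hc.eventually_lt_const (by norm_num : (1 : ℝ) < 2)] with n hn hcn
  refine hn.trans (Measure.le_iff.2 fun A _ => ?_)
  simp only [Measure.smul_apply, smul_eq_mul]
  gcongr

/-- Only an upper bound for the second moment is needed, and domination of the second marginal
provides it. The displacements of the plan and of the base point vanish in the limit. -/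
theorem IsRecovery.eventually_W₂_dirac_lt [IsProbabilityMeasure μ₀] (h : IsRecovery δ μ₀ p)
    {x : Y} {xs : ∀ n, X n} (hxs : Tendsto (fun n => (δ n).cross (xs n) x) atTop (𝓝 0)) {R : ℝ}
    (hR : W₂ μ₀ (Measure.dirac x) < ENNReal.ofReal R) :
    ∀ᶠ n in atTop, W₂ ((p n).map Prod.fst) (Measure.dirac (xs n)) < ENNReal.ofReal R := by
  obtain ⟨c, hc, hcp⟩ := h.snd_le
  have := h.prob
  have hprob : ∀ n, IsProbabilityMeasure ((p n).map Prod.fst) := fun n =>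
    Measure.isProbabilityMeasure_map measurable_fst.aemeasurable
  have hRpos : 0 < R := ENNReal.ofReal_pos.1 (bot_le.trans_lt hR)
  set W := W₂ μ₀ (Measure.dirac x) with hW
  have hWt : W ≠ ⊤ := hR.ne_top
  set w := W.toReal with hw
  have hw0 : 0 ≤ w := ENNReal.toReal_nonneg
  have hwR : w < R := by
    rw [← ENNReal.ofReal_toReal hWt, ENNReal.ofReal_lt_ofReal_iff hRpos] at hR
    exact hR
  have hgap : 0 < R ^ 2 - w ^ 2 := by nlinarith
  -- The weight in `(a + b)² ≤ (1 + t) a² + (1 + 1/t) b²`, small enough that `(1 + t) w² < R²`; the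
  -- `+ 1` covers `w = 0`.
  set t := (R ^ 2 - w ^ 2) / (2 * w ^ 2 + 1) with ht
  have ht0 : 0 < t := by positivity
  have htw : (1 + t) * w ^ 2 < R ^ 2 := by
    have h1 : t * (2 * w ^ 2 + 1) = R ^ 2 - w ^ 2 := div_mul_cancel₀ _ (by positivity)
    nlinarith
  -- the upper bound for the squared distance and its limit
  have hbound : ∀ᶠ n in atTop, W₂ ((p n).map Prod.fst) (Measure.dirac (xs n)) ^ 2
      ≤ ENNReal.ofReal (1 + t) * (ENNReal.ofReal (c n) * W ^ 2)
        + ENNReal.ofReal (2 * (1 + 1 / t)) *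
          ((∫⁻ ω, ENNReal.ofReal ((δ n).cross ω.1 ω.2 ^ 2) ∂(p n))
            + ENNReal.ofReal ((δ n).cross (xs n) x ^ 2)) := by
    filter_upwards [hcp] with n hn
    rw [W₂_dirac_sq, lintegral_map (by fun_prop) measurable_fst]
    have hpt : ∀ ω : X n × Y, edist ω.1 (xs n) ^ 2 ≤ ENNReal.ofReal (1 + t) * edist ω.2 x ^ 2
        + ENNReal.ofReal (2 * (1 + 1 / t)) * (ENNReal.ofReal ((δ n).cross ω.1 ω.2 ^ 2)
          + ENNReal.ofReal ((δ n).cross (xs n) x ^ 2)) := by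
      intro ω
      rw [edist_dist, edist_dist, ← ENNReal.ofReal_pow dist_nonneg,
        ← ENNReal.ofReal_pow dist_nonneg,
        ← ENNReal.ofReal_add (by positivity) (by positivity), ← ENNReal.ofReal_mul (by positivity),
        ← ENNReal.ofReal_mul (by positivity), ← ENNReal.ofReal_add (by positivity) (by positivity)]
      refine ENNReal.ofReal_le_ofReal ?_
      have h1 := abs_le.1 ((δ n).abs_dist_sub_dist_le ω.1 (xs n) ω.2 x)
      have h2 : dist ω.1 (xs n) ≤ dist ω.2 x + ((δ n).cross ω.1 ω.2 + (δ n).cross (xs n) x) := by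
        linarith
      set a := dist ω.2 x
      set b := (δ n).cross ω.1 ω.2
      set b' := (δ n).cross (xs n) x
      have h3 : dist ω.1 (xs n) ^ 2 ≤ (a + (b + b')) ^ 2 := by gcongr
      have h4 : 2 * (a * (b + b')) ≤ t * a ^ 2 + 1 / t * (b + b') ^ 2 := by
        have h5 : t * a ^ 2 + 1 / t * (b + b') ^ 2 - 2 * (a * (b + b'))
            = (t * a - (b + b')) ^ 2 / t := by
          field_simp
          ring
        have h6 : 0 ≤ (t * a - (b + b')) ^ 2 / t := by positivity
        linarith
      have h7 : (b + b') ^ 2 ≤ 2 * (b ^ 2 + b' ^ 2) := by nlinarith [sq_nonneg (b - b')]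
      have h8 := mul_le_mul_of_nonneg_left h7 (by positivity : 0 ≤ 1 + 1 / t)
      nlinarith
    refine (lintegral_mono hpt).trans ?_
    have hmd : Measurable fun y : Y => edist y x ^ 2 := by fun_prop
    have hmd2 : Measurable fun ω : X n × Y => ENNReal.ofReal (1 + t) * edist ω.2 x ^ 2 := by
      fun_prop
    rw [lintegral_add_left hmd2,
      lintegral_const_mul' _ _ (by finiteness), lintegral_const_mul' _ _ (by finiteness),
      lintegral_add_right _ measurable_const, lintegral_const, measure_univ, mul_one]
    gcongr
    have h9 : ∫⁻ ω, edist ω.2 x ^ 2 ∂(p n) = ∫⁻ y, edist y x ^ 2 ∂((p n).map Prod.snd) :=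
      (lintegral_map hmd measurable_snd).symm
    rw [h9, W₂_dirac_sq]
    refine (lintegral_mono' hn le_rfl).trans ?_
    rw [lintegral_smul_measure, smul_eq_mul]
  have hlim : Tendsto (fun n => ENNReal.ofReal (1 + t) * (ENNReal.ofReal (c n) * W ^ 2)
        + ENNReal.ofReal (2 * (1 + 1 / t)) *
          ((∫⁻ ω, ENNReal.ofReal ((δ n).cross ω.1 ω.2 ^ 2) ∂(p n))
            + ENNReal.ofReal ((δ n).cross (xs n) x ^ 2))) atTop
      (𝓝 (ENNReal.ofReal (1 + t) * (ENNReal.ofReal 1 * W ^ 2)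
        + ENNReal.ofReal (2 * (1 + 1 / t)) * (0 + ENNReal.ofReal (0 ^ 2)))) := by
    refine Tendsto.add ?_ ?_
    · refine ENNReal.Tendsto.const_mul (ENNReal.Tendsto.mul_const (ENNReal.tendsto_ofReal hc) ?_) ?_
      · right; finiteness
      · right; simp
    · refine ENNReal.Tendsto.const_mul (h.cost.add (ENNReal.tendsto_ofReal (hxs.pow 2))) ?_
      right; finiteness
  have hlt : ENNReal.ofReal (1 + t) * (ENNReal.ofReal 1 * W ^ 2)
      + ENNReal.ofReal (2 * (1 + 1 / t)) * (0 + ENNReal.ofReal (0 ^ 2))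
      < ENNReal.ofReal (R ^ 2) := by
    rw [← ENNReal.ofReal_toReal hWt]
    simp only [ENNReal.ofReal_one, one_mul, ne_eq, OfNat.ofNat_ne_zero, not_false_eq_true, zero_pow,
      ENNReal.ofReal_zero, add_zero, mul_zero]
    rw [← ENNReal.ofReal_pow hw0, ← ENNReal.ofReal_mul (by positivity)]
    exact (ENNReal.ofReal_lt_ofReal_iff (by positivity)).2 htw
  filter_upwards [hbound, hlim.eventually_lt_const hlt] with n h1 h2
  have h3 := h1.trans_lt h2
  rw [ENNReal.ofReal_pow hRpos.le] at h3
  exact lt_of_not_ge fun hge => h3.not_ge (pow_le_pow_left₀ bot_le hge 2)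

end Recovery

theorem isRecovery_of_couplings {X : ℕ → Type*} [∀ n, MetricSpace (X n)]
    [∀ n, MeasurableSpace (X n)] {Y : Type*} [MetricSpace Y] [MeasurableSpace Y]
    {δ : ∀ n, MetricCoupling (X n) Y} {m : ∀ n, Measure (X n)} [∀ n, IsProbabilityMeasure (m n)]
    {mY : Measure Y} {q : ∀ n, Measure (X n × Y)} (hq : ∀ n, q n ∈ couplings (m n) mY)
    (hcost : ∀ n, ∫⁻ ω, ENNReal.ofReal ((δ n).cross ω.1 ω.2 ^ 2) ∂(q n)
      ≤ ENNReal.ofReal ((1 / ((n : ℝ) + 1)) ^ 4)) : IsRecovery δ mY q where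
  prob n := isProbabilityMeasure_of_mem_couplings (hq n)
  cost := by
    refine tendsto_of_tendsto_of_tendsto_of_le_of_le tendsto_const_nhds ?_ (fun n => bot_le) hcost
    have := ENNReal.tendsto_ofReal (tendsto_one_div_add_atTop_nhds_zero_nat (𝕜 := ℝ).pow 4)
    simpa using this
  snd_le := ⟨fun _ => 1, tendsto_const_nhds, Eventually.of_forall fun n => by
    rw [(hq n).2, ENNReal.ofReal_one, one_smul]⟩

/-! ### Construction of recovery plans -/

section RecoveryExistence

variable {X : ℕ → Type*} [∀ n, MetricSpace (X n)] [∀ n, MeasurableSpace (X n)]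
  [∀ n, BorelSpace (X n)] {Y : Type*} [MetricSpace Y] [MeasurableSpace Y] [BorelSpace Y]
  {δ : ∀ n, MetricCoupling (X n) Y} {m : ∀ n, Measure (X n)} [∀ n, IsProbabilityMeasure (m n)]
  {mY : Measure Y} [IsProbabilityMeasure mY] {q : ∀ n, Measure (X n × Y)}

/-- Every ball at `y` eventually sees mass of `m n` nearby, so `X n` contains points arbitrarily
close to `y`. -/
theorem tendsto_cross_of_almost_nearest
    (hsupp : ∀ V : Set Y, IsOpen V → V.Nonempty → 0 < mY V) (hq : ∀ n, q n ∈ couplings (m n) mY)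
    (hqδ : ∀ η : ℝ, 0 < η → Tendsto (fun n => q n {ω | η < (δ n).cross ω.1 ω.2}) atTop (𝓝 0))
    {R : ∀ n, Y → X n}
    (hR : ∀ n y x, (δ n).cross (R n y) y ≤ (δ n).cross x y + 1 / ((n : ℝ) + 1)) (y : Y) :
    Tendsto (fun n => (δ n).cross (R n y) y) atTop (𝓝 0) := by
  refine tendsto_order.2 ⟨fun a ha => Eventually.of_forall fun n =>
    ha.trans_le ((δ n).cross_nonneg _ _), fun a ha => ?_⟩
  obtain ⟨c, hc0, hc⟩ := exists_eventually_le_measureReal_cross_lt hsupp hq hqδ y (half_pos ha)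
  filter_upwards [hc, tendsto_one_div_add_atTop_nhds_zero_nat.eventually_lt_const (half_pos ha)]
    with n hn hn'
  have hne : (m n) {x | (δ n).cross x y < a / 2} ≠ 0 := fun h0 => by
    rw [measureReal_def, h0, ENNReal.toReal_zero] at hn
    linarith
  obtain ⟨x, hx⟩ := nonempty_of_measure_ne_zero hne
  have hx' : (δ n).cross x y < a / 2 := hx
  linarith [hR n y x]

variable [∀ n, SecondCountableTopology (X n)] [SecondCountableTopology Y]

/-- The choice for infinite entropy, where no entropy bound on the lifted measures is required.
Comparison with `R n x` bounds the displacement at `y` by `dist y x + 2`, so the second moment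
dominates the cost. -/
theorem isRecovery_of_moment (hsupp : ∀ V : Set Y, IsOpen V → V.Nonempty → 0 < mY V)
    (hq : ∀ n, q n ∈ couplings (m n) mY)
    (hqδ : ∀ η : ℝ, 0 < η → Tendsto (fun n => q n {ω | η < (δ n).cross ω.1 ω.2}) atTop (𝓝 0))
    {R : ∀ n, Y → X n} (hRm : ∀ n, Measurable (R n))
    (hR : ∀ n y x, (δ n).cross (R n y) y ≤ (δ n).cross x y + 1 / ((n : ℝ) + 1))
    {μ₀ : Measure Y} [IsProbabilityMeasure μ₀] {x : Y} (hμ₀ : ∫⁻ y, edist y x ^ 2 ∂μ₀ ≠ ⊤) :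
    IsRecovery δ μ₀ fun n => μ₀.map fun y => (R n y, y) := by
  have hm : ∀ n, Measurable fun y => (R n y, y) := fun n => (hRm n).prodMk measurable_id
  refine ⟨fun n => Measure.isProbabilityMeasure_map (hm n).aemeasurable, ?_,
    ⟨fun _ => 1, tendsto_const_nhds, Eventually.of_forall fun n => ?_⟩⟩
  · have hc : ∀ n, Measurable fun ω : X n × Y => ENNReal.ofReal ((δ n).cross ω.1 ω.2 ^ 2) :=
      fun n => ((δ n).measurable_cross.pow_const 2).ennreal_ofReal
    have heq : ∀ n, ∫⁻ ω, ENNReal.ofReal ((δ n).cross ω.1 ω.2 ^ 2) ∂(μ₀.map fun y => (R n y, y))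
        = ∫⁻ y, ENNReal.ofReal ((δ n).cross (R n y) y ^ 2) ∂μ₀ := fun n =>
      lintegral_map (hc n) (hm n)
    simp only [heq]
    have hlim := tendsto_cross_of_almost_nearest hsupp hq hqδ hR
    have h0 : (0 : ℝ≥0∞) = ∫⁻ _, 0 ∂μ₀ := by simp
    rw [h0]
    refine tendsto_lintegral_filter_of_dominated_convergence
      (fun y => ENNReal.ofReal (2 * dist y x ^ 2 + 8))
      (Eventually.of_forall fun n => (hc n).comp (hm n)) ?_ ?_ (ae_of_all _ fun y => ?_)
    · filter_upwards [(hlim x).eventually_lt_const zero_lt_one] with n hn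
      refine ae_of_all _ fun y => ENNReal.ofReal_le_ofReal ?_
      have h1 := hR n y (R n x)
      have h2 := (δ n).cross_le_right (R n x) y x
      have h3 : 1 / ((n : ℝ) + 1) ≤ 1 := by
        rw [div_le_one (by positivity)]; linarith [n.cast_nonneg (α := ℝ)]
      have h4 : (δ n).cross (R n y) y ≤ dist y x + 2 := by
        rw [dist_comm] at h2; linarith
      have h5 : (δ n).cross (R n y) y ^ 2 ≤ (dist y x + 2) ^ 2 := by
        have := (δ n).cross_nonneg (R n y) y
        gcongr
      nlinarith [sq_nonneg (dist y x - 2)]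
    · have : ∀ y, ENNReal.ofReal (2 * dist y x ^ 2 + 8) = 2 * edist y x ^ 2 + 8 := fun y => by
        rw [ENNReal.ofReal_add (by positivity) (by norm_num), ENNReal.ofReal_mul (by norm_num),
          ENNReal.ofReal_pow dist_nonneg, ← edist_dist]
        simp
      simp only [this]
      rw [lintegral_add_right _ measurable_const, lintegral_const_mul' _ _ (by simp)]
      simp only [lintegral_const, measure_univ, mul_one]
      finiteness
    · have := ENNReal.tendsto_ofReal ((hlim y).pow 2)
      simpa using this
  · rw [Measure.map_map measurable_snd (hm n), ENNReal.ofReal_one, one_smul]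
    exact le_of_eq Measure.map_id

/-- Pairs further apart than `1/(n+1)` are discarded. The cost `(n+1)⁻⁴` makes their `q n`-mass at
most `(n+1)⁻²`, and finite entropy turns this into a vanishing loss of `μ₀`-mass. What remains has
small cost pointwise, whatever the size of the density. -/
theorem exists_isRecovery_of_entropy_ne_top (hq : ∀ n, q n ∈ couplings (m n) mY)
    (hcost : ∀ n, ∫⁻ ω, ENNReal.ofReal ((δ n).cross ω.1 ω.2 ^ 2) ∂(q n)
      ≤ ENNReal.ofReal ((1 / ((n : ℝ) + 1)) ^ 4))
    {μ₀ : Measure Y} [IsProbabilityMeasure μ₀] (hS : entropy mY μ₀ ≠ ⊤) :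
    ∃ p : ∀ n, Measure (X n × Y), IsRecovery δ μ₀ p ∧ ∃ s : ℕ → ℝ,
      Tendsto s atTop (𝓝 (∫ y, entropyDensity mY μ₀ y ∂mY)) ∧
      ∀ᶠ n in atTop, entropy (m n) ((p n).map Prod.fst) ≤ (s n : EReal) := by
  classical
  set S := ∫ y, entropyDensity mY μ₀ y ∂mY with hSdef
  let η : ℕ → ℝ := fun n => 1 / ((n : ℝ) + 1)
  have hη0 : ∀ n, 0 < η n := fun n => by positivity
  have hηt : Tendsto η atTop (𝓝 0) := tendsto_one_div_add_atTop_nhds_zero_nat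
  have hqp : ∀ n, IsProbabilityMeasure (q n) := fun n =>
    isProbabilityMeasure_of_mem_couplings (hq n)
  let G : ∀ n, Set (X n × Y) := fun n => {ω | (δ n).cross ω.1 ω.2 ≤ η n}
  have hG : ∀ n, MeasurableSet (G n) := fun n =>
    measurableSet_le (δ n).measurable_cross measurable_const
  have hGc : ∀ n, (q n).real (G n)ᶜ ≤ η n ^ 2 := by
    intro n
    refine ENNReal.toReal_le_of_le_ofReal (by positivity) ?_
    have h1 : (G n)ᶜ = {ω | η n < (δ n).cross ω.1 ω.2} := by
      ext ω; simp [G]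
    rw [h1]
    refine (measure_lt_cross_le (δ n) (q n) (hη0 n)).trans ?_
    rw [ENNReal.div_le_iff (by simp [(hη0 n).ne']) (by simp),
      ← ENNReal.ofReal_mul (by positivity)]
    refine (hcost n).trans (ENNReal.ofReal_le_ofReal (le_of_eq ?_))
    ring
  have hGt : Tendsto (fun n => (q n).real (G n)ᶜ) atTop (𝓝 0) := by
    refine squeeze_zero (fun n => measureReal_nonneg) hGc ?_
    simpa using hηt.pow 2
  let Z : ℕ → ℝ := fun n => ∫ ω in G n, (μ₀.rnDeriv mY ω.2).toReal ∂(q n)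
  have hac := absolutelyContinuous_of_entropy_ne_top hS
  have hu : Integrable (fun y => (μ₀.rnDeriv mY y).toReal) mY := Measure.integrable_toReal_rnDeriv
  have hZ1 : ∀ n, Z n ≤ 1 := fun n => by
    refine (setIntegral_le_integral (integrable_comp_snd (hq n) hu)
      (ae_of_all _ fun _ => ENNReal.toReal_nonneg)).trans ?_
    rw [integral_comp_snd (hq n) hu, integral_rnDeriv_toReal_eq_one hac]
  have hZt : Tendsto Z atTop (𝓝 1) := by
    refine tendsto_order.2 ⟨fun a ha => ?_, fun a ha => Eventually.of_forall fun n =>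
      (hZ1 n).trans_lt ha⟩
    have ha' : 0 < 1 - a := by linarith
    set t := (|S + Real.log 2| + 1) / (1 - a) with ht
    have ht0 : 0 < t := by positivity
    filter_upwards [hGt.eventually_lt_const (Real.exp_pos (-t))] with n hn
    have h1 := mul_one_sub_setIntegral_le (hq n) hS (hG n) ht0.le hn.le
    have h2 : t * (1 - a) = |S + Real.log 2| + 1 := div_mul_cancel₀ _ ha'.ne'
    have h3 := le_abs_self (S + Real.log 2)
    by_contra hcon
    have h4 : 1 - a ≤ 1 - Z n := by linarith [not_lt.1 hcon]
    have h5 := mul_le_mul_of_nonneg_left h4 ht0.le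
    change t * (1 - Z n) ≤ S + Real.log 2 at h1
    linarith
  -- Where nothing is left after the restriction, `q n` itself serves as a default value; this
  -- happens for finitely many `n` only.
  have hex : ∀ n, ∃ p : Measure (X n × Y), IsProbabilityMeasure p ∧ (0 < Z n → p (G n)ᶜ = 0 ∧
      p.map Prod.snd ≤ ENNReal.ofReal (Z n)⁻¹ • μ₀ ∧
      entropy (m n) (p.map Prod.fst)
        ≤ (((S + (q n).real (G n)ᶜ) / Z n - Real.log (Z n) : ℝ) : EReal)) := by
    intro n
    by_cases hZ0 : 0 < Z n
    · obtain ⟨p, hp, h⟩ := exists_plan_of_entropy_ne_top (hq n) hS (hG n) hZ0 rfl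
      exact ⟨p, hp, fun _ => h⟩
    · exact ⟨q n, hqp n, fun h => absurd h hZ0⟩
  choose p hp hpZ using hex
  have hZpos : ∀ᶠ n in atTop, 0 < Z n := hZt.eventually_const_lt zero_lt_one
  refine ⟨p, ⟨hp, ?_, fun n => (Z n)⁻¹, ?_, hZpos.mono fun n hn => (hpZ n hn).2.1⟩,
    fun n => (S + (q n).real (G n)ᶜ) / Z n - Real.log (Z n), ?_,
    hZpos.mono fun n hn => (hpZ n hn).2.2⟩
  · have hlim : Tendsto (fun n => ENNReal.ofReal (η n ^ 2)) atTop (𝓝 0) := by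
      have := ENNReal.tendsto_ofReal (hηt.pow 2)
      simpa using this
    refine tendsto_of_tendsto_of_tendsto_of_le_of_le' tendsto_const_nhds hlim
      (Eventually.of_forall fun n => bot_le) ?_
    filter_upwards [hZpos] with n hn
    calc ∫⁻ ω, ENNReal.ofReal ((δ n).cross ω.1 ω.2 ^ 2) ∂(p n)
        ≤ ∫⁻ _, ENNReal.ofReal (η n ^ 2) ∂(p n) := by
          refine lintegral_mono_ae ?_
          have : ∀ᵐ ω ∂(p n), ω ∈ G n := (hpZ n hn).1
          filter_upwards [this] with ω hω
          have hω' : (δ n).cross ω.1 ω.2 ≤ η n := hω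
          have := (δ n).cross_nonneg ω.1 ω.2
          exact ENNReal.ofReal_le_ofReal (by gcongr)
      _ = ENNReal.ofReal (η n ^ 2) := by simp
  · simpa using hZt.inv₀ one_ne_zero
  · have h1 := ((hGt.const_add S).div hZt one_ne_zero).sub
      ((Real.continuousAt_log one_ne_zero).tendsto.comp hZt)
    simpa using h1

end RecoveryExistence

/-! ### Limits of geodesics -/

theorem W₂_dirac_dirac {X : Type*} [MetricSpace X] [SecondCountableTopology X] [MeasurableSpace X]
    [BorelSpace X] (x y : X) : W₂ (Measure.dirac x) (Measure.dirac y) = edist x y := by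
  have h := W₂_dirac_sq (Measure.dirac x) y
  rw [lintegral_dirac] at h
  exact le_antisymm (sq_le_sq_ennreal.1 h.le) (sq_le_sq_ennreal.1 h.ge)

theorem abs_min_dist_sq_le {Z : Type*} [MetricSpace Z] (z w : Z) (M : ℕ) :
    |min (dist z w) (M : ℝ) ^ 2| ≤ (M : ℝ) ^ 2 := by
  rw [abs_of_nonneg (sq_nonneg _)]
  exact pow_le_pow_left₀ (le_min dist_nonneg M.cast_nonneg) (min_le_right _ _) 2

theorem lintegral_edist_sq_le_of_truncated {Y : Type*} [MetricSpace Y] [MeasurableSpace Y]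
    [BorelSpace Y] {ν : Measure Y} [IsProbabilityMeasure ν] {y : Y} {R : ℝ}
    (h : ∀ M : ℕ, ∫ z, min (dist z y) M ^ 2 ∂ν ≤ R ^ 2) :
    ∫⁻ z, edist z y ^ 2 ∂ν ≤ ENNReal.ofReal (R ^ 2) := by
  have hm : ∀ M : ℕ, Measurable fun z : Y => min (dist z y) (M : ℝ) ^ 2 := fun M => by fun_prop
  have hlim : Tendsto (fun M : ℕ => ∫⁻ z, ENNReal.ofReal (min (dist z y) M ^ 2) ∂ν) atTop
      (𝓝 (∫⁻ z, edist z y ^ 2 ∂ν)) := by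
    refine lintegral_tendsto_of_tendsto_of_monotone (fun M => (hm M).ennreal_ofReal.aemeasurable)
      (ae_of_all _ fun z M N hMN => ?_) (ae_of_all _ fun z => ?_)
    · refine ENNReal.ofReal_le_ofReal (pow_le_pow_left₀ (le_min dist_nonneg M.cast_nonneg) ?_ 2)
      exact min_le_min le_rfl (by exact_mod_cast hMN)
    · refine tendsto_const_nhds.congr' ?_
      obtain ⟨N, hN⟩ := exists_nat_ge (dist z y)
      filter_upwards [eventually_ge_atTop N] with M hM
      rw [min_eq_left (hN.trans (by exact_mod_cast hM)), edist_dist, ENNReal.ofReal_pow dist_nonneg]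
  refine le_of_tendsto' hlim fun M => ?_
  rw [← ofReal_integral_eq_lintegral_ofReal (integrable_of_bounded (hm M)
    fun z => abs_min_dist_sq_le z y M)
    (ae_of_all _ fun z => sq_nonneg _)]
  exact ENNReal.ofReal_le_ofReal (h M)

/-- Lower semicontinuity of the second moment. Truncated squared distances to `xs i` and to `y`
agree asymptotically in probability and pass to the weak limit; the truncation is removed by
monotone convergence. -/
theorem W₂_dirac_le_of_weakLimit {ι : Type*} {l : Filter ι} [l.NeBot] {X : ι → Type*}
    [∀ i, MetricSpace (X i)] [∀ i, SecondCountableTopology (X i)] [∀ i, MeasurableSpace (X i)]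
    [∀ i, BorelSpace (X i)] {Y : Type*} [MetricSpace Y] [SecondCountableTopology Y]
    [MeasurableSpace Y] [BorelSpace Y] {δ : ∀ i, MetricCoupling (X i) Y} {T : ∀ i, X i → Y}
    (hT : ∀ i, Measurable (T i)) {α : ∀ i, Measure (X i)} [∀ i, IsProbabilityMeasure (α i)]
    (hsmall : ∀ η : ℝ, 0 < η → Tendsto (fun i => α i {x | η < (δ i).cross x (T i x)}) l (𝓝 0))
    {ν : Measure Y} [IsProbabilityMeasure ν] (hν : WeakLimit l T α ν) {xs : ∀ i, X i} {y : Y}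
    (hxs : Tendsto (fun i => (δ i).cross (xs i) y) l (𝓝 0)) {R : ι → ℝ} {R' : ℝ}
    (hR0 : ∀ i, 0 ≤ R i)
    (hR : Tendsto R l (𝓝 R'))
    (hW : ∀ᶠ i in l, W₂ (α i) (Measure.dirac (xs i)) ≤ ENNReal.ofReal (R i)) :
    W₂ ν (Measure.dirac y) ≤ ENNReal.ofReal R' := by
  have hR'0 : 0 ≤ R' := ge_of_tendsto' hR hR0
  rw [← sq_le_sq_ennreal, W₂_dirac_sq, ← ENNReal.ofReal_pow hR'0]
  refine lintegral_edist_sq_le_of_truncated fun M => ?_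
  have t1 := hν.tendsto_integral (f := fun z => min (dist z y) (M : ℝ) ^ 2) (by fun_prop)
    (fun z => abs_min_dist_sq_le z y M)
  have t2 := tendsto_integral_sub_of_tendsto_measure (l := l) (P := α)
    (A := fun i x => min (dist (T i x) y) (M : ℝ) ^ 2)
    (B := fun i x => min (dist x (xs i)) (M : ℝ) ^ 2)
    (fun i => by have := hT i; fun_prop) (fun i => by fun_prop) (C := (M : ℝ) ^ 2)
    (fun i x => abs_min_dist_sq_le _ _ M) (fun i x => abs_min_dist_sq_le _ _ M) (by
      intro η hη
      set κ := η / (4 * (M + 1)) with hκ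
      have hκ0 : 0 < κ := by positivity
      refine tendsto_of_tendsto_of_tendsto_of_le_of_le' tendsto_const_nhds (hsmall κ hκ0)
        (Eventually.of_forall fun i => bot_le) ?_
      filter_upwards [hxs.eventually_lt_const hκ0] with i hi
      refine measure_mono fun x hx => ?_
      have hx' : η < |min (dist (T i x) y) (M : ℝ) ^ 2 - min (dist x (xs i)) (M : ℝ) ^ 2| := hx
      by_contra hcon
      have h1 : (δ i).cross x (T i x) ≤ κ := not_lt.1 hcon
      have h2 := (δ i).abs_dist_sub_dist_le x (xs i) (T i x) y
      have h3 : |min (dist (T i x) y) (M : ℝ) - min (dist x (xs i)) (M : ℝ)| ≤ 2 * κ := by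
        refine (abs_min_sub_min_le_max _ _ _ _).trans ?_
        rw [sub_self, abs_zero]
        refine max_le ?_ (by positivity)
        rw [abs_sub_comm]
        linarith
      have h4 : |min (dist (T i x) y) (M : ℝ) + min (dist x (xs i)) (M : ℝ)| ≤ 2 * M := by
        rw [abs_of_nonneg (add_nonneg (le_min dist_nonneg M.cast_nonneg)
          (le_min dist_nonneg M.cast_nonneg))]
        linarith [min_le_right (dist (T i x) y) (M : ℝ), min_le_right (dist x (xs i)) (M : ℝ)]
      rw [sq_sub_sq, abs_mul] at hx'
      have h5 := mul_le_mul h4 h3 (abs_nonneg _) (by positivity)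
      have h6 : 2 * (M : ℝ) * (2 * κ) ≤ η := by
        have h7 : 4 * ((M : ℝ) + 1) * κ = η := by rw [hκ]; field_simp
        nlinarith
      linarith)
  have t3 : Tendsto (fun i => ∫ x, min (dist x (xs i)) (M : ℝ) ^ 2 ∂(α i)) l
      (𝓝 (∫ z, min (dist z y) (M : ℝ) ^ 2 ∂ν)) := by
    have := t1.sub t2
    simpa using this
  refine le_of_tendsto_of_tendsto t3 (hR.pow 2) ?_
  filter_upwards [hW] with i hi
  have h1 : ∫⁻ x, edist x (xs i) ^ 2 ∂(α i) ≤ ENNReal.ofReal (R i ^ 2) := by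
    rw [← W₂_dirac_sq, ENNReal.ofReal_pow (hR0 i)]
    exact pow_le_pow_left₀ bot_le hi 2
  have hm : Measurable fun x : X i => dist x (xs i) := by fun_prop
  have hfin : ∫⁻ x, edist x (xs i) ^ 2 ∂(α i) ≠ ⊤ := ne_top_of_le_ne_top (by finiteness) h1
  have h_int := integrable_dist_sq (f := fun x : X i => x) (g := fun _ => xs i) hm hfin
  rw [← ofReal_integral_dist_sq (f := fun x : X i => x) (g := fun _ => xs i) hm hfin,
    ENNReal.ofReal_le_ofReal_iff (sq_nonneg _)] at h1
  refine le_trans (integral_mono (integrable_of_bounded (by fun_prop)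
    fun x => abs_min_dist_sq_le x (xs i) M) h_int fun x => ?_) h1
  exact pow_le_pow_left₀ (le_min dist_nonneg M.cast_nonneg) (min_le_left _ _) 2

/-- A curve of probability measures is a geodesic if each of its points lies, at the right
position, between any earlier and any later one. -/
theorem isW₂Geodesic_of_between {Y : Type*} [MetricSpace Y] [CompleteSpace Y]
    [SecondCountableTopology Y] [MeasurableSpace Y] [BorelSpace Y] {ν : ℝ → ProbabilityMeasure Y}
    (hfin : W₂ (ν (-1) : Measure Y) (ν 1) < ⊤)
    (h : ∀ a b c : ℝ, -1 ≤ a → a < b → b < c → c ≤ 1 →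
      W₂ (ν a : Measure Y) (ν b) ≤ ENNReal.ofReal ((b - a) / (c - a)) * W₂ (ν a : Measure Y) (ν c) ∧
      W₂ (ν b : Measure Y) (ν c)
        ≤ ENNReal.ofReal ((c - b) / (c - a)) * W₂ (ν a : Measure Y) (ν c)) :
    IsW₂Geodesic ν := by
  set L := W₂ (ν (-1) : Measure Y) (ν 1) with hL
  set l := L.toReal with hl
  have hl0 : 0 ≤ l := ENNReal.toReal_nonneg
  have hLl : L = ENNReal.ofReal l := (ENNReal.ofReal_toReal hfin.ne).symm
  have hleft : ∀ b : ℝ, -1 ≤ b → b ≤ 1 →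
      W₂ (ν (-1) : Measure Y) (ν b) ≤ ENNReal.ofReal ((b + 1) / 2) * L := by
    intro b hb1 hb2
    rcases hb1.eq_or_lt with rfl | hb1
    · rw [W₂_self]; exact bot_le
    rcases hb2.eq_or_lt with rfl | hb2
    · norm_num [hL]
    · have := (h (-1) b 1 le_rfl hb1 hb2 le_rfl).1
      rwa [show (b - -1) / (1 - -1) = (b + 1) / 2 by norm_num] at this
  have hupper : ∀ a b : ℝ, -1 ≤ a → a < b → b ≤ 1 →
      W₂ (ν a : Measure Y) (ν b) ≤ ENNReal.ofReal ((b - a) / 2) * L := by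
    intro a b ha hab hb
    rcases ha.eq_or_lt with rfl | ha
    · have := hleft b hab.le hb
      rwa [show b - -1 = b + 1 by ring]
    · have h1 := (h (-1) a b le_rfl ha hab hb).2
      have hb0 : 0 < b + 1 := by linarith
      refine h1.trans ((mul_le_mul_right (hleft b (by linarith) hb) _).trans (le_of_eq ?_))
      rw [← mul_assoc, ← ENNReal.ofReal_mul (div_nonneg (by linarith) (by linarith))]
      congr 2
      rw [show b - -1 = b + 1 by ring]
      field_simp
  have heq : ∀ a b : ℝ, -1 ≤ a → a < b → b ≤ 1 →
      W₂ (ν a : Measure Y) (ν b) = ENNReal.ofReal ((b - a) / 2) * L := by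
    intro a b ha hab hb
    refine le_antisymm (hupper a b ha hab hb) ?_
    have hWfin : W₂ (ν a : Measure Y) (ν b) ≠ ⊤ :=
      ne_top_of_le_ne_top (ENNReal.mul_ne_top ENNReal.ofReal_ne_top hfin.ne) (hupper a b ha hab hb)
    have hright : W₂ (ν b : Measure Y) (ν 1) ≤ ENNReal.ofReal ((1 - b) / 2) * L := by
      rcases hb.eq_or_lt with rfl | hb
      · rw [W₂_self]; exact bot_le
      · exact hupper b 1 (by linarith) hb le_rfl
    -- The upper bounds for the three pieces add up exactly to `L`, so none of them can be strict.
    have htri : L ≤ ENNReal.ofReal ((a + 1) / 2) * L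
        + (W₂ (ν a : Measure Y) (ν b) + ENNReal.ofReal ((1 - b) / 2) * L) :=
      (W₂_triangle _ (ν a : Measure Y) _).trans (add_le_add (hleft a ha (by linarith))
        ((W₂_triangle _ (ν b : Measure Y) _).trans (add_le_add le_rfl hright)))
    set w := (W₂ (ν a : Measure Y) (ν b)).toReal with hw
    have hw0 : 0 ≤ w := ENNReal.toReal_nonneg
    rw [← ENNReal.ofReal_toReal hWfin] at htri ⊢
    have h1 : 0 ≤ (a + 1) / 2 := by linarith
    have h2 : 0 ≤ (1 - b) / 2 := by linarith
    have h3 : 0 ≤ (b - a) / 2 := by linarith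
    rw [hLl, ← ENNReal.ofReal_mul h1, ← ENNReal.ofReal_mul h2,
      ← ENNReal.ofReal_add hw0 (mul_nonneg h2 hl0),
      ← ENNReal.ofReal_add (mul_nonneg h1 hl0) (add_nonneg hw0 (mul_nonneg h2 hl0)),
      ENNReal.ofReal_le_ofReal_iff (by positivity)] at htri
    rw [hLl, ← ENNReal.ofReal_mul h3]
    refine ENNReal.ofReal_le_ofReal ?_
    linarith
  refine ⟨hfin, fun a ha b hb => ?_⟩
  rcases lt_trichotomy a b with hab | rfl | hab
  · rw [heq a b ha.1 hab hb.2, abs_sub_comm, abs_of_pos (by linarith)]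
  · simp [W₂_self]
  · rw [W₂_comm, heq b a hb.1 hab ha.2, abs_of_pos (by linarith)]

/-! ### Stability -/

theorem AsympTight.congr' {X : ℕ → Type*} [∀ n, MetricSpace (X n)] [∀ n, MeasurableSpace (X n)]
    {Y : Type*} [MetricSpace Y] {δ : ∀ n, MetricCoupling (X n) Y} {α β : ∀ n, Measure (X n)}
    (h : AsympTight δ α) (hαβ : ∀ᶠ n in atTop, α n = β n) : AsympTight δ β := by
  intro ε hε η hη
  obtain ⟨F, hF⟩ := h ε hε η hη
  refine ⟨F, ?_⟩
  filter_upwards [hF, hαβ] with n hn hn'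
  rwa [← hn']

theorem WeakLimit.congr' {ι : Type*} {l : Filter ι} {Ω : ι → Type*} [∀ i, MeasurableSpace (Ω i)]
    {Z : Type*} [TopologicalSpace Z] [MeasurableSpace Z] {T : ∀ i, Ω i → Z}
    {P P' : ∀ i, Measure (Ω i)} {ν : Measure Z} (h : WeakLimit l T P ν)
    (hP : ∀ᶠ i in l, P i = P' i) : WeakLimit l T P' ν := fun F =>
  (h F).congr' (hP.mono fun i hi => by rw [hi])

theorem isW₂Geodesic_const {X : Type*} [MetricSpace X] [SecondCountableTopology X]
    [MeasurableSpace X] [BorelSpace X] (μ : ProbabilityMeasure X) : IsW₂Geodesic fun _ => μ :=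
  ⟨by rw [W₂_self]; exact ENNReal.zero_lt_top, fun a _ b _ => by simp [W₂_self]⟩

/-- Time `0` is the midpoint, so the full length is twice the distance from time `0` to time `1`,
which is estimated through the two Dirac masses. -/
theorem IsW₂Geodesic.W₂_le_of_dirac {X : Type*} [MetricSpace X] [CompleteSpace X]
    [SecondCountableTopology X] [MeasurableSpace X] [BorelSpace X] {μ : ℝ → ProbabilityMeasure X}
    (hμ : IsW₂Geodesic μ) {x y : X} {A B : ℝ}
    (hA : 0 ≤ A) (hB : 0 ≤ B) (hx : W₂ (μ 0 : Measure X) (Measure.dirac x) ≤ ENNReal.ofReal A)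
    (hy : W₂ (μ 1 : Measure X) (Measure.dirac y) ≤ ENNReal.ofReal B) :
    W₂ (μ (-1) : Measure X) (μ 1) ≤ ENNReal.ofReal (2 * (A + dist x y + B)) := by
  have h1 := hμ.2 0 (by norm_num) 1 (by norm_num)
  have h2 : W₂ (μ 0 : Measure X) (μ 1) ≤ ENNReal.ofReal (A + dist x y + B) := by
    rw [ENNReal.ofReal_add (by positivity) hB, ENNReal.ofReal_add hA dist_nonneg, ← edist_dist]
    refine (W₂_triangle _ (Measure.dirac y) _).trans (add_le_add ?_ ?_)
    · refine (W₂_triangle _ (Measure.dirac x) _).trans (add_le_add hx ?_)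
      rw [W₂_dirac_dirac]
    · rwa [W₂_comm]
  rw [h1] at h2
  have h3 : W₂ (μ (-1) : Measure X) (μ 1)
      = ENNReal.ofReal 2 * (ENNReal.ofReal (|0 - 1| / 2) * W₂ (μ (-1) : Measure X) (μ 1)) := by
    rw [← mul_assoc, ← ENNReal.ofReal_mul (by norm_num)]
    norm_num
  rw [h3, ENNReal.ofReal_mul (by norm_num)]
  exact mul_le_mul_right h2 _

/-- Passing to the limit in the sum of two entropies. -/
theorem exists_entropy_add_le_of_weakLimit {U : Filter ℕ} [U.NeBot] {X : ℕ → Type*}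
    [∀ n, MeasurableSpace (X n)] {Y : Type*} [MetricSpace Y] [MeasurableSpace Y] [BorelSpace Y]
    {T : ∀ n, X n → Y} (hT : ∀ n, Measurable (T n)) {m α β : ∀ n, Measure (X n)}
    [∀ n, IsProbabilityMeasure (m n)] [∀ n, IsProbabilityMeasure (α n)]
    [∀ n, IsProbabilityMeasure (β n)] {m' α' β' : Measure Y} [IsProbabilityMeasure m']
    [IsProbabilityMeasure α'] [IsProbabilityMeasure β'] (hm : WeakLimit U T m m')
    (hα : WeakLimit U T α α') (hβ : WeakLimit U T β β') {B : ℝ}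
    (h : ∀ ε : ℝ, 0 < ε → ∀ᶠ n in U, ∃ a b : ℝ, entropy (m n) (α n) = a ∧
      entropy (m n) (β n) = b ∧ a + b ≤ B + ε) :
    ∃ a b : ℝ, entropy m' α' = a ∧ entropy m' β' = b ∧ a + b ≤ B := by
  have hlim : ∀ {γ : ∀ n, Measure (X n)} {γ' : Measure Y}, WeakLimit U T γ γ' →
      ∀ φ : BoundedContinuousFunction Y ℝ, Tendsto (fun n => ∫ x, φ (T n x) ∂(γ n)
        - Real.log (∫ x, Real.exp (φ (T n x)) ∂(m n))) U
        (𝓝 (∫ y, φ y ∂γ' - Real.log (∫ y, Real.exp (φ y) ∂m'))) := by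
    intro γ γ' hγ φ
    have hb : ∀ y, |φ y| ≤ ‖φ‖ := fun y => φ.norm_coe_le_norm y
    refine (hγ φ).sub ?_
    have h1 := hm.tendsto_integral (f := fun y => Real.exp (φ y)) (by fun_prop)
      (C := Real.exp ‖φ‖) (fun y => by
        rw [abs_of_pos (Real.exp_pos _)]
        exact Real.exp_le_exp.2 ((le_abs_self _).trans (hb y)))
    have h2 := (integral_exp_pos_of_bounded (q := m') φ.continuous.measurable hb).ne'
    exact (Real.continuousAt_log h2).tendsto.comp h1
  -- The test functions for the two entropies are independent. Taking the supremum over `φ` with `ψ`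
  -- fixed, and then over `ψ`, controls the sum without separate bounds on the two entropies.
  have key : ∀ φ ψ : BoundedContinuousFunction Y ℝ,
      (∫ y, φ y ∂α' - Real.log (∫ y, Real.exp (φ y) ∂m'))
        + (∫ y, ψ y ∂β' - Real.log (∫ y, Real.exp (ψ y) ∂m')) ≤ B := by
    intro φ ψ
    refine le_of_forall_pos_le_add fun ε hε => ?_
    refine le_of_tendsto ((hlim hα φ).add (hlim hβ ψ)) ?_
    filter_upwards [h ε hε] with n ⟨a, b, ha, hb, hab⟩
    have h1 := le_entropy (m := m n) (μ := α n) (φ := fun x => φ (T n x))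
      (φ.continuous.measurable.comp (hT n)) (fun x => φ.norm_coe_le_norm _)
    have h2 := le_entropy (m := m n) (μ := β n) (φ := fun x => ψ (T n x))
      (ψ.continuous.measurable.comp (hT n)) (fun x => ψ.norm_coe_le_norm _)
    rw [ha, EReal.coe_le_coe_iff] at h1
    rw [hb, EReal.coe_le_coe_iff] at h2
    linarith
  have hreal : ∀ {γ : Measure Y} [IsProbabilityMeasure γ] {M : ℝ}, entropy m' γ ≤ (M : EReal) →
      ∃ a : ℝ, entropy m' γ = a := by
    intro γ _ M hM
    refine ⟨_, (EReal.coe_toReal (hM.trans_lt (EReal.coe_lt_top _)).ne fun hb => ?_).symm⟩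
    have := entropy_nonneg (m := m') (μ := γ)
    rw [hb] at this
    simp at this
  have hα1 : ∀ ψ : BoundedContinuousFunction Y ℝ, entropy m' α'
      ≤ ((B - (∫ y, ψ y ∂β' - Real.log (∫ y, Real.exp (ψ y) ∂m')) : ℝ) : EReal) := fun ψ =>
    entropy_le_of_forall_continuous fun φ => by linarith [key φ ψ]
  obtain ⟨a, ha⟩ := hreal (hα1 0)
  have hβ1 : entropy m' β' ≤ ((B - a : ℝ) : EReal) :=
    entropy_le_of_forall_continuous fun ψ => by
      have := hα1 ψ
      rw [ha, EReal.coe_le_coe_iff] at this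
      linarith
  obtain ⟨b, hb⟩ := hreal hβ1
  refine ⟨a, b, ha, hb, ?_⟩
  rw [hb, EReal.coe_le_coe_iff] at hβ1
  linarith

section Stability

variable {X : ℕ → Type*} [∀ n, MetricSpace (X n)] [∀ n, CompleteSpace (X n)]
  [∀ n, SecondCountableTopology (X n)] [∀ n, MeasurableSpace (X n)] [∀ n, BorelSpace (X n)]
  {Y : Type*} [MetricSpace Y] [CompleteSpace Y] [SecondCountableTopology Y] [MeasurableSpace Y]
  [BorelSpace Y] {δ : ∀ n, MetricCoupling (X n) Y} {m : ∀ n, Measure (X n)}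
  [∀ n, IsProbabilityMeasure (m n)] {mY : Measure Y} [IsProbabilityMeasure mY]
  {q : ∀ n, Measure (X n × Y)} {K : ℝ} {Kbar : ℝ → EReal}

/-- The limit of geodesics of bounded length, with asymptotically tight values at `0`, along an
ultrafilter. -/
theorem exists_geodesic_weakLimit (hsupp : ∀ V : Set Y, IsOpen V → V.Nonempty → 0 < mY V)
    (hq : ∀ n, q n ∈ couplings (m n) mY)
    (hqδ : ∀ η : ℝ, 0 < η → Tendsto (fun n => q n {ω | η < (δ n).cross ω.1 ω.2}) atTop (𝓝 0))
    (hRic : ∀ n, HasRobustUpperRicciBoundWith (m n) K Kbar) {U : Ultrafilter ℕ}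
    (hU : (U : Filter ℕ) ≤ atTop) {T : ∀ n, X n → Y} (hT : ∀ n, Measurable (T n))
    (hTδ : ∀ n x y, (δ n).cross x (T n x) ≤ (δ n).cross x y + 1 / ((n : ℝ) + 1))
    {μ : ∀ n, ℝ → ProbabilityMeasure (X n)} (hμ : ∀ n, IsW₂Geodesic (μ n)) {C A : ℝ} (hC : 0 ≤ C)
    (hA : 0 ≤ A)
    (hμC : ∀ᶠ n in atTop, W₂ (μ n (-1) : Measure (X n)) (μ n 1) ≤ ENNReal.ofReal C)
    (h0 : AsympTight δ fun n => (μ n 0 : Measure (X n))) {xs : ∀ n, X n} {x : Y}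
    (hxs : Tendsto (fun n => (δ n).cross (xs n) x) atTop (𝓝 0))
    (hμA : ∀ᶠ n in atTop,
      W₂ (μ n 0 : Measure (X n)) (Measure.dirac (xs n)) ≤ ENNReal.ofReal A) :
    ∃ ν : ℝ → ProbabilityMeasure Y, IsW₂Geodesic ν ∧ ∀ a ∈ Set.Icc (-1 : ℝ) 1,
      TightThrough U T (fun n x => (δ n).cross x (T n x)) (fun n => (μ n a : Measure (X n))) ∧
      WeakLimit U T (fun n => (μ n a : Measure (X n))) (ν a : Measure Y) := by
  classical
  have htight : ∀ a ∈ Set.Icc (-1 : ℝ) 1, TightThrough U T (fun n x => (δ n).cross x (T n x))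
      (fun n => (μ n a : Measure (X n))) := fun a ha =>
    (h0.of_geodesic hsupp hq hqδ hRic hμ hC hμC ha).tightThrough hU hT hTδ
  -- The ultrafilter gives limits at all of the uncountably many times at once. Outside `[-1, 1]`
  -- the value `mY` is a default.
  have hex : ∀ a : ℝ, ∃ ν : ProbabilityMeasure Y, a ∈ Set.Icc (-1 : ℝ) 1 →
      WeakLimit U T (fun n => (μ n a : Measure (X n))) (ν : Measure Y) := by
    intro a
    by_cases ha : a ∈ Set.Icc (-1 : ℝ) 1
    · obtain ⟨ν, hν⟩ := exists_weakLimit U hT _ (htight a ha).tight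
      exact ⟨ν, fun _ => hν⟩
    · exact ⟨⟨mY, inferInstance⟩, fun h => absurd h ha⟩
  choose ν hν using hex
  -- Bounded length and a bounded value at time `0` give finite second moments in the limit, as
  -- needed for optimality of the limit couplings.
  have hmom : ∀ a ∈ Set.Icc (-1 : ℝ) 1, W₂ (ν a : Measure Y) (Measure.dirac x)
      ≤ ENNReal.ofReal (C + A) := by
    intro a ha
    refine W₂_dirac_le_of_weakLimit (l := (U : Filter ℕ)) hT (htight a ha).small (hν a ha)
      (hxs.mono_left hU) (R := fun _ => C + A) (fun _ => by positivity) tendsto_const_nhds (hU ?_)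
    filter_upwards [hμC, hμA] with n h1 h2
    refine (W₂_triangle _ (μ n 0 : Measure (X n)) _).trans ?_
    rw [ENNReal.ofReal_add hC hA, (hμ n).2 a ha 0 (by norm_num)]
    refine add_le_add (le_trans ?_ h1) h2
    refine mul_le_of_le_one_left bot_le (ENNReal.ofReal_le_one.2 ?_)
    rw [sub_zero]
    linarith [abs_le.2 ha]
  have hmom' : ∀ a ∈ Set.Icc (-1 : ℝ) 1, ∫⁻ y, edist y x ^ 2 ∂(ν a : Measure Y) ≠ ⊤ := by
    intro a ha
    rw [← W₂_dirac_sq]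
    exact ENNReal.pow_ne_top (ne_top_of_le_ne_top ENNReal.ofReal_ne_top (hmom a ha))
  refine ⟨ν, isW₂Geodesic_of_between ?_ fun a b c ha hab hbc hc => ?_,
    fun a ha => ⟨htight a ha, hν a ha⟩⟩
  · refine (W₂_triangle _ (Measure.dirac x) _).trans_lt (ENNReal.add_lt_top.2 ⟨?_, ?_⟩)
    · exact (hmom _ (by norm_num)).trans_lt ENNReal.ofReal_lt_top
    · rw [W₂_comm]
      exact (hmom _ (by norm_num)).trans_lt ENNReal.ofReal_lt_top
  · have ha' : a ∈ Set.Icc (-1 : ℝ) 1 := ⟨ha, by linarith⟩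
    have hb' : b ∈ Set.Icc (-1 : ℝ) 1 := ⟨by linarith, by linarith⟩
    have hc' : c ∈ Set.Icc (-1 : ℝ) 1 := ⟨by linarith, hc⟩
    have hac : 0 < c - a := by linarith
    have hθ : 1 - (b - a) / (c - a) = (c - b) / (c - a) := by
      field_simp
      ring
    have hsplit : ∀ n {s t : ℝ}, s ∈ Set.Icc (-1 : ℝ) 1 → t ∈ Set.Icc (-1 : ℝ) 1 → s ≤ t →
        W₂ (μ n s : Measure (X n)) (μ n t)
          = ENNReal.ofReal ((t - s) / (c - a)) * W₂ (μ n a : Measure (X n)) (μ n c) := by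
      intro n s t hs ht hst
      rw [(hμ n).2 s hs t ht, (hμ n).2 a ha' c hc', ← mul_assoc,
        ← ENNReal.ofReal_mul (div_nonneg (by linarith) hac.le), abs_sub_comm s, abs_sub_comm a,
        abs_of_nonneg (by linarith : 0 ≤ t - s), abs_of_pos hac]
      congr 2
      field_simp
    have := W₂_le_of_weakLimit (T := T) (e := fun n x => (δ n).cross x (T n x)) hU hT
      (fun n => (δ n).measurable_cross.comp (measurable_id.prodMk (hT n)))
      (fun n x x' => (δ n).abs_dist_sub_dist_le x x' (T n x) (T n x')) (htight a ha')
      (htight b hb') (htight c hc') (hν a ha') (hν b hb') (hν c hc') (θ := (b - a) / (c - a))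
      (div_pos (by linarith) hac) ((div_lt_one hac).2 (by linarith))
      (L := fun n => W₂ (μ n a : Measure (X n)) (μ n c))
      (fun n => by
        rw [(hμ n).2 a ha' c hc']
        exact ENNReal.mul_ne_top ENNReal.ofReal_ne_top (hμ n).1.ne)
      (fun n => hsplit n ha' hb' hab.le)
      (fun n => by rw [hθ]; exact hsplit n hb' hc' hbc.le) (fun n => rfl) x (hmom' a ha')
      (hmom' c hc')
    rwa [hθ] at this

/-- Stability of the robust upper Ricci bound along a sequence of couplings of quickly vanishing
cost. -/
theorem hasRobustUpperRicciBoundWith_of_couplings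
    (hsupp : ∀ V : Set Y, IsOpen V → V.Nonempty → 0 < mY V)
    (hq : ∀ n, q n ∈ couplings (m n) mY)
    (hcost : ∀ n, ∫⁻ ω, ENNReal.ofReal ((δ n).cross ω.1 ω.2 ^ 2) ∂(q n)
      ≤ ENNReal.ofReal ((1 / ((n : ℝ) + 1)) ^ 4))
    (hRic : ∀ n, HasRobustUpperRicciBoundWith (m n) K Kbar) :
    HasRobustUpperRicciBoundWith mY K Kbar := by
  classical
  refine ⟨(hRic 0).1, fun r hr hKr x y hxy μ₀ hμ₀ => ?_⟩
  have hYne : Nonempty Y := ⟨x⟩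
  have hXne : ∀ n, Nonempty (X n) := fun n => nonempty_of_isProbabilityMeasure (m n)
  have hrecq := isRecovery_of_couplings hq hcost
  have hqδ : ∀ η : ℝ, 0 < η →
      Tendsto (fun n => q n {ω | η < (δ n).cross ω.1 ω.2}) atTop (𝓝 0) := fun η hη =>
    hrecq.tendsto_measure hη
  -- Almost nearest point maps in both directions: `T` brings measures to `Y`, and `R` lifts points
  -- to `X n`.
  choose T hT hTδ using fun n => exists_measurable_almost_minimizer (f := (δ n).cross)
    (δ n).cross_nonneg (δ n).measurable_cross_left
    (fun a => (δ n).continuous_cross.comp (Continuous.prodMk_right a))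
    (by positivity : 0 < 1 / ((n : ℝ) + 1))
  choose R hR hRδ using fun n => exists_measurable_almost_minimizer
    (f := fun (b : Y) (a : X n) => (δ n).cross a b) (fun b a => (δ n).cross_nonneg a b)
    (δ n).measurable_cross_right
    (fun b => (δ n).continuous_cross.comp (Continuous.prodMk_left b))
    (by positivity : 0 < 1 / ((n : ℝ) + 1))
  have hRlim := tendsto_cross_of_almost_nearest hsupp hq hqδ hRδ
  -- the recovery sequence
  obtain ⟨p, hp, hpS⟩ : ∃ p : ∀ n, Measure (X n × Y), IsRecovery δ (μ₀ : Measure Y) p ∧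
      (entropy mY μ₀ ≠ ⊤ → ∃ s : ℕ → ℝ,
        Tendsto s atTop (𝓝 (∫ y, entropyDensity mY μ₀ y ∂mY)) ∧
        ∀ᶠ n in atTop, entropy (m n) ((p n).map Prod.fst) ≤ (s n : EReal)) := by
    by_cases hS : entropy mY (μ₀ : Measure Y) = ⊤
    · refine ⟨_, isRecovery_of_moment hsupp hq hqδ hR hRδ (x := x) ?_, fun h => absurd hS h⟩
      rw [← W₂_dirac_sq]
      exact ENNReal.pow_ne_top hμ₀.ne_top
    · obtain ⟨p, hp, hs⟩ := exists_isRecovery_of_entropy_ne_top hq hcost hS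
      exact ⟨p, hp, fun _ => hs⟩
  have hpprob := hp.prob
  let α : ∀ n, ProbabilityMeasure (X n) := fun n =>
    ⟨(p n).map Prod.fst, Measure.isProbabilityMeasure_map measurable_fst.aemeasurable⟩
  let ρ : ℕ → ℝ := fun n => dist (R n x) (R n y)
  have hρ : Tendsto ρ atTop (𝓝 r) := by
    rw [tendsto_iff_dist_tendsto_zero]
    refine squeeze_zero (fun _ => dist_nonneg) (fun n => ?_)
      (by simpa using (hRlim x).add (hRlim y))
    rw [Real.dist_eq, ← hxy]
    exact (δ n).abs_dist_sub_dist_le _ _ _ _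
  have hρpos : ∀ᶠ n in atTop, 0 < ρ n := hρ.eventually_const_lt hr
  -- The bound is applied in `X n` at distance `ρ n`, not `r`; this is where upper semicontinuity of
  -- `Kbar` enters.
  have hρK : ∀ b : EReal, Kbar r < b → ∀ᶠ n in atTop, Kbar (ρ n) < b := fun b hb =>
    (tendsto_nhdsWithin_iff.2 ⟨hρ, hρpos⟩).eventually ((hRic 0).1.usc r hr b hb)
  have hαW : ∀ᶠ n in atTop, W₂ (α n : Measure (X n)) (Measure.dirac (R n x))
      < ENNReal.ofReal (ρ n ^ 4) := by
    -- The strict inequality leaves room both for the error of the recovery sequence and for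
    -- replacing `r` by `ρ n`.
    obtain ⟨c, hc1, hc2⟩ := exists_between hμ₀
    have hct : c ≠ ⊤ := hc2.ne_top
    rw [← ENNReal.ofReal_toReal hct] at hc1 hc2
    have hc3 : c.toReal < r ^ 4 := (ENNReal.ofReal_lt_ofReal_iff (by positivity)).1 hc2
    filter_upwards [hp.eventually_W₂_dirac_lt (hRlim x) hc1,
      (hρ.pow 4).eventually_const_lt hc3] with n h1 h2
    exact h1.trans_le (ENNReal.ofReal_le_ofReal h2.le)
  -- the geodesics in the approximating spaces
  have hgeo : ∀ n, ∃ μ : ℝ → ProbabilityMeasure (X n), IsW₂Geodesic μ ∧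
      (0 < ρ n → Kbar (ρ n) < ⊤ →
        W₂ (α n : Measure (X n)) (Measure.dirac (R n x)) < ENNReal.ofReal (ρ n ^ 4) →
        μ 0 = α n ∧ W₂ (μ 1 : Measure (X n)) (Measure.dirac (R n y)) ≤ ENNReal.ofReal (ρ n ^ 2) ∧
        entropy (m n) (μ 1) - 2 * entropy (m n) (μ 0) + entropy (m n) (μ (-1))
          ≤ Kbar (ρ n) * ((ρ n ^ 2 : ℝ) : EReal)) := by
    intro n
    by_cases h : 0 < ρ n ∧ Kbar (ρ n) < ⊤ ∧
      W₂ (α n : Measure (X n)) (Measure.dirac (R n x)) < ENNReal.ofReal (ρ n ^ 4)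
    · obtain ⟨μ, h1, h2⟩ := (hRic n).2 (ρ n) h.1 h.2.1 (R n x) (R n y) rfl (α n) h.2.2
      exact ⟨μ, h1, fun _ _ _ => h2⟩
    -- The constant curve at the finitely many bad indices keeps `μ n` a geodesic for every `n`.
    · exact ⟨fun _ => α n, isW₂Geodesic_const _, fun h1 h2 h3 => absurd ⟨h1, h2, h3⟩ h⟩
  choose μ hμ hμ' using hgeo
  have hgood : ∀ᶠ n in atTop, μ n 0 = α n ∧
      W₂ (μ n 1 : Measure (X n)) (Measure.dirac (R n y)) ≤ ENNReal.ofReal (ρ n ^ 2) ∧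
      entropy (m n) (μ n 1) - 2 * entropy (m n) (μ n 0) + entropy (m n) (μ n (-1))
        ≤ Kbar (ρ n) * ((ρ n ^ 2 : ℝ) : EReal) := by
    filter_upwards [hρpos, hρK ⊤ hKr, hαW] with n h1 h2 h3
    exact hμ' n h1 h2 h3
  have hρr : ∀ᶠ n in atTop, ρ n < r + 1 := hρ.eventually_lt_const (by linarith)
  have hμA : ∀ᶠ n in atTop, W₂ (μ n 0 : Measure (X n)) (Measure.dirac (R n x))
      ≤ ENNReal.ofReal ((r + 1) ^ 4) := by
    filter_upwards [hgood, hαW, hρr] with n h1 h2 h3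
    rw [h1.1]
    refine h2.le.trans (ENNReal.ofReal_le_ofReal ?_)
    exact pow_le_pow_left₀ dist_nonneg h3.le 4
  have hμC : ∀ᶠ n in atTop, W₂ (μ n (-1) : Measure (X n)) (μ n 1)
      ≤ ENNReal.ofReal (2 * ((r + 1) ^ 4 + (r + 1) + (r + 1) ^ 2)) := by
    filter_upwards [hgood, hμA, hρr] with n h1 h2 h3
    refine ((hμ n).W₂_le_of_dirac (by positivity) (by positivity) h2 h1.2.1).trans
      (ENNReal.ofReal_le_ofReal ?_)
    have h4 : ρ n ^ 2 ≤ (r + 1) ^ 2 := pow_le_pow_left₀ dist_nonneg h3.le 2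
    have h5 : dist (R n x) (R n y) ≤ r + 1 := h3.le
    linarith
  have h0 : AsympTight δ fun n => (μ n 0 : Measure (X n)) :=
    hp.asympTight.congr' (hgood.mono fun n hn => by rw [hn.1]; rfl)
  let U : Ultrafilter ℕ := hyperfilter ℕ
  have hU : (U : Filter ℕ) ≤ atTop := Nat.hyperfilter_le_atTop
  obtain ⟨ν, hνgeo, hν⟩ := exists_geodesic_weakLimit hsupp hq hqδ hRic hU hT hTδ hμ
    (by positivity) (by positivity) hμC h0 (hRlim x) hμA
  have hν0 : ν 0 = μ₀ := by
    have h1 : WeakLimit U T (fun n => (μ n 0 : Measure (X n))) (μ₀ : Measure Y) :=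
      ((hp.weakLimit hT hTδ).mono_filter hU).congr'
        (hU (hgood.mono fun n hn => by rw [hn.1]; rfl))
    have h2 : (ν 0 : Measure Y) = (μ₀ : Measure Y) := (hν 0 (by norm_num)).2.unique h1
    exact Subtype.ext h2
  refine ⟨ν, hνgeo, hν0, ?_, ?_⟩
  · refine W₂_dirac_le_of_weakLimit (l := (U : Filter ℕ)) hT (hν 1 (by norm_num)).1.small
      (hν 1 (by norm_num)).2 ((hRlim y).mono_left hU) (R := fun n => ρ n ^ 2)
      (fun n => sq_nonneg _) ((hρ.pow 2).mono_left hU) (hU (hgood.mono fun n hn => hn.2.1))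
  · rw [hν0]
    by_cases hS : entropy mY (μ₀ : Measure Y) = ⊤
    · rw [hS, EReal.mul_top_of_pos (by norm_num), EReal.sub_top, EReal.bot_add]
      exact bot_le
    obtain ⟨s, hs, hsS⟩ := hpS hS
    rw [entropy_of_integrable (absolutelyContinuous_of_entropy_ne_top hS)
      (integrable_entropyDensity_of_entropy_ne_top hS)]
    set S := ∫ y, entropyDensity mY μ₀ y ∂mY
    obtain ⟨k, hk⟩ : ∃ k : ℝ, Kbar r = k :=
      ⟨_, (EReal.coe_toReal hKr.ne ((hRic 0).1.ne_bot r hr)).symm⟩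
    have hmlim : WeakLimit U T m mY :=
      ((hrecq.weakLimit hT hTδ).mono_filter hU).congr' (Eventually.of_forall fun n => (hq n).1)
    obtain ⟨a, b, ha, hb, hab⟩ := exists_entropy_add_le_of_weakLimit hT hmlim
      (hν 1 (by norm_num)).2 (hν (-1) (by norm_num)).2 (B := k * r ^ 2 + 2 * S) (by
        intro ε hε
        -- Half of `ε` pays for the slack `κ` in `Kbar (ρ n) < k + κ`; the other half is left for
        -- the convergence of `ρ n` and `s n`.
        set κ := ε / (2 * r ^ 2) with hκ
        have hκ0 : 0 < κ := by positivity
        have hκr : κ * r ^ 2 = ε / 2 := by rw [hκ]; field_simp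
        have hlim : Tendsto (fun n => (k + κ) * ρ n ^ 2 + 2 * s n) atTop
            (𝓝 ((k + κ) * r ^ 2 + 2 * S)) := ((hρ.pow 2).const_mul _).add (hs.const_mul 2)
        refine hU ?_
        filter_upwards [hgood, hsS, hlim.eventually_lt_const
          (show (k + κ) * r ^ 2 + 2 * S < k * r ^ 2 + 2 * S + ε by linarith [add_mul k κ (r ^ 2)]),
          hρK ((k + κ : ℝ) : EReal) (by rw [hk, EReal.coe_lt_coe_iff]; linarith)] with n h1 h2 h3 h4
        have h5 : entropy (m n) (μ n 0) ≤ (s n : EReal) := by rw [h1.1]; exact h2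
        have h6 : entropy (m n) (μ n 0 : Measure (X n)) ≠ ⊤ := (h5.trans_lt (EReal.coe_lt_top _)).ne
        have h7 : entropy (m n) (μ n 0 : Measure (X n)) ≠ ⊥ := fun hbot => by
          have := entropy_nonneg (m := m n) (μ := (μ n 0 : Measure (X n)))
          rw [hbot] at this
          simp at this
        have h8 := h1.2.2
        rw [← EReal.coe_toReal h6 h7] at h5 h8
        rw [EReal.coe_le_coe_iff] at h5
        have h9 : Kbar (ρ n) * ((ρ n ^ 2 : ℝ) : EReal) ≤ (((k + κ) * ρ n ^ 2 : ℝ) : EReal) := by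
          rw [EReal.coe_mul]
          exact mul_le_mul_of_nonneg_right h4.le (by exact_mod_cast sq_nonneg (ρ n))
        obtain ⟨a, b, ha, hb, hab⟩ := EReal_add_le_of_sub_two_mul_add_le entropy_nonneg
          entropy_nonneg (h8.trans h9)
        exact ⟨a, b, ha, hb, by linarith⟩)
    have h2 : (2 : EReal) = ((2 : ℝ) : EReal) := rfl
    rw [ha, hb, hk, h2, ← EReal.coe_mul, ← EReal.coe_mul, ← EReal.coe_sub, ← EReal.coe_add,
      EReal.coe_le_coe_iff]
    linarith

theorem exists_couplings_of_D₂_lt {X Y : Type*} [MetricSpace X] [MeasurableSpace X]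
    [MetricSpace Y] [MeasurableSpace Y] {m : Measure X} {m' : Measure Y} {c : ℝ≥0∞}
    (h : D₂ m m' < c) : ∃ (δ : MetricCoupling X Y) (q : Measure (X × Y)), q ∈ couplings m m' ∧
      ∫⁻ ω, ENNReal.ofReal (δ.cross ω.1 ω.2 ^ 2) ∂q ≤ c ^ 2 := by
  have h1 : D₂ m m' ^ 2 < c ^ 2 := lt_of_not_ge fun hge => h.not_ge (sq_le_sq_ennreal.1 hge)
  have h2 : D₂ m m' ^ 2 = ⨅ δ : MetricCoupling X Y, ⨅ q ∈ couplings m m',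
      ∫⁻ p, ENNReal.ofReal (δ.d (Sum.inl p.1) (Sum.inr p.2) ^ 2) ∂q := by
    rw [D₂, ← ENNReal.rpow_natCast, ← ENNReal.rpow_mul]
    norm_num
  rw [h2] at h1
  simp only [iInf_lt_iff] at h1
  obtain ⟨δ, q, hq, hlt⟩ := h1
  exact ⟨δ, q, hq, hlt.le⟩

end Stability

end SyntheticRicci

end

/-! ### From convergence in `D₂` to couplings of quickly vanishing cost -/

theorem mainTheorem3 {X : ℕ → Type*} {Y : Type*}
    [∀ n, MetricSpace (X n)] [∀ n, CompleteSpace (X n)] [∀ n, SecondCountableTopology (X n)]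
    [∀ n, MeasurableSpace (X n)] [∀ n, BorelSpace (X n)]
    [MetricSpace Y] [CompleteSpace Y] [SecondCountableTopology Y]
    [MeasurableSpace Y] [BorelSpace Y] [LocallyCompactSpace Y]
    (m : ∀ n, Measure (X n)) [∀ n, IsProbabilityMeasure (m n)]
    (hm : ∀ n, SyntheticRicci.IsMMSpace (m n))
    (mY : Measure Y) [IsProbabilityMeasure mY] (hmY : SyntheticRicci.IsMMSpace mY)
    (K : ℝ) (Kbar : ℝ → EReal)
    (hRic : ∀ n, SyntheticRicci.HasRobustUpperRicciBoundWith (m n) K Kbar)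
    (hconv : Tendsto (fun n => SyntheticRicci.D₂ (m n) mY) atTop (𝓝 0)) :
    SyntheticRicci.HasRobustUpperRicciBoundWith mY K Kbar := by
  -- A selection of indices suffices, as the conclusion concerns the limit space alone. Squaring the
  -- bound on `D₂` gives the fourth power required of the cost.
  have hex : ∀ j : ℕ, ∃ n : ℕ,
      SyntheticRicci.D₂ (m n) mY < ENNReal.ofReal ((1 / ((j : ℝ) + 1)) ^ 2) := fun j =>
    (hconv.eventually_lt_const (ENNReal.ofReal_pos.2 (by positivity))).exists
  choose φ hφ using hex
  choose δ q hq hcost using fun j => SyntheticRicci.exists_couplings_of_D₂_lt (hφ j)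
  refine SyntheticRicci.hasRobustUpperRicciBoundWith_of_couplings (m := fun j => m (φ j))
    hmY.fullSupport hq (fun j => (hcost j).trans (le_of_eq ?_)) fun j => hRic (φ j)
  rw [← ENNReal.ofReal_pow (by positivity), ← pow_mul]
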